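/- **Notation.** Throughout, $p$ denotes a prime, $\mu$ the Möbius function, and $e(t)=\exp(2\pi i t)$. Let $x$ be a large integer with $x\equiv 3 \pmod 4$, and put $$W=2\prod_{p\le 0.1\log\log x}p,\qquad U_1=x^{(\log\log x)^{-4}},\qquad U_2=x^{1/3},$$ $$z=x^{0.265/2},\quad z_1=x^{0.183/2},\quad z_0=e^{(\log x)^{1/3}},\quad D_0=e^{(\log x)^{2/3}},\quad D_1=x^{1/3-10^{-7}}.$$ *Sieves.* For real $D$ and $\beta\in\mathbb N$, let $\mathcal D^+(D,\beta)$ (resp. $\mathcal D^-(D,\beta)$) be the set of all $d=p_1\cdots p_n$ with primes $p_1>\dots>p_n$, $n\ge 0$, such that $p_1\cdots p_m\,p_m^{\beta}<D$ for all odd (resp. even) $m$ with $1\le m\le n$. For a positive integer $n$ set $$\theta^\pm(n;D,D_0,y,z_0)=\Bigl(\sum_{\substack{d\mid n,\ d\mid \prod_{p\le z_0}p\\ d\in\mathcal D^\pm(D_0,10)}}\mu(d)\Bigr)\Bigl(\sum_{\substack{d\mid n,\ d\mid \prod_{z_0<p\le y}p\\ d\in\mathcal D^\pm(D,2)}}\mu(d)\Bigr).$$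 For positive integers $l$ set $$\omega_1(l)=\theta^+(l;D_1,D_0,z_1,z_0)\log\sqrt x,\qquad \omega_2(l)=-\frac{\log\sqrt x}{2}\sum_{\substack{z_1\le p<z\\ l=pm}}\theta^-(m;D_1/p,D_0,z_1,z_0).$$ *Minor arcs.* Let $\mathfrak M$ be the set of $\gamma\in[0,1]$ for which there are an integer $1\le q\le(\log x)^{10^5}$ and an integer $a$ coprime to $q$ with $|\gamma-a/q|\le(\log x)^{10^5}x^{-1}$, and let $\mathfrak m=[0,1]\setminus\mathfrak M$. *Sequences.* For an integer $1\le b\le W$ with $(b,W)=1$ and $b\equiv1\pmod 4$, for $\gamma\in\mathbb R$ and $i\in\{1,2\}$, let $$c_i(n,\gamma)=e(\gamma n)\sum_{\substack{n=k^2+l^2\\ k\in\mathbb Z,\ l\ge1}}\omega_i(l)\quad\text{if } n\le x \text{ and } n\equiv b\pmod W,$$ and $c_i(n,\gamma)=0$ otherwise. **Lemma.** There are absolute constants $C>0$ and $x_0$ such that for all integers $x\ge x_0$ with $x\equiv3\pmod4$, all $b$ as above, all $\gamma\in\mathfrak m$, all $i\in\{1,2\}$, and all complex sequences $(\alpha_n)$,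 $(\beta_d)$ such that $|\alpha_n|$ is at most the number of distinct prime divisors of $n$, $|\beta_d|\le1$, and $\beta_d=0$ unless $d$ is prime, we have $$\Bigl|\sum_{U_1\le d<U_2}\beta_d\sum_{\substack{n\ge1\\(d,n)=1}}\alpha_n\,c_i(dn,\gamma)\Bigr|\le C\,x(\log x)^{-24}.$$ -/

import Mathlib

namespace FouvryIwaniec

/-- `e(t) = exp(2 π i t)`. -/
noncomputable def e (t : ℝ) : ℂ := Complex.exp (2 * (Real.pi : ℂ) * Complex.I * (t : ℂ))

/-! ### Beta-sieve weights and the composed sieve -/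

/-- For `Q = Odd` this is membership in `𝒟⁺(D, β)`, for `Q = Even` membership in `𝒟⁻(D, β)`:
`d = p₁ ⋯ pₙ` with primes `p₁ > ⋯ > pₙ` and `p₁ ⋯ pₘ pₘ ^ β < D` for all `1 ≤ m ≤ n` with `Q m`.
If `p = pₘ`, then `p₁, …, pₘ` are exactly the prime divisors `q ≥ p` of `d`. -/
def BetaSupport (Q : ℕ → Prop) (D : ℝ) (β d : ℕ) : Prop :=
  Squarefree d ∧ ∀ p ∈ d.primeFactors,
    Q (d.primeFactors.filter (fun q => p ≤ q)).card →
      (∏ q ∈ d.primeFactors.filter (fun q => p ≤ q), (q : ℝ)) * (p : ℝ) ^ β < D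

open Classical in
/-- The beta-sieve weights of level `D`: `λ⁺_d(D, β)` for `Q = Odd`, `λ⁻_d(D, β)` for `Q = Even`. -/
noncomputable def betaWeight (Q : ℕ → Prop) (D : ℝ) (β d : ℕ) : ℝ :=
  if BetaSupport Q D β d then (ArithmeticFunction.moebius d : ℝ) else 0

/-- `P(z, z₀)`, the product of the primes `z₀ < p ≤ z`. -/
noncomputable def primeProd (z z₀ : ℝ) : ℕ :=
  ∏ p ∈ (Finset.Icc 1 ⌊z⌋₊).filter (fun p : ℕ => p.Prime ∧ z₀ < (p : ℝ)), p

/-- The beta-sieve of level `D` with sifting range `P`. -/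
noncomputable def betaSieve (Q : ℕ → Prop) (D : ℝ) (β P n : ℕ) : ℝ :=
  ∑ d ∈ n.divisors.filter (fun d => d ∣ P), betaWeight Q D β d

/-- The composed sieve `θ^±(n; D, D₀, z, z₀)`: the beta-sieve with `β = 10`, level `D₀` on the
primes `p ≤ z₀`, times the beta-sieve with `β = 2`, level `D` on the primes `z₀ < p ≤ z`. -/
noncomputable def theta (Q : ℕ → Prop) (n : ℕ) (D D₀ z z₀ : ℝ) : ℝ :=
  betaSieve Q D₀ 10 (primeProd z₀ 0) n * betaSieve Q D 2 (primeProd z z₀) n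

/-- The upper bound sieve `θ⁺`. -/
noncomputable def thetaPlus (n : ℕ) (D D₀ z z₀ : ℝ) : ℝ := theta Odd n D D₀ z z₀

/-- The lower bound sieve `θ⁻`. -/
noncomputable def thetaMinus (n : ℕ) (D D₀ z z₀ : ℝ) : ℝ := theta Even n D D₀ z z₀

/-! ### Parameters, all depending on `x` only -/

/-- `z = x ^ (ξ / 2)` with `ξ = 0.265`. -/
noncomputable def paramZ (x : ℕ) : ℝ := (x : ℝ) ^ ((0.265 : ℝ) / 2)

/-- `z₁ = x ^ (ξ₁ / 2)` with `ξ₁ = 0.183`. -/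
noncomputable def paramZ1 (x : ℕ) : ℝ := (x : ℝ) ^ ((0.183 : ℝ) / 2)

/-- `z₀ = exp ((log x) ^ (1/3))`. -/
noncomputable def paramZ0 (x : ℕ) : ℝ := Real.exp (Real.log x ^ ((1 : ℝ) / 3))

/-- `D₀ = exp ((log x) ^ (2/3))`. -/
noncomputable def paramD0 (x : ℕ) : ℝ := Real.exp (Real.log x ^ ((2 : ℝ) / 3))

/-- `D₁ = x ^ (1/3 - δ₀)` with `δ₀ = 10⁻⁷`. -/
noncomputable def paramD1 (x : ℕ) : ℝ := (x : ℝ) ^ ((1 : ℝ) / 3 - 1 / 10 ^ 7)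

/-- `U₁ = x ^ ((log log x)⁻⁴)`. -/
noncomputable def paramU1 (x : ℕ) : ℝ := (x : ℝ) ^ (1 / Real.log (Real.log x) ^ 4)

/-- `U₂ = x ^ (1/3)`. -/
noncomputable def paramU2 (x : ℕ) : ℝ := (x : ℝ) ^ ((1 : ℝ) / 3)

/-- `W = 2 ∏_{p ≤ w} p` with `w = 0.1 log log x`. -/
noncomputable def paramW (x : ℕ) : ℕ := 2 * primeProd (0.1 * Real.log (Real.log x)) 0

/-! ### The weights `ω₁`, `ω₂` and the sequences `c_i` -/

/-- `ω₁(l, x) = θ⁺(l; D₁, D₀, z₁, z₀) log √x`. -/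
noncomputable def omega1 (x l : ℕ) : ℝ :=
  thetaPlus l (paramD1 x) (paramD0 x) (paramZ1 x) (paramZ0 x) * Real.log (Real.sqrt x)

/-- `ω₂(l, x) = - (1/2) log √x ∑_{z₁ ≤ p < z, l = p m} θ⁻(m; D₁ / p, D₀, z₁, z₀)`, `p` prime. -/
noncomputable def omega2 (x l : ℕ) : ℝ :=
  -(1 / 2) * (∑ p ∈ l.primeFactors.filter (fun p : ℕ => paramZ1 x ≤ (p : ℝ) ∧ (p : ℝ) < paramZ x),
    thetaMinus (l / p) (paramD1 x / p) (paramD0 x) (paramZ1 x) (paramZ0 x)) *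
    Real.log (Real.sqrt x)

/-- `∑_{n = k² + l²} ω(l)`, over integers `k` and positive integers `l`. -/
noncomputable def sumTwoSquares (ω : ℕ → ℝ) (n : ℕ) : ℝ :=
  ∑ l ∈ Finset.Icc 1 n,
    ∑ _k ∈ (Finset.Icc (-(n : ℤ)) n).filter (fun k : ℤ => k ^ 2 + (l : ℤ) ^ 2 = n), ω l

/-- `c(n, γ) = e(γ n) ∑_{n = k² + l²} ω(l)` if `n ≤ x` and `n ≡ b (W)`, and `0` otherwise. -/
noncomputable def cSeq (ω : ℕ → ℝ) (x W b : ℕ) (γ : ℝ) (n : ℕ) : ℂ :=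
  if n ≤ x ∧ n ≡ b [MOD W] then e (γ * n) * (sumTwoSquares ω n : ℂ) else 0

/-- The Type II sum `∑_{U₁ ≤ d < U₂} β_d ∑_{n, (d, n) = 1} α_n c(d n)` of a sequence `c` that
vanishes beyond `x`, so that only `1 ≤ n ≤ x` matter. -/
noncomputable def typeII (U₁ U₂ : ℝ) (x : ℕ) (α β c : ℕ → ℂ) : ℂ :=
  ∑ d ∈ Finset.Ico ⌈U₁⌉₊ ⌈U₂⌉₊, β d *
    ∑ n ∈ (Finset.Icc 1 x).filter (fun n => Nat.Coprime d n), α n * c (d * n)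

/-! ### Major and minor arcs -/

/-- `𝔐(q, a)`, with `A_𝔐 = 10⁵`. -/
def majorArc (x q : ℕ) (a : ℤ) : Set ℝ :=
  {γ | γ ∈ Set.Icc (0 : ℝ) 1 ∧ |γ - a / q| ≤ Real.log x ^ (10 ^ 5 : ℕ) / x}

/-- `𝔐`, the union of the `𝔐(q, a)` over `1 ≤ q ≤ (log x) ^ A_𝔐` and integers `a` coprime to `q`. -/
def majorArcs (x : ℕ) : Set ℝ :=
  {γ | ∃ (q : ℕ) (a : ℤ), 1 ≤ q ∧ (q : ℝ) ≤ Real.log x ^ (10 ^ 5 : ℕ) ∧ IsCoprime a (q : ℤ) ∧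
    γ ∈ majorArc x q a}

/-- `𝔪 = [0, 1] \ 𝔐`. -/
def minorArcs (x : ℕ) : Set ℝ := Set.Icc (0 : ℝ) 1 \ majorArcs x

end FouvryIwaniec

/-!
The sum is of Type II, and the argument is a bilinear one in the Gaussian integers.

*The weights.* Sieve weights enter only as divisor sums: for both `i`, `ωᵢ(l) = ∑_{f ∣ l} λ_f` with
`λ_f ≪ (log x) ^ 2` supported on `f ≤ G = D₁ D₀`, and `G` is smaller than `x ^ (1/3)` by more than
any power of `log x` (`omega1_eq_divWeight`, `omega2_eq_divWeight`).

*Reductions.* The congruence modulo `W ≤ log x` is expanded into additive characters, which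
replaces `γ` by the translates `γ + j / W` (`norm_typeII_le`). As `γ` is on the minor arcs, each of
these has an approximation `a / q` with `(log x) ^ 1000 ≤ q ≤ x / (log x) ^ 1000`
(`exists_approx`). The primes `d` are restricted to dyadic blocks `[D, 2 D)` (`norm_fullSum_le`).

*Gaussian integers.* If `d` is prime and `(d, n) = 1`, then each `k + i l` of norm `d n` is a
product `ρ u` with `N(ρ) = d` and `N(u) = n` in exactly four ways, and `l = Im (ρ u)`
(`four_mul_sumTwoSquares`). Cauchy's inequality over `u` removes `α` and leads to the correlations
`∑_u ω(Im (ρ₁ u)) ω(Im (ρ₂ u)) e(γ h N(u))` with `h = N(ρ₁) - N(ρ₂)` (`sq_bilinearSum_le`). The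
pairs with `h = 0`, and the terms with `d ∣ n`, are few and are controlled by divisor moments.

*Lattices.* In the correlations with `h ≠ 0` the weights are opened. Then `u` runs over a convex
part of the lattice `f₁ ∣ Im (ρ₁ u)`, `f₂ ∣ Im (ρ₂ u)`. Instead of choosing a basis, the sum is
translated by `a v`, where `1 ≤ a ≤ M = (log x) ^ 900` roughly, and averaged over `a` and over all
vectors `v` of the lattice in a box of side `V`, `M V ≈ (x / D) ^ (1/2)`; by pigeonhole there are
enough such `v` (`norm_sum_lattice_le`). In `a` the phase is quadratic with leading coefficient
`γ h N(v)`, and Weyl differencing applies (`norm_quadratic_sum_le`). The sum over `f₁`, `f₂` now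
merely counts the divisors of `Im (ρ₁ v)` and `Im (ρ₂ v)` (`norm_correlation_le`). Only the lines
on which one of these vanishes need the level `G` to be less than `V`; elsewhere they are bounded
on average by moments of the divisor function (`sum_pairTerm_le`).

*Equidistribution.* It remains to bound the number of `(h, v, t)` for which `2 γ h N(v) t` is close
to an integer. The norms `N(v)` and the differences `h` are attained with bounded multiplicity on
average (`energy_nrm_le`), which leaves the integers `n ≤ N`, weighted by powers of the divisor
function, for which `γ n` is close to an integer. Since `q` and `x / q` are large powers of
`log x`, these are rare (`card_nearInt_le`, `sum_weylBound_sq_le`), and all losses, which are fixed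
powers of `log x`, are recovered (`norm_bilinearSum_le_of_minor`).
-/

namespace FouvryIwaniec

/-! ### Moments of the divisor function -/

/-- The number of divisors of `n`, as a real number; `tau 0 = 0`. -/
noncomputable def tau (n : ℕ) : ℝ := (n.divisors.card : ℝ)

lemma tau_nonneg (n : ℕ) : 0 ≤ tau n := Nat.cast_nonneg _

lemma one_le_tau {n : ℕ} (hn : n ≠ 0) : 1 ≤ tau n := by
  have : 0 < n.divisors.card := Finset.card_pos.mpr ⟨1, Nat.one_mem_divisors.mpr hn⟩
  show (1 : ℝ) ≤ (n.divisors.card : ℝ)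
  exact_mod_cast this

lemma tau_mul_le (m n : ℕ) : tau (m * n) ≤ tau m * tau n := by
  unfold tau
  rw [Nat.divisors_mul]
  exact_mod_cast Finset.card_mul_le

lemma sum_tau_mul (f : ℕ → ℝ) (N : ℕ) :
    ∑ n ∈ Finset.Icc 1 N, tau n * f n =
      ∑ d ∈ Finset.Icc 1 N, ∑ m ∈ Finset.Icc 1 (N / d), f (d * m) := by
  have h1 : ∀ n ∈ Finset.Icc 1 N, tau n * f n = ∑ _d ∈ n.divisors, f n := by
    intro n _
    simp [tau]
  rw [Finset.sum_congr rfl h1]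
  rw [Finset.sum_comm' (t' := Finset.Icc 1 N)
    (s' := fun d => (Finset.Icc 1 N).filter (fun n => d ∣ n))]
  · refine Finset.sum_congr rfl fun d hd => ?_
    obtain ⟨hd1, hd2⟩ := Finset.mem_Icc.mp hd
    symm
    refine Finset.sum_bij (fun m _ => d * m) ?_ ?_ ?_ ?_
    · intro m hm
      obtain ⟨hm1, hm2⟩ := Finset.mem_Icc.mp hm
      simp only [Finset.mem_filter, Finset.mem_Icc, dvd_mul_right, and_true]
      refine ⟨Nat.mul_pos hd1 hm1, ?_⟩
      calc d * m ≤ d * (N / d) := Nat.mul_le_mul_left _ hm2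
        _ ≤ N := Nat.mul_div_le N d
    · intro m₁ _ m₂ _ h
      exact Nat.eq_of_mul_eq_mul_left hd1 h
    · intro n hn
      simp only [Finset.mem_filter, Finset.mem_Icc] at hn
      obtain ⟨⟨hn1, hn2⟩, m, rfl⟩ := hn
      refine ⟨m, ?_, rfl⟩
      rw [Finset.mem_Icc]
      refine ⟨Nat.pos_of_ne_zero fun h => by simp [h] at hn1, ?_⟩
      rw [Nat.le_div_iff_mul_le hd1]
      linarith [mul_comm m d]
    · intros; rfl
  · intro n d
    simp only [Finset.mem_Icc, Nat.mem_divisors, Finset.mem_filter]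
    constructor
    · rintro ⟨⟨h1, h2⟩, h3, h4⟩
      exact ⟨⟨⟨h1, h2⟩, h3⟩, Nat.pos_of_dvd_of_pos h3 h1, (Nat.le_of_dvd h1 h3).trans h2⟩
    · rintro ⟨⟨⟨h1, h2⟩, h3⟩, _, _⟩
      exact ⟨⟨h1, h2⟩, h3, by omega⟩

lemma sum_one_div_le (N : ℕ) : ∑ n ∈ Finset.Icc 1 N, (1 : ℝ) / n ≤ 1 + Real.log N := by
  have h := harmonic_le_one_add_log N
  rw [harmonic_eq_sum_Icc] at h
  push_cast at h
  simpa using h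

lemma sum_tau_pow_div_le (k N : ℕ) :
    ∑ n ∈ Finset.Icc 1 N, tau n ^ k / n ≤ (1 + Real.log N) ^ 2 ^ k := by
  induction k with
  | zero => simpa using sum_one_div_le N
  | succ k ih =>
    have h1 : ∑ n ∈ Finset.Icc 1 N, tau n ^ (k + 1) / n
        = ∑ n ∈ Finset.Icc 1 N, tau n * (tau n ^ k / n) :=
      Finset.sum_congr rfl fun n _ => by ring
    rw [h1, sum_tau_mul]
    have h0 : ∀ n : ℕ, 0 ≤ tau n ^ k / n := fun n =>
      div_nonneg (pow_nonneg (tau_nonneg n) k) (Nat.cast_nonneg n)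
    calc ∑ d ∈ Finset.Icc 1 N, ∑ m ∈ Finset.Icc 1 (N / d), tau (d * m) ^ k / ((d * m : ℕ) : ℝ)
        ≤ ∑ d ∈ Finset.Icc 1 N, ∑ m ∈ Finset.Icc 1 N, tau d ^ k / d * (tau m ^ k / m) := by
          refine Finset.sum_le_sum fun d _ => ?_
          refine (Finset.sum_le_sum fun m _ => ?_).trans
            (Finset.sum_le_sum_of_subset_of_nonneg
              (Finset.Icc_subset_Icc_right (Nat.div_le_self N d)) fun m _ _ =>
                mul_nonneg (h0 d) (h0 m))
          rw [div_mul_div_comm, ← mul_pow, Nat.cast_mul]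
          gcongr
          · exact tau_nonneg _
          · exact tau_mul_le d m
      _ = (∑ n ∈ Finset.Icc 1 N, tau n ^ k / n) ^ 2 := by
          rw [sq, Finset.sum_mul_sum]
      _ ≤ ((1 + Real.log N) ^ 2 ^ k) ^ 2 := by
          refine pow_le_pow_left₀ (Finset.sum_nonneg fun n _ => h0 n) ih 2
      _ = _ := by rw [← pow_mul, ← pow_succ]

/-- Moments of the divisor function, by induction on `k`: one factor `tau n` is opened as a sum over
`n = d m`, and `tau (d m) ≤ tau d * tau m` separates the variables. -/
lemma sum_tau_pow_le (k N : ℕ) : ∀ N' ≤ N,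
    ∑ n ∈ Finset.Icc 1 N', tau n ^ k ≤ N' * (1 + Real.log N) ^ (2 ^ k - 1) := by
  induction k with
  | zero => intro N' _; simp
  | succ k ih =>
    intro N' hN'
    have h1 : ∑ n ∈ Finset.Icc 1 N', tau n ^ (k + 1)
        = ∑ n ∈ Finset.Icc 1 N', tau n * tau n ^ k :=
      Finset.sum_congr rfl fun n _ => by ring
    have hlog : 0 ≤ 1 + Real.log (N : ℝ) := by
      have := Real.log_natCast_nonneg N
      linarith
    have h0 : ∀ n : ℕ, 0 ≤ tau n ^ k := fun n => pow_nonneg (tau_nonneg n) k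
    rw [h1, sum_tau_mul]
    calc ∑ d ∈ Finset.Icc 1 N', ∑ m ∈ Finset.Icc 1 (N' / d), tau (d * m) ^ k
        ≤ ∑ d ∈ Finset.Icc 1 N',
            tau d ^ k * (((N' : ℝ) / d) * (1 + Real.log N) ^ (2 ^ k - 1)) := by
          refine Finset.sum_le_sum fun d _ => ?_
          calc ∑ m ∈ Finset.Icc 1 (N' / d), tau (d * m) ^ k
              ≤ ∑ m ∈ Finset.Icc 1 (N' / d), tau d ^ k * tau m ^ k := by
                refine Finset.sum_le_sum fun m _ => ?_
                rw [← mul_pow]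
                exact pow_le_pow_left₀ (tau_nonneg _) (tau_mul_le d m) k
            _ = tau d ^ k * ∑ m ∈ Finset.Icc 1 (N' / d), tau m ^ k := by
                rw [Finset.mul_sum]
            _ ≤ tau d ^ k * (((N' / d : ℕ) : ℝ) * (1 + Real.log N) ^ (2 ^ k - 1)) :=
                mul_le_mul_of_nonneg_left (ih _ ((Nat.div_le_self _ _).trans hN')) (h0 d)
            _ ≤ _ := by
                gcongr
                · exact h0 d
                · exact Nat.cast_div_le
      _ = N' * (1 + Real.log N) ^ (2 ^ k - 1) * ∑ d ∈ Finset.Icc 1 N', tau d ^ k / d := by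
          rw [Finset.mul_sum]
          refine Finset.sum_congr rfl fun d _ => by ring
      _ ≤ N' * (1 + Real.log N) ^ (2 ^ k - 1) * (1 + Real.log N) ^ 2 ^ k := by
          refine mul_le_mul_of_nonneg_left ?_ (by positivity)
          refine (Finset.sum_le_sum_of_subset_of_nonneg (Finset.Icc_subset_Icc_right hN')
            fun m _ _ => div_nonneg (h0 m) (Nat.cast_nonneg m)).trans (sum_tau_pow_div_le k N)
      _ = _ := by
          rw [mul_assoc, ← pow_add]
          congr 2
          have := Nat.one_le_two_pow (n := k)
          rw [pow_succ]
          omega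

/-! ### Fibres and energies -/

lemma sum_comp_eq {ι κ : Type*} [DecidableEq κ] (s : Finset ι) (t : Finset κ) (g : ι → κ)
    (hg : ∀ i ∈ s, g i ∈ t) (f : κ → ℝ) :
    ∑ i ∈ s, f (g i) = ∑ j ∈ t, ((s.filter (fun i => g i = j)).card : ℝ) * f j := by
  rw [← Finset.sum_fiberwise_of_maps_to hg]
  refine Finset.sum_congr rfl fun j _ => ?_
  rw [← nsmul_eq_mul, ← Finset.sum_const]
  refine Finset.sum_congr rfl fun i hi => ?_
  rw [(Finset.mem_filter.mp hi).2]

lemma sum_comp_le {ι κ : Type*} [DecidableEq κ] (s : Finset ι) (t : Finset κ) (g : ι → κ)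
    (hg : ∀ i ∈ s, g i ∈ t) (f : κ → ℝ) (hf : ∀ j ∈ t, 0 ≤ f j) (c : κ → ℝ)
    (hc : ∀ j ∈ t, ((s.filter (fun i => g i = j)).card : ℝ) ≤ c j) :
    ∑ i ∈ s, f (g i) ≤ ∑ j ∈ t, c j * f j := by
  rw [sum_comp_eq s t g hg]
  exact Finset.sum_le_sum fun j hj => mul_le_mul_of_nonneg_right (hc j hj) (hf j hj)

/-- The collision count of `f` on `s`: the number of pairs in `s × s` on which `f` agrees. -/
def energy {ι κ : Type*} [DecidableEq κ] (s : Finset ι) (f : ι → κ) : ℕ :=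
  ((s ×ˢ s).filter (fun p => f p.1 = f p.2)).card

lemma energy_eq_sum {ι κ : Type*} [DecidableEq κ] (s : Finset ι) (t : Finset κ) (f : ι → κ)
    (hf : ∀ i ∈ s, f i ∈ t) :
    (energy s f : ℝ) = ∑ j ∈ t, ((s.filter (fun i => f i = j)).card : ℝ) ^ 2 := by
  have h1 : (energy s f : ℝ) = ∑ i ∈ s, ((s.filter (fun i' => f i' = f i)).card : ℝ) := by
    unfold energy
    rw [Finset.card_filter, Finset.sum_product_right]
    push_cast
    refine Finset.sum_congr rfl fun i _ => ?_
    rw [Finset.card_filter]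
    push_cast
    rfl
  rw [h1, sum_comp_eq s t f hf (fun j => ((s.filter (fun i' => f i' = j)).card : ℝ))]
  exact Finset.sum_congr rfl fun j _ => (sq _).symm

lemma energy_mono {ι κ : Type*} [DecidableEq κ] {s t : Finset ι} (h : s ⊆ t) (f : ι → κ) :
    energy s f ≤ energy t f :=
  Finset.card_le_card (Finset.filter_subset_filter _ (Finset.product_subset_product h h))

/-- A difference is represented at most as often as the difference `0`, by
`2 c(j) c(j - h) ≤ c(j)² + c(j - h)²` for the fibre sizes `c`. -/
lemma card_sub_eq_le_energy {ι : Type*} (s : Finset ι) (f : ι → ℤ) (h : ℤ) :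
    (((s ×ˢ s).filter (fun p => f p.1 - f p.2 = h)).card : ℝ) ≤ energy s f := by
  classical
  set c : ℤ → ℝ := fun j => ((s.filter (fun i => f i = j)).card : ℝ) with hc
  have h1 : (((s ×ˢ s).filter (fun p => f p.1 - f p.2 = h)).card : ℝ)
      = ∑ i ∈ s, c (f i - h) := by
    rw [Finset.card_filter, Finset.sum_product]
    push_cast
    refine Finset.sum_congr rfl fun i _ => ?_
    simp only [hc]
    rw [Finset.card_filter]
    push_cast
    refine Finset.sum_congr rfl fun i' _ => ?_
    congr 1
    exact propext ⟨fun h => by linarith, fun h => by linarith⟩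
  have hmem : ∀ i ∈ s, f i ∈ s.image f := fun i hi => Finset.mem_image_of_mem f hi
  rw [h1, sum_comp_eq s (s.image f) f hmem (fun j => c (j - h)), energy_eq_sum s (s.image f) f hmem]
  have h2 : ∑ j ∈ s.image f, c (j - h) ^ 2 ≤ ∑ j ∈ s.image f, c j ^ 2 := by
    have h3 : ∑ j ∈ s.image f, c (j - h) ^ 2
        = ∑ j ∈ (s.image f).image (fun j => j - h), c j ^ 2 :=
      (Finset.sum_image (s := s.image f) (g := fun j => j - h) (f := fun j => c j ^ 2)
        (fun a _ b _ hab => by simpa using hab)).symm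
    rw [h3, ← Finset.sum_filter_of_ne (p := fun j => j ∈ s.image f)]
    · refine Finset.sum_le_sum_of_subset_of_nonneg (fun j hj => (Finset.mem_filter.mp hj).2)
        fun j _ _ => sq_nonneg _
    · intro j _ hj
      by_contra hj'
      apply hj
      have : s.filter (fun i => f i = j) = ∅ := by
        refine Finset.filter_eq_empty_iff.mpr fun i hi hij => hj' ?_
        rw [← hij]
        exact hmem i hi
      simp [hc, this]
  calc ∑ j ∈ s.image f, c j * c (j - h)
      ≤ ∑ j ∈ s.image f, (c j ^ 2 + c (j - h) ^ 2) / 2 :=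
        Finset.sum_le_sum fun j _ => by nlinarith [sq_nonneg (c j - c (j - h))]
    _ = (∑ j ∈ s.image f, c j ^ 2 + ∑ j ∈ s.image f, c (j - h) ^ 2) / 2 := by
        rw [← Finset.sum_div, Finset.sum_add_distrib]
    _ ≤ ∑ j ∈ s.image f, c j ^ 2 := by linarith

/-- Replacing a sum over `i` by one over the values `f i` costs, after Cauchy's inequality, the
number of collisions of `f`. -/
lemma sq_sum_comp_le {ι κ : Type*} [DecidableEq κ] (s : Finset ι) (t : Finset κ) (f : ι → κ)
    (hf : ∀ i ∈ s, f i ∈ t) (F : κ → ℝ) :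
    (∑ i ∈ s, F (f i)) ^ 2 ≤ energy s f * ∑ j ∈ t, F j ^ 2 := by
  rw [sum_comp_eq s t f hf, energy_eq_sum s t f hf]
  exact Finset.sum_mul_sq_le_sq_mul_sq _ _ _

/-! ### Lattice points in boxes -/

/-- The integer points of the square `[-P, P]²`. -/
noncomputable def box (P : ℕ) : Finset (ℤ × ℤ) := Finset.Icc (-(P : ℤ)) P ×ˢ Finset.Icc (-(P : ℤ)) P

/-- The norm of the Gaussian integer `u.1 + i u.2`. -/
def nrm (u : ℤ × ℤ) : ℤ := u.1 ^ 2 + u.2 ^ 2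

/-- The imaginary part of the product of the Gaussian integers `ρ.1 + i ρ.2` and `u.1 + i u.2`. -/
def imMul (ρ u : ℤ × ℤ) : ℤ := ρ.1 * u.2 + ρ.2 * u.1

/-- The fourth moment of the divisor function up to any `N ≤ X` is at most `K N`. -/
def TauBound (K : ℝ) (X : ℕ) : Prop :=
  ∀ N ≤ X, ∑ n ∈ Finset.Icc 1 N, tau n ^ 4 ≤ K * N

lemma mem_box {P : ℕ} {u : ℤ × ℤ} : u ∈ box P ↔ |u.1| ≤ P ∧ |u.2| ≤ P := by
  simp [box, abs_le]

lemma card_box (P : ℕ) : (box P).card = (2 * P + 1) ^ 2 := by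
  simp only [box, Finset.card_product, Int.card_Icc]
  rw [sq]
  congr 1 <;> omega

lemma card_box_le {P : ℕ} (hP : 1 ≤ P) : ((box P).card : ℝ) ≤ 9 * (P : ℝ) ^ 2 := by
  rw [card_box]
  have : (1 : ℝ) ≤ P := by exact_mod_cast hP
  push_cast
  nlinarith

/-- The solutions of a primitive linear equation in a box: `u.1` determines `u` and lies in a fixed
residue class modulo `ρ.1`. -/
lemma card_imMul_eq_le {ρ : ℤ × ℤ} (hρ : IsCoprime ρ.1 ρ.2) (ha : ρ.1 ≠ 0) (P : ℕ) (l : ℤ) :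
    (((box P).filter (fun u => imMul ρ u = l)).card : ℝ) ≤ 2 * P / |(ρ.1 : ℝ)| + 1 := by
  have ha' : 0 < |ρ.1| := abs_pos.mpr ha
  have h1 : ((box P).filter (fun u => imMul ρ u = l)).card
      ≤ (Finset.Icc (0 : ℤ) ((2 * P) / |ρ.1|)).card := by
    refine Finset.card_le_card_of_injOn (fun u => (u.1 + P) / |ρ.1|) ?_ ?_
    · intro u hu
      have hu' := (Finset.mem_filter.mp hu).1
      rw [mem_box, abs_le] at hu'
      rw [Finset.coe_Icc, Set.mem_Icc]
      exact ⟨Int.ediv_nonneg (by linarith [hu'.1.1]) ha'.le,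
        Int.ediv_le_ediv ha' (by linarith [hu'.1.2])⟩
    · intro u hu v hv huv
      have hu' := (Finset.mem_filter.mp hu).2
      have hv' := (Finset.mem_filter.mp hv).2
      simp only [imMul] at hu' hv' huv
      have hdvd : |ρ.1| ∣ u.1 - v.1 := by
        rw [abs_dvd]
        refine hρ.dvd_of_dvd_mul_left ⟨v.2 - u.2, ?_⟩
        linarith
      have h1 : (u.1 + P) % |ρ.1| = (v.1 + P) % |ρ.1| := by
        rw [Int.emod_eq_emod_iff_emod_sub_eq_zero]
        apply Int.emod_eq_zero_of_dvd
        simpa using hdvd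
      have h2 : u.1 = v.1 := by
        have e1 := Int.mul_ediv_add_emod (u.1 + P) |ρ.1|
        have e2 := Int.mul_ediv_add_emod (v.1 + P) |ρ.1|
        rw [huv, h1] at e1
        linarith
      have h3 : u.2 = v.2 := by
        apply mul_left_cancel₀ ha
        rw [h2] at hu'
        linarith
      exact Prod.ext h2 h3
  have h2 : ((Finset.Icc (0 : ℤ) ((2 * P) / |ρ.1|)).card : ℝ) ≤ 2 * P / |(ρ.1 : ℝ)| + 1 := by
    rw [Int.card_Icc]
    have h3 : 0 ≤ (2 * (P : ℤ)) / |ρ.1| := Int.ediv_nonneg (by positivity) ha'.le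
    have h4 : ((((2 * (P : ℤ)) / |ρ.1| + 1 - 0).toNat : ℤ) : ℝ)
        = ((2 * (P : ℤ)) / |ρ.1| : ℤ) + 1 := by
      rw [Int.toNat_of_nonneg (by linarith)]
      push_cast
      ring
    have h5 : (((2 * (P : ℤ)) / |ρ.1| : ℤ) : ℝ) ≤ 2 * P / |(ρ.1 : ℝ)| := by
      rw [le_div_iff₀ (by exact_mod_cast ha')]
      exact_mod_cast Int.ediv_mul_le _ ha'.ne'
    rw [Int.cast_natCast] at h4
    linarith
  exact (by exact_mod_cast h1 : (((box P).filter (fun u => imMul ρ u = l)).card : ℝ) ≤ _).trans h2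

/-- The case of `sum_tau_imMul` in which the first coordinate of `ρ` is the larger one. -/
lemma sum_tau_imMul_of_abs_le {K : ℝ} {X : ℕ} (hK : TauBound K X) {ρ : ℤ × ℤ}
    (hρ : IsCoprime ρ.1 ρ.2) (ha : ρ.1 ≠ 0) (hab : |ρ.2| ≤ |ρ.1|) {P : ℕ}
    (h1 : |ρ.1| ≤ P) (hX : 2 * P ^ 2 ≤ X) (hK0 : 0 ≤ K) :
    ∑ u ∈ (box P).filter (fun u => imMul ρ u ≠ 0), tau (imMul ρ u).natAbs ^ 4
      ≤ 12 * P ^ 2 * K := by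
  set A : ℕ := ρ.1.natAbs with hA
  have hA' : ((A : ℕ) : ℤ) = |ρ.1| := by rw [hA, Int.natCast_natAbs]
  have hAP : A ≤ P := by zify; rw [hA']; exact h1
  have hA0 : (0 : ℝ) < A := by
    have : 0 < A := Int.natAbs_pos.mpr ha
    exact_mod_cast this
  have hA1 : |(ρ.1 : ℝ)| = A := by
    rw [hA, Nat.cast_natAbs, Int.cast_abs]
  have hAP' : (A : ℝ) ≤ P := by exact_mod_cast hAP
  refine (sum_comp_le _ (Finset.Icc 1 (2 * P * A)) (fun u => (imMul ρ u).natAbs) ?_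
    (fun j => tau j ^ 4) (fun j _ => pow_nonneg (tau_nonneg j) 4)
    (fun _ => 2 * (2 * P / A + 1)) ?_).trans ?_
  · intro u hu
    obtain ⟨hu1, hu2⟩ := Finset.mem_filter.mp hu
    rw [mem_box] at hu1
    rw [Finset.mem_Icc]
    refine ⟨Int.natAbs_pos.mpr hu2, ?_⟩
    zify
    rw [hA']
    unfold imMul
    calc |ρ.1 * u.2 + ρ.2 * u.1| ≤ |ρ.1| * |u.2| + |ρ.2| * |u.1| := by
          rw [← abs_mul, ← abs_mul]; exact abs_add_le _ _
      _ ≤ |ρ.1| * P + |ρ.1| * P := by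
          gcongr
          · exact hu1.2
          · exact hu1.1
      _ = 2 * P * |ρ.1| := by ring
  · intro j _
    have hsub : ((box P).filter (fun u => imMul ρ u ≠ 0)).filter
        (fun u => (imMul ρ u).natAbs = j) ⊆
        (box P).filter (fun u => imMul ρ u = j) ∪ (box P).filter (fun u => imMul ρ u = -j) := by
      intro u hu
      simp only [Finset.mem_filter, Finset.mem_union] at hu ⊢
      have := Int.natAbs_eq (imMul ρ u)
      rw [hu.2] at this
      tauto
    have h3 := (Finset.card_le_card hsub).trans (Finset.card_union_le _ _)
    have h4 := card_imMul_eq_le hρ ha P j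
    have h5 := card_imMul_eq_le hρ ha P (-j)
    rw [hA1] at h4 h5
    have h6 : ((((box P).filter (fun u => imMul ρ u ≠ 0)).filter
        (fun u => (imMul ρ u).natAbs = j)).card : ℝ) ≤
        ((box P).filter (fun u => imMul ρ u = j)).card
          + ((box P).filter (fun u => imMul ρ u = -j)).card := by exact_mod_cast h3
    linarith
  · rw [← Finset.mul_sum]
    have h7 := hK (2 * P * A) (by nlinarith)
    calc 2 * (2 * (P : ℝ) / A + 1) * ∑ j ∈ Finset.Icc 1 (2 * P * A), tau j ^ 4
        ≤ 2 * (2 * (P : ℝ) / A + 1) * (K * (2 * P * A : ℕ)) := by gcongr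
      _ = (8 * P ^ 2 + 4 * P * A) * K := by
          push_cast
          field_simp
          ring
      _ ≤ 12 * P ^ 2 * K := by
          refine mul_le_mul_of_nonneg_right ?_ hK0
          nlinarith [Nat.cast_nonneg (α := ℝ) P]

/-- The fourth moment of the divisor function over the values of a primitive linear form on a
box. The fibres over a fixed value are arithmetic progressions, whence the uniformity in `ρ`. -/
lemma sum_tau_imMul {K : ℝ} {X : ℕ} (hK : TauBound K X) (hK0 : 0 ≤ K) {ρ : ℤ × ℤ}
    (hρ : IsCoprime ρ.1 ρ.2) {P : ℕ} (hP : ρ ∈ box P) (hX : 2 * P ^ 2 ≤ X) :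
    ∑ u ∈ (box P).filter (fun u => imMul ρ u ≠ 0), tau (imMul ρ u).natAbs ^ 4
      ≤ 12 * P ^ 2 * K := by
  rw [mem_box] at hP
  have hne : ρ.1 ≠ 0 ∨ ρ.2 ≠ 0 := by
    by_contra! h
    rw [h.1, h.2] at hρ
    exact not_isCoprime_zero_zero hρ
  rcases le_total |ρ.2| |ρ.1| with h | h
  · refine sum_tau_imMul_of_abs_le hK hρ ?_ h hP.1 hX hK0
    intro h0
    rw [h0, abs_zero] at h
    rcases hne with h1 | h1
    · exact h1 h0
    · exact h1 (abs_nonpos_iff.mp h)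
  · have h2 : ρ.2 ≠ 0 := by
      intro h0
      rw [h0, abs_zero] at h
      rcases hne with h1 | h1
      · exact h1 (abs_nonpos_iff.mp h)
      · exact h1 h0
    have h3 := sum_tau_imMul_of_abs_le (ρ := ρ.swap) hK hρ.symm h2 h hP.2 hX hK0
    refine le_trans (le_of_eq ?_) h3
    refine Finset.sum_bij (fun u _ => u.swap) ?_ ?_ ?_ ?_
    · intro u hu
      rw [Finset.mem_filter, mem_box] at hu ⊢
      simp only [imMul, Prod.fst_swap, Prod.snd_swap] at hu ⊢
      exact ⟨⟨hu.1.2, hu.1.1⟩, by rw [add_comm]; exact hu.2⟩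
    · intro u _ v _ h
      exact Prod.swap_injective h
    · intro u hu
      refine ⟨u.swap, ?_, by simp⟩
      rw [Finset.mem_filter, mem_box] at hu ⊢
      simp only [imMul, Prod.fst_swap, Prod.snd_swap] at hu ⊢
      exact ⟨⟨hu.1.2, hu.1.1⟩, by rw [add_comm]; exact hu.2⟩
    · intro u _
      simp only [imMul, Prod.fst_swap, Prod.snd_swap, add_comm]

lemma card_mul_eq_le (P : ℕ) {n : ℤ} (hn : n ≠ 0) :
    (((box P).filter (fun u => u.1 * u.2 = n)).card : ℝ) ≤ 2 * tau n.natAbs := by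
  have h : ((box P).filter (fun u => u.1 * u.2 = n)).card
      ≤ (n.natAbs.divisors ×ˢ ({1, -1} : Finset ℤ)).card := by
    refine Finset.card_le_card_of_injOn (fun u => (u.1.natAbs, u.1.sign)) ?_ ?_
    · intro u hu
      have hu' := (Finset.mem_filter.mp hu).2
      have h0 : u.1 ≠ 0 := fun h => hn (by rw [← hu', h, zero_mul])
      rw [Finset.mem_coe, Finset.mem_product, Nat.mem_divisors]
      refine ⟨⟨Int.natAbs_dvd_natAbs.mpr ⟨u.2, hu'.symm⟩, by simpa using hn⟩, ?_⟩
      simp only [Finset.mem_insert, Finset.mem_singleton]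
      rcases lt_or_gt_of_ne h0 with h | h
      · right; exact Int.sign_eq_neg_one_of_neg h
      · left; exact Int.sign_eq_one_of_pos h
    · intro u hu v hv huv
      have hu' := (Finset.mem_filter.mp hu).2
      have hv' := (Finset.mem_filter.mp hv).2
      have h0 : u.1 ≠ 0 := fun h => hn (by rw [← hu', h, zero_mul])
      simp only [Prod.mk.injEq] at huv
      have h1 : u.1 = v.1 := by
        rw [← Int.sign_mul_natAbs u.1, ← Int.sign_mul_natAbs v.1, huv.1, huv.2]
      refine Prod.ext h1 (mul_left_cancel₀ h0 ?_)
      rw [hu', h1, hv']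
  have h2 : (n.natAbs.divisors ×ˢ ({1, -1} : Finset ℤ)).card = n.natAbs.divisors.card * 2 := by
    rw [Finset.card_product]; rfl
  rw [h2] at h
  unfold tau
  have h3 : (((box P).filter (fun u => u.1 * u.2 = n)).card : ℝ)
    ≤ (n.natAbs.divisors.card : ℝ) * 2 := by exact_mod_cast h
  linarith

lemma card_mul_eq_zero_le {P : ℕ} :
    ((box P).filter (fun u => u.1 * u.2 = 0)).card ≤ 2 * (2 * P + 1) := by
  have hsub : (box P).filter (fun u => u.1 * u.2 = 0) ⊆
      ({0} : Finset ℤ) ×ˢ Finset.Icc (-(P : ℤ)) P ∪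
        Finset.Icc (-(P : ℤ)) P ×ˢ ({0} : Finset ℤ) := by
    intro u hu
    simp only [Finset.mem_filter, mem_box, abs_le, mul_eq_zero, Finset.mem_union,
      Finset.mem_product, Finset.mem_singleton, Finset.mem_Icc] at hu ⊢
    tauto
  refine (Finset.card_le_card hsub).trans ((Finset.card_union_le _ _).trans ?_)
  simp only [Finset.card_product, Finset.card_singleton, Int.card_Icc]
  omega

/-- The number of pairs of points of a box with the same norm: `u.1² - v.1² = v.2² - u.2²` turns
it into a count of solutions to `A B = C E`, hence into a second moment of the divisor function. -/
lemma energy_nrm_le {K : ℝ} {X : ℕ} (hK : TauBound K X) {P : ℕ} (hP : 1 ≤ P)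
    (hX : 4 * P ^ 2 ≤ X) (hK1 : 1 ≤ K) :
    (energy (box P) nrm : ℝ) ≤ 132 * P ^ 2 * K := by
  have h1 : energy (box P) nrm ≤ energy (box (2 * P)) (fun u => u.1 * u.2) := by
    -- `(u, v) ↦ ((u.1 - v.1, u.1 + v.1), (v.2 - u.2, v.2 + u.2))` is injective.
    refine Finset.card_le_card_of_injOn
      (fun p => ((p.1.1 - p.2.1, p.1.1 + p.2.1), (p.2.2 - p.1.2, p.2.2 + p.1.2))) ?_ ?_
    · intro p hp
      rw [Finset.mem_coe, Finset.mem_filter, Finset.mem_product] at hp ⊢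
      simp only [mem_box, abs_le, nrm] at hp ⊢
      push_cast
      obtain ⟨⟨⟨⟨_, _⟩, _, _⟩, ⟨_, _⟩, _, _⟩, h⟩ := hp
      refine ⟨⟨⟨⟨?_, ?_⟩, ?_, ?_⟩, ⟨?_, ?_⟩, ?_, ?_⟩, ?_⟩ <;> linarith
    · intro p _ p' _ h
      simp only [Prod.mk.injEq] at h
      obtain ⟨⟨h1, h2⟩, h3, h4⟩ := h
      refine Prod.ext (Prod.ext ?_ ?_) (Prod.ext ?_ ?_) <;> linarith
  have h2 : (energy (box (2 * P)) (fun u : ℤ × ℤ => u.1 * u.2) : ℝ) ≤ 132 * P ^ 2 * K := by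
    set s := box (2 * P) with hs
    set c : ℤ → ℝ := fun n => ((s.filter (fun u => u.1 * u.2 = n)).card : ℝ) with hc
    have h3 : (energy s (fun u : ℤ × ℤ => u.1 * u.2) : ℝ) = ∑ u ∈ s, c (u.1 * u.2) := by
      unfold energy
      rw [Finset.card_filter, Finset.sum_product_right]
      push_cast
      refine Finset.sum_congr rfl fun i _ => ?_
      simp only [hc]
      rw [Finset.card_filter]
      push_cast
      rfl
    -- The product `0` is treated separately: it has infinitely many divisors.
    rw [h3, ← Finset.sum_filter_add_sum_filter_not s (fun u => u.1 * u.2 = 0)]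
    have hP' : (1 : ℝ) ≤ P := by exact_mod_cast hP
    have hzero : c 0 ≤ 10 * P := by
      have := card_mul_eq_zero_le (P := 2 * P)
      have h4 : c 0 ≤ 2 * (2 * (2 * P) + 1) := by
        simp only [hc]; exact_mod_cast this
      linarith
    have hc0 : 0 ≤ c 0 := Nat.cast_nonneg _
    have h4 : ∑ u ∈ s.filter (fun u => u.1 * u.2 = 0), c (u.1 * u.2) ≤ 100 * P ^ 2 := by
      have : ∑ u ∈ s.filter (fun u => u.1 * u.2 = 0), c (u.1 * u.2) = c 0 * c 0 := by
        rw [Finset.sum_congr rfl (g := fun _ => c 0)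
          (fun u hu => by rw [(Finset.mem_filter.mp hu).2]), Finset.sum_const, nsmul_eq_mul]
      rw [this]
      nlinarith
    have h5 : ∑ u ∈ s.filter (fun u => ¬ u.1 * u.2 = 0), c (u.1 * u.2) ≤ 32 * P ^ 2 * K := by
      calc ∑ u ∈ s.filter (fun u => ¬ u.1 * u.2 = 0), c (u.1 * u.2)
          ≤ ∑ u ∈ s.filter (fun u => ¬ u.1 * u.2 = 0), 2 * tau (u.1 * u.2).natAbs :=
            Finset.sum_le_sum fun u hu => card_mul_eq_le _ (Finset.mem_filter.mp hu).2
        _ ≤ ∑ j ∈ Finset.Icc 1 (4 * P ^ 2), (4 * tau j) * (2 * tau j) := by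
            refine sum_comp_le _ _ (fun u : ℤ × ℤ => (u.1 * u.2).natAbs) ?_
              (fun j => 2 * tau j) (fun j _ => by have := tau_nonneg j; positivity) _ ?_
            · intro u hu
              obtain ⟨hu1, hu2⟩ := Finset.mem_filter.mp hu
              rw [hs, mem_box] at hu1
              rw [Finset.mem_Icc]
              refine ⟨Int.natAbs_pos.mpr hu2, ?_⟩
              zify
              rw [abs_mul]
              calc |u.1| * |u.2| ≤ ((2 * P : ℕ) : ℤ) * ((2 * P : ℕ) : ℤ) := by
                    gcongr
                    · exact hu1.1
                    · exact hu1.2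
                _ = _ := by push_cast; ring
            · intro j hj
              have hj0 : (j : ℤ) ≠ 0 := by
                have := (Finset.mem_Icc.mp hj).1
                omega
              have hsub : (s.filter (fun u => ¬ u.1 * u.2 = 0)).filter
                  (fun u => (u.1 * u.2).natAbs = j) ⊆
                  s.filter (fun u => u.1 * u.2 = (j : ℤ)) ∪
                    s.filter (fun u => u.1 * u.2 = -(j : ℤ)) := by
                intro u hu
                simp only [Finset.mem_filter, Finset.mem_union] at hu ⊢
                have := Int.natAbs_eq (u.1 * u.2)
                rw [hu.2] at this
                tauto
              have h3 := (Finset.card_le_card hsub).trans (Finset.card_union_le _ _)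
              have h4 := card_mul_eq_le (2 * P) hj0
              have h5 := card_mul_eq_le (2 * P) (neg_ne_zero.mpr hj0)
              rw [Int.natAbs_neg] at h5
              rw [Int.natAbs_natCast] at h4 h5
              have h6 : (((s.filter (fun u => ¬ u.1 * u.2 = 0)).filter
                  (fun u => (u.1 * u.2).natAbs = j)).card : ℝ) ≤
                  (s.filter (fun u => u.1 * u.2 = (j : ℤ))).card
                    + (s.filter (fun u => u.1 * u.2 = -(j : ℤ))).card := by exact_mod_cast h3
              linarith
        _ ≤ ∑ j ∈ Finset.Icc 1 (4 * P ^ 2), 8 * tau j ^ 4 := by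
            refine Finset.sum_le_sum fun j hj => ?_
            have : 1 ≤ tau j := one_le_tau (by have := (Finset.mem_Icc.mp hj).1; omega)
            nlinarith [pow_le_pow_right₀ this (show 2 ≤ 4 by norm_num)]
        _ ≤ 8 * (K * (4 * P ^ 2 : ℕ)) := by
            rw [← Finset.mul_sum]
            linarith [hK (4 * P ^ 2) hX]
        _ = 32 * P ^ 2 * K := by push_cast; ring
    nlinarith [sq_nonneg (P : ℝ)]
  exact (by exact_mod_cast h1 : (energy (box P) nrm : ℝ)
    ≤ energy (box (2 * P)) (fun u : ℤ × ℤ => u.1 * u.2)).trans h2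

/-! ### Weyl sums -/

/-- The distance from `y` to the nearest integer. -/
noncomputable def distInt (y : ℝ) : ℝ := |y - round y|

lemma distInt_le (y : ℝ) (m : ℤ) : distInt y ≤ |y - m| := round_le y m

lemma distInt_neg (y : ℝ) : distInt (-y) = distInt y := by
  refine le_antisymm ?_ ?_
  · refine (distInt_le (-y) (-round y)).trans (le_of_eq ?_)
    unfold distInt
    rw [← abs_neg]; congr 1; push_cast; ring
  · refine (distInt_le y (-round (-y))).trans (le_of_eq ?_)
    unfold distInt
    rw [← abs_neg]; congr 1; push_cast; ring

lemma norm_e (t : ℝ) : ‖e t‖ = 1 := by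
  unfold e
  rw [show 2 * (Real.pi : ℂ) * Complex.I * (t : ℂ) = ((2 * Real.pi * t : ℝ) : ℂ) * Complex.I by
    push_cast; ring]
  exact Complex.norm_exp_ofReal_mul_I _

lemma e_add (s t : ℝ) : e (s + t) = e s * e t := by
  unfold e
  rw [← Complex.exp_add]; congr 1; push_cast; ring

lemma e_intCast (n : ℤ) : e n = 1 := by
  unfold e
  rw [Complex.exp_eq_one_iff]
  exact ⟨n, by push_cast; ring⟩

lemma star_e (t : ℝ) : (starRingEnd ℂ) (e t) = e (-t) := by
  unfold e
  rw [← Complex.exp_conj]; congr 1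
  simp [map_ofNat]

lemma four_mul_distInt_le (y : ℝ) : 4 * distInt y ≤ ‖e y - 1‖ := by
  set w : ℝ := y - round y with hw
  have h1 : e y = e w := by
    have : y = w + (round y : ℤ) := by rw [hw]; ring
    conv_lhs => rw [this]
    rw [e_add, e_intCast, mul_one]
  have h2 : ‖e w - 1‖ = 2 * |Real.sin (Real.pi * w)| := by
    unfold e
    rw [show 2 * (Real.pi : ℂ) * Complex.I * (w : ℂ)
      = Complex.I * ((2 * Real.pi * w : ℝ) : ℂ) by push_cast; ring]
    rw [Complex.norm_exp_I_mul_ofReal_sub_one]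
    rw [Real.norm_eq_abs, abs_mul, abs_two]
    congr 3; ring
  have h3 : |w| ≤ 1 / 2 := abs_sub_round y
  have h4 : |Real.sin (Real.pi * w)| = Real.sin (Real.pi * |w|) := by
    have hpi := Real.pi_pos
    rw [Real.abs_sin_eq_sin_abs_of_abs_le_pi, abs_mul, abs_of_pos hpi]
    rw [abs_mul, abs_of_pos hpi]
    nlinarith
  have h5 := Real.mul_le_sin (x := Real.pi * |w|) (by positivity)
    (by nlinarith [Real.pi_pos])
  have h6 : 2 / Real.pi * (Real.pi * |w|) = 2 * |w| := by
    field_simp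
  rw [h6] at h5
  rw [h1, h2, h4]
  change 4 * |w| ≤ _
  linarith

lemma geom_sum_e (y : ℝ) (u n : ℤ) (h : u - 1 ≤ n) :
    (∑ b ∈ Finset.Icc u n, e (y * b)) * (e y - 1) = e (y * (n + 1)) - e (y * u) := by
  induction n, h using Int.leInduction with
  | base => simp
  | succ n hn ih =>
    have h1 : Finset.Icc u (n + 1) = insert (n + 1) (Finset.Icc u n) := by
      ext a; simp only [Finset.mem_Icc, Finset.mem_insert]; omega
    rw [h1, Finset.sum_insert (by simp), add_mul, ih]
    push_cast
    rw [mul_add y ((n : ℝ) + 1) 1, e_add, mul_one]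
    ring

lemma norm_sum_e_le {y η : ℝ} (hη : 0 < η) (hy : η < distInt y) (u n : ℤ) :
    ‖∑ b ∈ Finset.Icc u n, e (y * b)‖ ≤ 1 / (2 * η) := by
  rcases lt_or_ge n (u - 1) with h | h
  · rw [Finset.Icc_eq_empty (by omega), Finset.sum_empty, norm_zero]
    positivity
  · have h1 := congrArg norm (geom_sum_e y u n h)
    rw [norm_mul] at h1
    have h2 : ‖e (y * (n + 1)) - e (y * u)‖ ≤ 2 :=
      (norm_sub_le _ _).trans (by rw [norm_e, norm_e]; norm_num)
    have h3 := four_mul_distInt_le y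
    rw [le_div_iff₀ (by positivity)]
    nlinarith [norm_nonneg (∑ b ∈ Finset.Icc u n, e (y * b))]

/-- The number of shifts `|t| ≤ M` for which `2 y t` lies within `1 / (M ε)` of an integer. -/
noncomputable def badCount (M : ℕ) (ε y : ℝ) : ℕ :=
  ((Finset.Icc (-(M : ℤ)) M).filter (fun t : ℤ => distInt (2 * y * t) ≤ 1 / (M * ε))).card

/-- The bound furnished by Weyl's inequality for quadratic exponential sums of length `M` with
leading coefficient `y`, when all differenced sums below the threshold `M ε` are accepted. -/
noncomputable def weylBound (M : ℕ) (ε y : ℝ) : ℝ :=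
  min (M : ℝ) (Real.sqrt (2 * M ^ 2 * ε + M * badCount M ε y))

lemma weylBound_nonneg (M : ℕ) (ε y : ℝ) : 0 ≤ weylBound M ε y :=
  le_min (Nat.cast_nonneg _) (Real.sqrt_nonneg _)

lemma weylBound_le (M : ℕ) (ε y : ℝ) : weylBound M ε y ≤ M := min_le_left _ _

lemma weylBound_sq_le (M : ℕ) {ε : ℝ} (hε : 0 ≤ ε) (y : ℝ) :
    weylBound M ε y ^ 2 ≤ 2 * M ^ 2 * ε + M * badCount M ε y := by
  have h : 0 ≤ 2 * (M : ℝ) ^ 2 * ε + M * badCount M ε y := by positivity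
  calc weylBound M ε y ^ 2 ≤ Real.sqrt (2 * M ^ 2 * ε + M * badCount M ε y) ^ 2 :=
        pow_le_pow_left₀ (weylBound_nonneg M ε y) (min_le_right _ _) 2
    _ = _ := Real.sq_sqrt h

/-- Weyl's inequality for quadratic phases on an interval contained in `[1, M]`. -/
lemma norm_quadratic_sum_le {M : ℕ} {ε : ℝ} (hε : 0 < ε) (hM : 1 ≤ M)
    (y φ c : ℝ) {u w : ℤ} (hu : 1 ≤ u) (hw : w ≤ M) :
    ‖∑ a ∈ Finset.Icc u w, e (y * a ^ 2 + φ * a + c)‖ ≤ weylBound M ε y := by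
  have hM0 : (1 : ℝ) ≤ M := by exact_mod_cast hM
  have hcard : ∀ u' w' : ℤ, 1 ≤ u' → w' ≤ M → ((Finset.Icc u' w').card : ℝ) ≤ M := by
    intro u' w' h1 h2
    have : (Finset.Icc u' w').card ≤ M := by rw [Int.card_Icc]; omega
    exact_mod_cast this
  have htriv : ∀ (f : ℤ → ℝ) (u' w' : ℤ), 1 ≤ u' → w' ≤ M →
      ‖∑ a ∈ Finset.Icc u' w', e (f a)‖ ≤ M := by
    intro f u' w' h1 h2
    refine (norm_sum_le _ _).trans ?_
    simp only [norm_e, Finset.sum_const, nsmul_eq_mul, mul_one]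
    exact hcard u' w' h1 h2
  refine le_min (htriv _ u w hu hw) ?_
  refine Real.le_sqrt_of_sq_le ?_
  set z : ℤ → ℂ := fun a => e (y * a ^ 2 + φ * a + c) with hz
  have h1 : ‖∑ a ∈ Finset.Icc u w, z a‖ ^ 2
      = ‖∑ p ∈ Finset.Icc u w ×ˢ Finset.Icc u w, z p.1 * (starRingEnd ℂ) (z p.2)‖ := by
    rw [Finset.sum_product]
    change _ = ‖∑ x ∈ Finset.Icc u w, ∑ y ∈ Finset.Icc u w, z x * (starRingEnd ℂ) (z y)‖
    rw [← Finset.sum_mul_sum, ← map_sum, norm_mul, RCLike.norm_conj, sq]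
  have hmaps : ∀ p ∈ Finset.Icc u w ×ˢ Finset.Icc u w, p.1 - p.2 ∈ Finset.Icc (-(M : ℤ)) M := by
    intro p hp
    simp only [Finset.mem_product, Finset.mem_Icc] at hp ⊢
    omega
  -- Weyl differencing: on the pairs of difference `t` the phase is linear with slope `2 y t`.
  have hinner : ∀ t : ℤ, ∑ p ∈ (Finset.Icc u w ×ˢ Finset.Icc u w).filter (fun p => p.1 - p.2 = t),
      z p.1 * (starRingEnd ℂ) (z p.2)
      = e (y * t ^ 2 + φ * t) *
        ∑ b ∈ Finset.Icc (max u (u - t)) (min w (w - t)), e (2 * y * t * b) := by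
    intro t
    rw [Finset.mul_sum]
    refine Finset.sum_bij (fun p _ => p.2) ?_ ?_ ?_ ?_
    · intro p hp
      simp only [Finset.mem_filter, Finset.mem_product, Finset.mem_Icc] at hp
      simp only [Finset.mem_Icc]
      omega
    · intro p hp p' hp' h
      simp only [Finset.mem_filter] at hp hp'
      exact Prod.ext (by linarith [hp.2, hp'.2]) h
    · intro b hb
      simp only [Finset.mem_Icc] at hb
      refine ⟨(b + t, b), ?_, rfl⟩
      simp only [Finset.mem_filter, Finset.mem_product, Finset.mem_Icc]
      omega
    · intro p hp
      simp only [Finset.mem_filter] at hp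
      have h2 : p.1 = p.2 + t := by linarith [hp.2]
      simp only [hz]
      rw [star_e, ← e_add, ← e_add, h2]
      congr 1
      push_cast
      ring
  rw [h1, ← Finset.sum_fiberwise_of_maps_to hmaps]
  refine (norm_sum_le _ _).trans ?_
  -- A geometric sum is at most `M ε / 2`, unless its slope is within `1 / (M ε)` of an integer.
  have hterm : ∀ t ∈ Finset.Icc (-(M : ℤ)) M,
      ‖∑ p ∈ (Finset.Icc u w ×ˢ Finset.Icc u w).filter (fun p => p.1 - p.2 = t),
        z p.1 * (starRingEnd ℂ) (z p.2)‖
      ≤ M * ε / 2 + if distInt (2 * y * t) ≤ 1 / (M * ε) then (M : ℝ) else 0 := by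
    intro t _
    rw [hinner t, norm_mul, norm_e, one_mul]
    split_ifs with h
    · have := htriv (fun b => 2 * y * t * b) (max u (u - t)) (min w (w - t))
        (le_max_of_le_left hu) (min_le_of_left_le hw)
      have h0 : 0 ≤ (M : ℝ) * ε / 2 := by positivity
      linarith
    · push Not at h
      refine (norm_sum_e_le (by positivity) h _ _).trans (le_of_eq ?_)
      field_simp
      ring
  refine (Finset.sum_le_sum hterm).trans ?_
  rw [Finset.sum_add_distrib, Finset.sum_const, ← Finset.sum_filter, Finset.sum_const,
    nsmul_eq_mul, nsmul_eq_mul, Int.card_Icc]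
  have h2 : (((M : ℤ) + 1 - -(M : ℤ)).toNat : ℝ) = 2 * M + 1 := by
    have : ((M : ℤ) + 1 - -(M : ℤ)).toNat = 2 * M + 1 := by omega
    rw [this]; push_cast; ring
  rw [h2]
  unfold badCount
  nlinarith [mul_pos (show (0 : ℝ) < M by linarith) hε]

/-! ### Averaging over short vectors of a lattice -/

lemma exists_eq_Icc_of_ordConnected (s : Finset ℤ)
    (h : ∀ a ∈ s, ∀ c ∈ s, ∀ b, a ≤ b → b ≤ c → b ∈ s) :
    ∃ u w : ℤ, s = Finset.Icc u w := by
  rcases s.eq_empty_or_nonempty with rfl | hs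
  · exact ⟨1, 0, by simp⟩
  · refine ⟨s.min' hs, s.max' hs, ?_⟩
    ext b
    rw [Finset.mem_Icc]
    exact ⟨fun hb => ⟨s.min'_le b hb, s.le_max' b hb⟩,
      fun hb => h _ (s.min'_mem hs) _ (s.max'_mem hs) b hb.1 hb.2⟩

open Classical in
/-- Cut `box (2 R)` into cells of side `V`. The differences of the lattice points in one cell lie in
`box V`, so each cell has at most as many lattice points as `box V`. -/
lemma card_lattice_box_le (Λ : AddSubgroup (ℤ × ℤ)) {R M V : ℕ} (hV : 1 ≤ V)
    (hR : R < 2 * M * V) :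
    ((box (2 * R)).filter (· ∈ Λ)).card ≤ 64 * M ^ 2 * ((box V).filter (· ∈ Λ)).card := by
  set T : Finset ℤ := Finset.Icc (-(4 * M : ℤ)) (4 * M - 1) with hT
  have hTc : (T ×ˢ T).card = 64 * M ^ 2 := by
    rw [Finset.card_product, hT, Int.card_Icc]
    have : ((4 * M : ℤ) - 1 + 1 - -(4 * M)).toNat = 8 * M := by omega
    rw [this]; ring
  have hV' : (0 : ℤ) < V := by exact_mod_cast hV
  have hR' : (R : ℤ) < 2 * M * V := by exact_mod_cast hR
  have hq : ∀ r : ℤ, |r| ≤ (2 * R : ℕ) → r / V ∈ T := by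
    intro r hr
    rw [abs_le] at hr
    push_cast at hr
    rw [hT, Finset.mem_Icc]
    constructor
    · rw [Int.le_ediv_iff_mul_le hV']
      nlinarith
    · have : r / V < 4 * M := by
        rw [Int.ediv_lt_iff_lt_mul hV']
        nlinarith
      linarith
  rw [← hTc, mul_comm (T ×ˢ T).card]
  refine Finset.card_le_mul_card_image_of_maps_to
    (f := fun u : ℤ × ℤ => (u.1 / (V : ℤ), u.2 / (V : ℤ))) ?_ _ ?_
  · intro u hu
    obtain ⟨hu1, _⟩ := Finset.mem_filter.mp hu
    rw [mem_box] at hu1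
    exact Finset.mem_product.mpr ⟨hq _ hu1.1, hq _ hu1.2⟩
  · intro t _
    rcases (((box (2 * R)).filter (· ∈ Λ)).filter
      (fun u : ℤ × ℤ => (u.1 / (V : ℤ), u.2 / (V : ℤ)) = t)).eq_empty_or_nonempty with h | ⟨u₀, hu₀⟩
    · rw [h]; simp
    · refine Finset.card_le_card_of_injOn (fun u => u - u₀) ?_ fun a _ b _ h => by simpa using h
      intro u hu
      have hu' := Finset.mem_filter.mp (Finset.mem_coe.mp hu)
      have hu₀' := Finset.mem_filter.mp hu₀
      have hdiff : ∀ r r₀ : ℤ, r / (V : ℤ) = r₀ / V → |r - r₀| ≤ V := by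
        intro r r₀ h
        have e1 := Int.mul_ediv_add_emod r V
        have e2 := Int.mul_ediv_add_emod r₀ V
        have := Int.emod_nonneg r hV'.ne'
        have := Int.emod_nonneg r₀ hV'.ne'
        have := Int.emod_lt_of_pos r hV'
        have := Int.emod_lt_of_pos r₀ hV'
        rw [h] at e1
        rw [abs_le]
        constructor <;> linarith
      have he : (u.1 / (V : ℤ), u.2 / (V : ℤ)) = (u₀.1 / (V : ℤ), u₀.2 / (V : ℤ)) :=
        hu'.2.trans hu₀'.2.symm
      rw [Prod.mk.injEq] at he
      rw [Finset.mem_coe, Finset.mem_filter, mem_box]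
      exact ⟨⟨hdiff _ _ he.1, hdiff _ _ he.2⟩,
        Λ.sub_mem (Finset.mem_filter.mp hu'.1).2 (Finset.mem_filter.mp hu₀'.1).2⟩

open Classical in
/-- A sum over lattice points is controlled by the sums along short segments in the direction of
the short lattice vectors, on average over these vectors. No basis of the lattice is involved. -/
lemma norm_sum_lattice_le (Λ : AddSubgroup (ℤ × ℤ)) {R M V : ℕ} (hV : 1 ≤ V) (hM : 1 ≤ M)
    (hMV : M * V ≤ R) (hR : R < 2 * M * V) (F : ℤ × ℤ → ℂ) (hF : ∀ u, F u ≠ 0 → u ∈ box R ∧ u ∈ Λ)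
    (B : ℤ × ℤ → ℝ)
    (hB : ∀ v ∈ box V, v ∈ Λ → ∀ u ∈ Λ, ‖∑ a ∈ Finset.Icc (1 : ℤ) M, F (u + a • v)‖ ≤ B v) :
    ‖∑ u ∈ box R, F u‖ ≤ 64 * M * ∑ v ∈ (box V).filter (· ∈ Λ), B v := by
  set S := (box V).filter (· ∈ Λ) with hS
  set T := (box (2 * R)).filter (· ∈ Λ) with hT
  have hM0 : (0 : ℝ) < M := by exact_mod_cast hM
  have hS0 : (0 : ℝ) < S.card := by
    have : 0 < S.card := Finset.card_pos.mpr ⟨0, by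
      rw [hS, Finset.mem_filter, mem_box]
      exact ⟨by simp, Λ.zero_mem⟩⟩
    exact_mod_cast this
  -- Translation by `a v` preserves the lattice and moves `box R` within `box (2 R)`.
  have hshift : ∀ v ∈ S, ∀ a ∈ Finset.Icc (1 : ℤ) M, ∑ u ∈ box R, F u = ∑ u ∈ T, F (u + a • v) := by
    intro v hv a ha
    obtain ⟨hv1, hv2⟩ := Finset.mem_filter.mp hv
    rw [mem_box] at hv1
    rw [Finset.mem_Icc] at ha
    have hMV' : (M : ℤ) * V ≤ R := by exact_mod_cast hMV
    have hbd : ∀ r : ℤ, |r| ≤ V → |a * r| ≤ R := by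
      intro r hr
      rw [abs_mul, abs_of_nonneg (by linarith : 0 ≤ a)]
      calc a * |r| ≤ M * V := by
            gcongr
            exact ha.2
        _ ≤ R := hMV'
    symm
    refine Finset.sum_bij_ne_zero (fun u _ _ => u + a • v) ?_ ?_ ?_ ?_
    · intro u _ h
      exact (hF _ h).1
    · intro u _ _ u' _ _ h
      simpa using h
    · intro u hu h
      refine ⟨u - a • v, ?_, ?_, ?_⟩
      · rw [hT, Finset.mem_filter, mem_box]
        rw [mem_box] at hu
        refine ⟨⟨?_, ?_⟩, Λ.sub_mem (hF _ h).2 (Λ.zsmul_mem hv2 a)⟩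
        · have := hbd _ hv1.1
          simp only [Prod.fst_sub, Prod.smul_fst, smul_eq_mul]
          push_cast
          calc |u.1 - a * v.1| ≤ |u.1| + |a * v.1| := abs_sub _ _
            _ ≤ _ := by linarith [hu.1]
        · have := hbd _ hv1.2
          simp only [Prod.snd_sub, Prod.smul_snd, smul_eq_mul]
          push_cast
          calc |u.2 - a * v.2| ≤ |u.2| + |a * v.2| := abs_sub _ _
            _ ≤ _ := by linarith [hu.2]
      · simpa using h
      · simp
    · intros; rfl
  -- Average the translates over `v ∈ S` and `1 ≤ a ≤ M`.
  have h1 : ((S.card : ℝ) * M) * ‖∑ u ∈ box R, F u‖ ≤ T.card * ∑ v ∈ S, B v := by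
    have h2 : ((S.card : ℂ) * M) * ∑ u ∈ box R, F u
        = ∑ v ∈ S, ∑ u ∈ T, ∑ a ∈ Finset.Icc (1 : ℤ) M, F (u + a • v) := by
      have h3 : ∀ v ∈ S, ∑ u ∈ T, ∑ a ∈ Finset.Icc (1 : ℤ) M, F (u + a • v)
          = M * ∑ u ∈ box R, F u := by
        intro v hv
        rw [Finset.sum_comm, ← Finset.sum_congr rfl (hshift v hv), Finset.sum_const, nsmul_eq_mul,
          Int.card_Icc]
        simp
      rw [Finset.sum_congr rfl h3, Finset.sum_const, nsmul_eq_mul]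
      ring
    have h4 : ((S.card : ℝ) * M) * ‖∑ u ∈ box R, F u‖
        = ‖((S.card : ℂ) * M) * ∑ u ∈ box R, F u‖ := by
      rw [norm_mul, norm_mul, Complex.norm_natCast, Complex.norm_natCast]
    rw [h4, h2, Finset.mul_sum]
    refine (norm_sum_le _ _).trans (Finset.sum_le_sum fun v hv => ?_)
    refine (norm_sum_le _ _).trans ?_
    obtain ⟨hv1, hv2⟩ := Finset.mem_filter.mp hv
    refine (Finset.sum_le_sum fun u hu => hB v hv1 hv2 u (Finset.mem_filter.mp hu).2).trans ?_
    rw [Finset.sum_const, nsmul_eq_mul]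
  have h5 : (T.card : ℝ) ≤ 64 * M ^ 2 * S.card := by
    exact_mod_cast card_lattice_box_le Λ hV hR
  have hB0 : 0 ≤ ∑ v ∈ S, B v := Finset.sum_nonneg fun v hv =>
    (norm_nonneg _).trans
      (hB v (Finset.mem_filter.mp hv).1 (Finset.mem_filter.mp hv).2 0 Λ.zero_mem)
  have h6 := h1.trans (mul_le_mul_of_nonneg_right h5 hB0)
  have h7 : ((S.card : ℝ) * M) * ‖∑ u ∈ box R, F u‖
      ≤ ((S.card : ℝ) * M) * (64 * M * ∑ v ∈ S, B v) := by
    refine h6.trans (le_of_eq (by ring))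
  exact le_of_mul_le_mul_left h7 (by positivity)

/-! ### Multiples of a minor arc point close to integers -/

lemma card_le_of_abs_sub_le (s : Finset ℤ) {y r : ℝ} (hr : 0 ≤ r)
    (h : ∀ u ∈ s, |(u : ℝ) - y| ≤ r) : (s.card : ℝ) ≤ 2 * r + 1 := by
  have hsub : s ⊆ Finset.Icc ⌈y - r⌉ ⌊y + r⌋ := by
    intro u hu
    have := abs_le.mp (h u hu)
    rw [Finset.mem_Icc, Int.ceil_le, Int.le_floor]
    constructor <;> linarith
  have h1 : (s.card : ℝ) ≤ (Finset.Icc ⌈y - r⌉ ⌊y + r⌋).card := by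
    exact_mod_cast Finset.card_le_card hsub
  refine h1.trans ?_
  rw [Int.card_Icc]
  have h2 := Int.floor_le (y + r)
  have h3 := Int.le_ceil (y - r)
  rcases le_total 0 (⌊y + r⌋ + 1 - ⌈y - r⌉) with h4 | h4
  · have : (((⌊y + r⌋ + 1 - ⌈y - r⌉).toNat : ℤ) : ℝ) = ⌊y + r⌋ + 1 - ⌈y - r⌉ := by
      rw [Int.toNat_of_nonneg h4]; push_cast; ring
    rw [Int.cast_natCast] at this
    linarith
  · rw [Int.toNat_of_nonpos h4]
    push_cast
    linarith

/-- In a block of `q` consecutive integers few multiples of `γ ≈ a / q` are near an integer. -/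
lemma card_block_le {γ η : ℝ} {a : ℤ} {q : ℕ} (hq : 1 ≤ q) (haq : IsCoprime a (q : ℤ))
    (hγ : |γ - a / q| ≤ 1 / (q : ℝ) ^ 2) (hη : 0 ≤ η) (n₀ : ℕ) :
    (((Finset.Icc (n₀ + 1) (n₀ + q)).filter (fun n : ℕ => distInt (γ * n) ≤ η)).card : ℝ)
      ≤ 6 * η * q + 9 := by
  have hq0 : (0 : ℝ) < q := by exact_mod_cast hq
  set s := (Finset.Icc (n₀ + 1) (n₀ + q)).filter (fun n : ℕ => distInt (γ * n) ≤ η) with hs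
  -- The trivial bound suffices for `η ≥ 1 / 2` and for `q = 1`.
  have htriv : (s.card : ℝ) ≤ q := by
    have : s.card ≤ (Finset.Icc (n₀ + 1) (n₀ + q)).card := Finset.card_filter_le _ _
    rw [Nat.card_Icc] at this
    have h2 : s.card ≤ q := by omega
    exact_mod_cast h2
  rcases lt_or_ge η (1 / 2) with hη2 | hη2
  swap
  · nlinarith
  rcases lt_or_ge q 2 with hq2 | hq2
  · have : (q : ℝ) ≤ 1 := by exact_mod_cast (by omega : q ≤ 1)
    nlinarith [mul_nonneg hη hq0.le]
  have hq2' : (2 : ℝ) ≤ q := by exact_mod_cast hq2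
  have hinv : 1 / (q : ℝ) ≤ 1 / 2 := one_div_le_one_div_of_le (by norm_num) hq2'
  set c : ℝ := Int.fract (γ * n₀) with hc
  set g : ℕ → ℤ := fun n => (a * ((n : ℤ) - n₀)) % q with hg
  have hqz : (q : ℤ) ≠ 0 := by exact_mod_cast hq0.ne'
  have hqz' : (0 : ℤ) < q := by exact_mod_cast hq0
  -- The residues `a (n - n₀) mod q` are distinct within the block. By `hval` below, those coming
  -- from `s` lie in three short intervals.
  have hginj : Set.InjOn g s := by
    intro n hn n' hn' h
    have hn1 := Finset.mem_Icc.mp (Finset.mem_filter.mp hn).1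
    have hn1' := Finset.mem_Icc.mp (Finset.mem_filter.mp hn').1
    simp only [hg] at h
    have h1 : (q : ℤ) ∣ a * ((n : ℤ) - n') := by
      have h0 := Int.dvd_of_emod_eq_zero (Int.emod_eq_emod_iff_emod_sub_eq_zero.mp h)
      rwa [← mul_sub, sub_sub_sub_cancel_right] at h0
    have h2 : (q : ℤ) ∣ (n : ℤ) - n' := haq.symm.dvd_of_dvd_mul_left h1
    have h3 := Int.eq_zero_of_abs_lt_dvd h2 (by rw [abs_lt]; constructor <;> omega)
    omega
  have hval : ∀ u ∈ s.image g, ∃ k ∈ ({0, 1, 2} : Finset ℤ),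
      |(u : ℝ) - q * (k - c)| ≤ q * η + 1 := by
    intro u hu
    obtain ⟨n, hn, rfl⟩ := Finset.mem_image.mp hu
    obtain ⟨hn1, hn2⟩ := Finset.mem_filter.mp hn
    rw [Finset.mem_Icc] at hn1
    set w : ℤ := g n with hw
    have hw0 : 0 ≤ w := Int.emod_nonneg _ hqz
    have hw1 : w < q := Int.emod_lt_of_pos _ hqz'
    have hw0' : (0 : ℝ) ≤ w := by exact_mod_cast hw0
    have hw1' : (w : ℝ) < q := by exact_mod_cast hw1
    set j : ℤ := (a * ((n : ℤ) - n₀)) / q with hj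
    have hdiv : (q : ℝ) * j + w = a * ((n : ℝ) - n₀) := by
      have h0 : (q : ℤ) * j + w = a * ((n : ℤ) - n₀) := Int.mul_ediv_add_emod _ _
      have h0' := congrArg (Int.cast (R := ℝ)) h0
      push_cast at h0'
      exact h0'
    set k : ℤ := round (γ * n) - ⌊γ * n₀⌋ - j with hk
    -- Up to an error `1 / q`, `γ n` is `γ n₀ + a (n - n₀) / q`.
    have hclose : |(w : ℝ) / q + c - k| ≤ η + 1 / q := by
      have e1 : (w : ℝ) / q + c - k = (γ * n - round (γ * n)) - (γ - a / q) * (n - n₀) := by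
        have h2 : (w : ℝ) / q = a * ((n : ℝ) - n₀) / q - j := by
          field_simp
          linarith
        have h3 : γ * n₀ = ⌊γ * n₀⌋ + c := (Int.floor_add_fract _).symm
        rw [h2, hk]
        push_cast
        linear_combination -h3
      rw [e1]
      have h4 : |(γ - a / q) * ((n : ℝ) - n₀)| ≤ 1 / q := by
        rw [abs_mul]
        have h5 : |(n : ℝ) - n₀| ≤ q := by
          have h6 : (n₀ : ℝ) + 1 ≤ n := by exact_mod_cast hn1.1
          have h7 : (n : ℝ) ≤ n₀ + q := by exact_mod_cast hn1.2
          rw [abs_le]; constructor <;> linarith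
        calc |γ - a / q| * |(n : ℝ) - n₀| ≤ 1 / (q : ℝ) ^ 2 * q := by gcongr
          _ = 1 / q := by field_simp
      calc _ ≤ |γ * n - round (γ * n)| + |(γ - a / q) * ((n : ℝ) - n₀)| := abs_sub _ _
        _ ≤ η + 1 / q := add_le_add hn2 h4
    have hlt : |(w : ℝ) / q + c - k| < 1 := by linarith
    rw [abs_lt] at hlt
    have hc0 : 0 ≤ c := Int.fract_nonneg _
    have hc1 : c < 1 := Int.fract_lt_one _
    have hwq0 : 0 ≤ (w : ℝ) / q := by positivity
    have hwq1 : (w : ℝ) / q < 1 := by rw [div_lt_one hq0]; exact hw1'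
    refine ⟨k, ?_, ?_⟩
    · have hk1 : -1 < k := by
        have : (-1 : ℝ) < k := by linarith
        exact_mod_cast this
      have hk2 : k < 3 := by
        have : (k : ℝ) < 3 := by linarith
        exact_mod_cast this
      simp only [Finset.mem_insert, Finset.mem_singleton]
      omega
    · have e2 : (w : ℝ) - q * (k - c) = q * ((w : ℝ) / q + c - k) := by
        field_simp
        ring
      rw [e2, abs_mul, abs_of_pos hq0]
      calc (q : ℝ) * |(w : ℝ) / q + c - k| ≤ q * (η + 1 / q) := by gcongr
        _ = q * η + 1 := by field_simp
  classical
  have hcard : s.card = (s.image g).card := (Finset.card_image_of_injOn hginj).symm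
  have hsub : s.image g ⊆ ({0, 1, 2} : Finset ℤ).biUnion fun k =>
      (s.image g).filter (fun u : ℤ => |(u : ℝ) - q * (k - c)| ≤ q * η + 1) := by
    intro u hu
    obtain ⟨k, hk1, hk2⟩ := hval u hu
    exact Finset.mem_biUnion.mpr ⟨k, hk1, Finset.mem_filter.mpr ⟨hu, hk2⟩⟩
  have h1 := (Finset.card_le_card hsub).trans Finset.card_biUnion_le
  rw [hcard]
  have h2 : ((s.image g).card : ℝ) ≤ ∑ k ∈ ({0, 1, 2} : Finset ℤ),
      (((s.image g).filter (fun u : ℤ => |(u : ℝ) - q * (k - c)| ≤ q * η + 1)).card : ℝ) := by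
    exact_mod_cast h1
  refine h2.trans ((Finset.sum_le_sum fun k _ => card_le_of_abs_sub_le _ (r := q * η + 1)
    (by positivity) fun u hu => (Finset.mem_filter.mp hu).2).trans ?_)
  rw [Finset.sum_const, show ({0, 1, 2} : Finset ℤ).card = 3 from rfl, nsmul_eq_mul]
  push_cast
  nlinarith

/-- The positive integers up to `N` whose multiple of `γ` is within `η` of an integer. -/
noncomputable def nearInt (γ η : ℝ) (N : ℕ) : Finset ℕ :=
  (Finset.Icc 1 N).filter (fun n : ℕ => distInt (γ * n) ≤ η)

/-- Cut into blocks of length `q`. -/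
lemma card_nearInt_le {γ η : ℝ} {a : ℤ} {q : ℕ} (hq : 1 ≤ q) (haq : IsCoprime a (q : ℤ))
    (hγ : |γ - a / q| ≤ 1 / (q : ℝ) ^ 2) (hη : 0 ≤ η) (N : ℕ) :
    ((nearInt γ η N).card : ℝ) ≤ (N / q + 1) * (6 * η * q + 9) := by
  have hmaps : ∀ n ∈ nearInt γ η N, (n - 1) / q ∈ Finset.range (N / q + 1) := by
    intro n hn
    have := Finset.mem_Icc.mp (Finset.mem_filter.mp hn).1
    rw [Finset.mem_range, Nat.lt_succ_iff]
    exact Nat.div_le_div_right (by omega)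
  rw [Finset.card_eq_sum_card_fiberwise hmaps]
  push_cast
  calc ∑ j ∈ Finset.range (N / q + 1),
        (((nearInt γ η N).filter (fun n => (n - 1) / q = j)).card : ℝ)
      ≤ ∑ j ∈ Finset.range (N / q + 1), (6 * η * q + 9) := by
        refine Finset.sum_le_sum fun j _ => ?_
        refine le_trans ?_ (card_block_le hq haq hγ hη (j * q))
        refine Nat.cast_le.mpr (Finset.card_le_card ?_)
        intro n hn
        obtain ⟨hn1, hn2⟩ := Finset.mem_filter.mp hn
        obtain ⟨hn3, hn4⟩ := Finset.mem_filter.mp hn1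
        rw [Finset.mem_Icc] at hn3
        refine Finset.mem_filter.mpr ⟨?_, hn4⟩
        rw [Finset.mem_Icc]
        have e1 := Nat.div_add_mod (n - 1) q
        have e2 := Nat.mod_lt (n - 1) (show q > 0 by omega)
        rw [hn2, mul_comm] at e1
        omega
    _ = ((N / q : ℕ) + 1) * (6 * η * q + 9) := by
        rw [Finset.sum_const, Finset.card_range, nsmul_eq_mul]; push_cast; ring
    _ ≤ (N / q + 1) * (6 * η * q + 9) := by
        gcongr
        exact Nat.cast_div_le

/-- Cauchy's inequality: rare close multiples carry little divisor mass. -/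
lemma sq_sum_tau_nearInt_le {K : ℝ} {X : ℕ} (hK : TauBound K X) (γ η : ℝ) {N : ℕ} (hN : N ≤ X) :
    (∑ n ∈ nearInt γ η N, tau n ^ 2) ^ 2 ≤ K * N * (nearInt γ η N).card := by
  have h1 := sq_sum_le_card_mul_sum_sq (s := nearInt γ η N) (f := fun n => tau n ^ 2)
  have h2 : ∑ n ∈ nearInt γ η N, (tau n ^ 2) ^ 2 ≤ K * N := by
    refine le_trans ?_ (hK N hN)
    refine (Finset.sum_le_sum_of_subset_of_nonneg (Finset.filter_subset _ _) fun n _ _ => by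
      positivity).trans (le_of_eq (Finset.sum_congr rfl fun n _ => by ring))
  calc _ ≤ ((nearInt γ η N).card : ℝ) * ∑ n ∈ nearInt γ η N, (tau n ^ 2) ^ 2 := h1
    _ ≤ (nearInt γ η N).card * (K * N) := by gcongr
    _ = _ := by ring

/-- The number of `1 ≤ t ≤ T` for which `2 h m t γ` is within `η` of an integer. -/
noncomputable def hitCount (γ η : ℝ) (T h m : ℕ) : ℕ :=
  ((Finset.Icc 1 T).filter (fun t : ℕ => distInt (γ * (2 * h * m * t : ℕ)) ≤ η)).card

lemma hitCount_le (γ η : ℝ) (T h m : ℕ) : hitCount γ η T h m ≤ T :=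
  (Finset.card_filter_le _ _).trans (by simp)

/-- Each close multiple `n = 2 h m t` of `γ` is hit by at most `tau n ^ 2` triples, as `h` and `m`
determine `t`. -/
lemma sum_hitCount_le (γ η : ℝ) (H Q T : ℕ) :
    ∑ m ∈ Finset.Icc 1 Q, ∑ h ∈ Finset.Icc 1 H, (hitCount γ η T h m : ℝ)
      ≤ ∑ n ∈ nearInt γ η (2 * H * Q * T), tau n ^ 2 := by
  set s : Finset (ℕ × ℕ × ℕ) := (Finset.Icc 1 Q ×ˢ Finset.Icc 1 H ×ˢ Finset.Icc 1 T).filter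
    (fun p => distInt (γ * (2 * p.2.1 * p.1 * p.2.2 : ℕ)) ≤ η) with hs
  have h1 : ∑ m ∈ Finset.Icc 1 Q, ∑ h ∈ Finset.Icc 1 H, (hitCount γ η T h m : ℝ)
      = ∑ _p ∈ s, (1 : ℝ) := by
    rw [hs, Finset.sum_filter, Finset.sum_product]
    refine Finset.sum_congr rfl fun m _ => ?_
    rw [Finset.sum_product]
    refine Finset.sum_congr rfl fun h _ => ?_
    rw [hitCount, Finset.card_filter]
    push_cast
    rfl
  rw [h1]
  refine (sum_comp_le s (nearInt γ η (2 * H * Q * T)) (fun p => 2 * p.2.1 * p.1 * p.2.2) ?_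
    (fun _ => 1) (fun _ _ => zero_le_one) (fun n => tau n ^ 2) ?_).trans (by simp)
  · intro p hp
    obtain ⟨hp1, hp2⟩ := Finset.mem_filter.mp hp
    simp only [Finset.mem_product, Finset.mem_Icc] at hp1
    obtain ⟨⟨a1, a2⟩, ⟨b1, b2⟩, c1, c2⟩ := hp1
    refine Finset.mem_filter.mpr ⟨?_, hp2⟩
    rw [Finset.mem_Icc]
    constructor
    · have : 0 < 2 * p.2.1 * p.1 * p.2.2 := by positivity
      omega
    · gcongr
  · intro n hn
    have hn0 : n ≠ 0 := by
      have := (Finset.mem_Icc.mp (Finset.mem_filter.mp hn).1).1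
      omega
    have h2 : (s.filter (fun p => 2 * p.2.1 * p.1 * p.2.2 = n)).card
        ≤ (n.divisors ×ˢ n.divisors).card := by
      refine Finset.card_le_card_of_injOn (fun p => (p.1, p.2.1)) ?_ ?_
      · intro p hp
        have hp2 := (Finset.mem_filter.mp hp).2
        rw [Finset.mem_coe, Finset.mem_product, Nat.mem_divisors, Nat.mem_divisors]
        refine ⟨⟨⟨2 * p.2.1 * p.2.2, ?_⟩, hn0⟩, ⟨⟨2 * p.1 * p.2.2, ?_⟩, hn0⟩⟩ <;>
          rw [← hp2] <;> ring
      · intro p hp p' hp' h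
        have hp2 := (Finset.mem_filter.mp hp).2
        have hp2' := (Finset.mem_filter.mp hp').2
        simp only [Prod.mk.injEq] at h
        refine Prod.ext h.1 (Prod.ext h.2 ?_)
        rw [← h.1, ← h.2, ← hp2] at hp2'
        refine (Nat.eq_of_mul_eq_mul_left ?_ hp2').symm
        rcases Nat.eq_zero_or_pos (2 * p.2.1 * p.1) with h0 | h0
        · rw [h0, zero_mul] at hp2
          exact absurd hp2.symm hn0
        · exact h0
    rw [Finset.card_product] at h2
    unfold tau
    rw [sq]
    exact_mod_cast h2

/-- The shifts `t` and `-t` behave alike, and `t = 0` is always bad. -/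
lemma badCount_le (M : ℕ) (ε γ : ℝ) (h m : ℤ) :
    badCount M ε (γ * (h * m : ℤ)) ≤ 1 + 2 * hitCount γ (1 / (M * ε)) M h.natAbs m.natAbs := by
  set η : ℝ := 1 / (M * ε) with hη
  set S := (Finset.Icc 1 M).filter
    (fun t : ℕ => distInt (γ * (2 * h.natAbs * m.natAbs * t : ℕ)) ≤ η) with hS
  have hsub : (Finset.Icc (-(M : ℤ)) M).filter
      (fun t : ℤ => distInt (2 * (γ * (h * m : ℤ)) * t) ≤ η)
      ⊆ {0} ∪ (S.image (fun t : ℕ => (t : ℤ)) ∪ S.image (fun t : ℕ => -(t : ℤ))) := by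
    intro t ht
    obtain ⟨ht1, ht2⟩ := Finset.mem_filter.mp ht
    rw [Finset.mem_Icc] at ht1
    by_cases h0 : t = 0
    · simp [h0]
    have hmem : t.natAbs ∈ S := by
      refine Finset.mem_filter.mpr ⟨?_, ?_⟩
      · rw [Finset.mem_Icc]; omega
      · have habs : (γ * (2 * h.natAbs * m.natAbs * t.natAbs : ℕ) : ℝ)
            = 2 * (γ * (h * m : ℤ)) * t ∨ (γ * (2 * h.natAbs * m.natAbs * t.natAbs : ℕ) : ℝ)
            = -(2 * (γ * (h * m : ℤ)) * t) := by
          have e : ((h.natAbs * m.natAbs * t.natAbs : ℕ) : ℝ) = |((h * m * t : ℤ) : ℝ)| := by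
            rw [← Int.natAbs_mul, ← Int.natAbs_mul, Nat.cast_natAbs, Int.cast_abs]
          have e2 : (γ * (2 * h.natAbs * m.natAbs * t.natAbs : ℕ) : ℝ)
              = 2 * γ * ((h.natAbs * m.natAbs * t.natAbs : ℕ) : ℝ) := by push_cast; ring
          rw [e2, e]
          rcases abs_choice ((h * m * t : ℤ) : ℝ) with h3 | h3
          · left; rw [h3]; push_cast; ring
          · right; rw [h3]; push_cast; ring
        rcases habs with h3 | h3
        · rw [h3]; exact ht2
        · rw [h3, distInt_neg]; exact ht2
    simp only [Finset.mem_union, Finset.mem_singleton, Finset.mem_image]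
    right
    rcases Int.natAbs_eq t with h3 | h3
    · left; exact ⟨_, hmem, h3.symm⟩
    · right; exact ⟨_, hmem, h3.symm⟩
  have h1 := (Finset.card_le_card hsub).trans (Finset.card_union_le _ _)
  have h2 := Finset.card_union_le (S.image (fun t : ℕ => (t : ℤ))) (S.image (fun t : ℕ => -(t : ℤ)))
  have h3 : (S.image (fun t : ℕ => (t : ℤ))).card ≤ S.card := Finset.card_image_le
  have h4 : (S.image (fun t : ℕ => -(t : ℤ))).card ≤ S.card := Finset.card_image_le
  rw [Finset.card_singleton] at h1
  change _ ≤ 1 + 2 * S.card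
  change ((Finset.Icc (-(M : ℤ)) M).filter
      (fun t : ℤ => distInt (2 * (γ * (h * m : ℤ)) * t) ≤ η)).card ≤ _
  omega

/-- The hits, summed over a box of `v` and over `h`, in terms of the close multiples of `γ`.
Passing from `v` to its norm costs one application of Cauchy's inequality. -/
lemma sq_sum_hitCount_box_le {K : ℝ} {X : ℕ} (hK : TauBound K X) (hK1 : 1 ≤ K) (γ η : ℝ)
    {V H T : ℕ} (hV : 1 ≤ V) (hX : 4 * V ^ 2 ≤ X) :
    (∑ v ∈ (box V).filter (· ≠ 0), ∑ h ∈ Finset.Icc 1 H,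
      (hitCount γ η T h (nrm v).natAbs : ℝ)) ^ 2
      ≤ 132 * V ^ 2 * K * (H * T * ∑ n ∈ nearInt γ η (2 * H * (2 * V ^ 2) * T), tau n ^ 2) := by
  set G : ℕ → ℝ := fun m => ∑ h ∈ Finset.Icc 1 H, (hitCount γ η T h m : ℝ) with hG
  have hG0 : ∀ m, 0 ≤ G m := fun m => Finset.sum_nonneg fun h _ => Nat.cast_nonneg _
  have hGle : ∀ m, G m ≤ H * T := by
    intro m
    calc G m ≤ ∑ h ∈ Finset.Icc 1 H, (T : ℝ) :=
          Finset.sum_le_sum fun h _ => by exact_mod_cast hitCount_le γ η T h m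
      _ = H * T := by simp
  have hmaps : ∀ v ∈ (box V).filter (· ≠ 0), (nrm v).natAbs ∈ Finset.Icc 1 (2 * V ^ 2) := by
    intro v hv
    obtain ⟨hv1, hv2⟩ := Finset.mem_filter.mp hv
    rw [mem_box] at hv1
    have h1 : v.1 ^ 2 ≤ (V : ℤ) ^ 2 := sq_le_sq.mpr (by simpa using hv1.1)
    have h2 : v.2 ^ 2 ≤ (V : ℤ) ^ 2 := sq_le_sq.mpr (by simpa using hv1.2)
    have h3 : 0 < nrm v := by
      unfold nrm
      by_contra h
      have h4 : v.1 = 0 := by nlinarith [sq_nonneg v.1, sq_nonneg v.2]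
      have h5 : v.2 = 0 := by nlinarith [sq_nonneg v.1, sq_nonneg v.2]
      exact hv2 (Prod.ext h4 h5)
    rw [Finset.mem_Icc]
    constructor
    · omega
    · zify
      rw [abs_of_pos h3]
      unfold nrm
      linarith
  have h1 := sq_sum_comp_le ((box V).filter (· ≠ 0)) (Finset.Icc 1 (2 * V ^ 2))
    (fun v => (nrm v).natAbs) hmaps G
  have h2 : (energy ((box V).filter (· ≠ 0)) (fun v => (nrm v).natAbs) : ℝ)
      ≤ 132 * V ^ 2 * K := by
    refine le_trans ?_ (energy_nrm_le hK hV hX hK1)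
    have h3 : energy ((box V).filter (· ≠ 0)) (fun v => (nrm v).natAbs)
        ≤ energy (box V) (fun v => (nrm v).natAbs) := energy_mono (Finset.filter_subset _ _) _
    have h4 : energy (box V) (fun v => (nrm v).natAbs) = energy (box V) nrm := by
      unfold energy
      congr 1
      refine Finset.filter_congr fun p _ => ?_
      have e1 : 0 ≤ nrm p.1 := by unfold nrm; positivity
      have e2 : 0 ≤ nrm p.2 := by unfold nrm; positivity
      change (nrm p.1).natAbs = (nrm p.2).natAbs ↔ _
      omega
    rw [h4] at h3
    exact_mod_cast h3
  have h5 : ∑ m ∈ Finset.Icc 1 (2 * V ^ 2), G m ^ 2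
      ≤ H * T * ∑ n ∈ nearInt γ η (2 * H * (2 * V ^ 2) * T), tau n ^ 2 := by
    calc ∑ m ∈ Finset.Icc 1 (2 * V ^ 2), G m ^ 2
        ≤ ∑ m ∈ Finset.Icc 1 (2 * V ^ 2), H * T * G m :=
          Finset.sum_le_sum fun m _ => by
            rw [sq]; exact mul_le_mul_of_nonneg_right (hGle m) (hG0 m)
      _ = H * T * ∑ m ∈ Finset.Icc 1 (2 * V ^ 2), G m := by rw [Finset.mul_sum]
      _ ≤ _ := mul_le_mul_of_nonneg_left (sum_hitCount_le γ η H (2 * V ^ 2) T) (by positivity)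
  refine h1.trans ?_
  have h6 : 0 ≤ ∑ m ∈ Finset.Icc 1 (2 * V ^ 2), G m ^ 2 :=
    Finset.sum_nonneg fun m _ => sq_nonneg _
  exact mul_le_mul h2 h5 h6 (by positivity)

/-! ### Correlations of the sieve weights along two Gaussian integers -/

/-- The weight `∑_{f ∣ l} lam f`, over `1 ≤ f ≤ G`, for positive `l`, extended by `0` to `l ≤ 0`. -/
noncomputable def divWeight (lam : ℕ → ℝ) (G : ℕ) (l : ℤ) : ℝ :=
  if 0 < l then ∑ f ∈ Finset.Icc 1 G, if (f : ℤ) ∣ l then lam f else 0 else 0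

/-- The number of divisors `1 ≤ f ≤ G` of `l`; for `l = 0` this is `G`. -/
noncomputable def divCount (G : ℕ) (l : ℤ) : ℝ :=
  ∑ f ∈ Finset.Icc 1 G, if (f : ℤ) ∣ l then 1 else 0

lemma divCount_nonneg (G : ℕ) (l : ℤ) : 0 ≤ divCount G l :=
  Finset.sum_nonneg fun f _ => by split_ifs <;> norm_num

lemma divCount_le (G : ℕ) (l : ℤ) : divCount G l ≤ G := by
  calc divCount G l ≤ ∑ f ∈ Finset.Icc 1 G, (1 : ℝ) :=
        Finset.sum_le_sum fun f _ => by split_ifs <;> norm_num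
    _ = G := by simp

lemma divCount_le_tau (G : ℕ) {l : ℤ} (hl : l ≠ 0) : divCount G l ≤ tau l.natAbs := by
  unfold divCount tau
  rw [← Finset.sum_filter, Finset.sum_const, nsmul_eq_mul, mul_one]
  refine Nat.cast_le.mpr (Finset.card_le_card fun f hf => ?_)
  rw [Nat.mem_divisors]
  exact ⟨Int.natCast_dvd.mp (Finset.mem_filter.mp hf).2, by simpa using hl⟩

lemma abs_divWeight_le {lam : ℕ → ℝ} {Lam : ℝ} (hLam : 0 ≤ Lam) (hlam : ∀ f, |lam f| ≤ Lam)
    (G : ℕ) (l : ℤ) : |divWeight lam G l| ≤ Lam * tau l.natAbs := by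
  unfold divWeight
  split_ifs with hl
  · refine le_trans ?_ (mul_le_mul_of_nonneg_left (divCount_le_tau G hl.ne') hLam)
    unfold divCount
    rw [Finset.mul_sum]
    refine (Finset.abs_sum_le_sum_abs _ _).trans (Finset.sum_le_sum fun f _ => ?_)
    split_ifs
    · simpa using hlam f
    · simp
  · rw [abs_zero]
    exact mul_nonneg hLam (tau_nonneg _)

lemma quadratic_le_of_le_of_le {A B C x : ℤ} (hA : 0 ≤ A) {a b c : ℤ} (hab : a ≤ b) (hbc : b ≤ c)
    (ha : A * a ^ 2 + B * a + C ≤ x) (hc : A * c ^ 2 + B * c + C ≤ x) :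
    A * b ^ 2 + B * b + C ≤ x := by
  rcases hab.eq_or_lt with rfl | hab'
  · exact ha
  have h1 : 0 ≤ A * ((c - a) * (c - b) * (b - a)) := by
    have : 0 ≤ c - a := by linarith
    have : 0 ≤ c - b := by linarith
    have : 0 ≤ b - a := by linarith
    positivity
  have h2 : (c - a) * (A * b ^ 2 + B * b + C) ≤ (c - a) * x := by
    have h3 : (c - b) * (A * a ^ 2 + B * a + C) ≤ (c - b) * x :=
      mul_le_mul_of_nonneg_left ha (by linarith)
    have h4 : (b - a) * (A * c ^ 2 + B * c + C) ≤ (b - a) * x :=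
      mul_le_mul_of_nonneg_left hc (by linarith)
    nlinarith
  exact le_of_mul_le_mul_left h2 (by linarith)

/-- The lattice of all `u` with `f₁ ∣ Im (ρ₁ u)` and `f₂ ∣ Im (ρ₂ u)`. -/
def divLattice (ρ₁ ρ₂ : ℤ × ℤ) (f₁ f₂ : ℕ) : AddSubgroup (ℤ × ℤ) where
  carrier := {u | (f₁ : ℤ) ∣ imMul ρ₁ u ∧ (f₂ : ℤ) ∣ imMul ρ₂ u}
  zero_mem' := by simp [imMul]
  add_mem' := by
    rintro u v ⟨h1, h2⟩ ⟨h3, h4⟩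
    refine ⟨?_, ?_⟩
    · have : imMul ρ₁ (u + v) = imMul ρ₁ u + imMul ρ₁ v := by
        simp only [imMul, Prod.fst_add, Prod.snd_add]; ring
      rw [this]; exact dvd_add h1 h3
    · have : imMul ρ₂ (u + v) = imMul ρ₂ u + imMul ρ₂ v := by
        simp only [imMul, Prod.fst_add, Prod.snd_add]; ring
      rw [this]; exact dvd_add h2 h4
  neg_mem' := by
    rintro u ⟨h1, h2⟩
    refine ⟨?_, ?_⟩
    · have : imMul ρ₁ (-u) = -imMul ρ₁ u := by
        simp only [imMul, Prod.fst_neg, Prod.snd_neg]; ring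
      rw [this]; exact (dvd_neg).mpr h1
    · have : imMul ρ₂ (-u) = -imMul ρ₂ u := by
        simp only [imMul, Prod.fst_neg, Prod.snd_neg]; ring
      rw [this]; exact (dvd_neg).mpr h2

lemma mem_divLattice {ρ₁ ρ₂ : ℤ × ℤ} {f₁ f₂ : ℕ} {u : ℤ × ℤ} :
    u ∈ divLattice ρ₁ ρ₂ f₁ f₂ ↔ (f₁ : ℤ) ∣ imMul ρ₁ u ∧ (f₂ : ℤ) ∣ imMul ρ₂ u := Iff.rfl

/-- The convex region of the `u` in a box with `N(ρ₁ u), N(ρ₂ u) ≤ x` and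
`Im (ρ₁ u), Im (ρ₂ u) > 0`. -/
def region (x R : ℤ) (ρ₁ ρ₂ u : ℤ × ℤ) : Prop :=
  (|u.1| ≤ R ∧ |u.2| ≤ R) ∧ (nrm ρ₁ * nrm u ≤ x ∧ nrm ρ₂ * nrm u ≤ x) ∧
    0 < imMul ρ₁ u ∧ 0 < imMul ρ₂ u

/-- Along a line the region is an interval: the conditions are linear or convex quadratic. -/
lemma region_convex {x R : ℤ} {ρ₁ ρ₂ u v : ℤ × ℤ} {a b c : ℤ} (hab : a ≤ b) (hbc : b ≤ c)
    (ha : region x R ρ₁ ρ₂ (u + a • v)) (hc : region x R ρ₁ ρ₂ (u + c • v)) :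
    region x R ρ₁ ρ₂ (u + b • v) := by
  simp only [region, abs_le, imMul, Prod.fst_add, Prod.snd_add, Prod.smul_fst, Prod.smul_snd,
    smul_eq_mul] at ha hc ⊢
  obtain ⟨⟨⟨a1, a2⟩, a3, a4⟩, ⟨a5, a6⟩, a7, a8⟩ := ha
  obtain ⟨⟨⟨c1, c2⟩, c3, c4⟩, ⟨c5, c6⟩, c7, c8⟩ := hc
  have hlin : ∀ B C y : ℤ, B * a + C ≤ y → B * c + C ≤ y → B * b + C ≤ y := by
    intro B C y h1 h2
    have := quadratic_le_of_le_of_le (A := 0) (B := B) (C := C) (x := y) le_rfl hab hbc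
      (by linarith) (by linarith)
    linarith
  have hn : ∀ t : ℤ, ∀ d : ℤ, d * nrm (u + t • v)
      = d * nrm v * t ^ 2 + d * (2 * (u.1 * v.1 + u.2 * v.2)) * t + d * nrm u := by
    intro t d
    simp only [nrm, Prod.fst_add, Prod.snd_add, Prod.smul_fst, Prod.smul_snd, smul_eq_mul]
    ring
  have hnn : ∀ w : ℤ × ℤ, 0 ≤ nrm w := fun w => by unfold nrm; positivity
  rw [hn] at a5 a6 c5 c6 ⊢
  rw [hn]
  refine ⟨⟨⟨?_, ?_⟩, ?_, ?_⟩, ⟨?_, ?_⟩, ?_, ?_⟩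
  · have := hlin (-v.1) (-u.1) R (by linarith) (by linarith); linarith
  · have := hlin v.1 u.1 R (by linarith) (by linarith); linarith
  · have := hlin (-v.2) (-u.2) R (by linarith) (by linarith); linarith
  · have := hlin v.2 u.2 R (by linarith) (by linarith); linarith
  · exact quadratic_le_of_le_of_le (mul_nonneg (hnn _) (hnn _)) hab hbc a5 c5
  · exact quadratic_le_of_le_of_le (mul_nonneg (hnn _) (hnn _)) hab hbc a6 c6
  · have := hlin (-(ρ₁.1 * v.2 + ρ₁.2 * v.1)) (-(ρ₁.1 * u.2 + ρ₁.2 * u.1)) (-1)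
      (by linarith) (by linarith)
    linarith
  · have := hlin (-(ρ₂.1 * v.2 + ρ₂.2 * v.1)) (-(ρ₂.1 * u.2 + ρ₂.2 * u.1)) (-1)
      (by linarith) (by linarith)
    linarith

/-- The correlation of the weights along `ρ₁` and `ρ₂`, twisted by a quadratic phase. Opening the
weights leaves sums over lattices; these are averaged over their short vectors `v`, and the sum
over the moduli then only counts divisors of `Im (ρ₁ v)` and `Im (ρ₂ v)`. -/
lemma norm_correlation_le {lam : ℕ → ℝ} {Lam : ℝ} (hlam : ∀ f, |lam f| ≤ Lam) (G x : ℕ)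
    {R M V : ℕ} (hV : 1 ≤ V) (hM : 1 ≤ M) (hMV : M * V ≤ R) (hR : R < 2 * M * V)
    {ε : ℝ} (hε : 0 < ε) (γ : ℝ) (ρ₁ ρ₂ : ℤ × ℤ) :
    ‖∑ u ∈ box R, if nrm ρ₁ * nrm u ≤ x ∧ nrm ρ₂ * nrm u ≤ x then
      (divWeight lam G (imMul ρ₁ u) * divWeight lam G (imMul ρ₂ u) : ℂ)
        * e (γ * ((nrm ρ₁ - nrm ρ₂) * nrm u : ℤ)) else 0‖
    ≤ Lam ^ 2 * (64 * M * ∑ v ∈ box V, divCount G (imMul ρ₁ v) * divCount G (imMul ρ₂ v) *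
        weylBound M ε (γ * ((nrm ρ₁ - nrm ρ₂) * nrm v : ℤ))) := by
  classical
  set h : ℤ := nrm ρ₁ - nrm ρ₂ with hh
  set F : ℕ → ℕ → ℤ × ℤ → ℂ := fun f₁ f₂ u =>
    if u ∈ divLattice ρ₁ ρ₂ f₁ f₂ ∧ region x R ρ₁ ρ₂ u then e (γ * (h * nrm u : ℤ)) else 0 with hF
  -- Positivity of the arguments of the weights is part of `region`, so only the divisibility
  -- conditions depend on the moduli `f₁`, `f₂`.
  have hexp : ∀ u ∈ box R, (if nrm ρ₁ * nrm u ≤ x ∧ nrm ρ₂ * nrm u ≤ x then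
      (divWeight lam G (imMul ρ₁ u) * divWeight lam G (imMul ρ₂ u) : ℂ)
        * e (γ * (h * nrm u : ℤ)) else 0)
      = ∑ f₁ ∈ Finset.Icc 1 G, ∑ f₂ ∈ Finset.Icc 1 G, (lam f₁ * lam f₂ : ℂ) * F f₁ f₂ u := by
    intro u hu
    rw [mem_box] at hu
    by_cases hreg : region x R ρ₁ ρ₂ u
    · obtain ⟨_, h2, h3, h4⟩ := hreg
      have hreg : region x R ρ₁ ρ₂ u := ⟨hu, h2, h3, h4⟩
      rw [if_pos h2]
      unfold divWeight
      rw [if_pos h3, if_pos h4]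
      push_cast
      rw [Finset.sum_mul_sum, Finset.sum_mul]
      refine Finset.sum_congr rfl fun f₁ _ => ?_
      rw [Finset.sum_mul]
      refine Finset.sum_congr rfl fun f₂ _ => ?_
      simp only [hF, mem_divLattice, hreg, and_true]
      by_cases h5 : (f₁ : ℤ) ∣ imMul ρ₁ u <;> by_cases h6 : (f₂ : ℤ) ∣ imMul ρ₂ u <;>
        simp [h5, h6]
    · have hz : ∀ f₁ f₂, F f₁ f₂ u = 0 := fun f₁ f₂ => by simp [hF, hreg]
      simp only [hz, mul_zero, Finset.sum_const_zero]
      split_ifs with h2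
      · have h3 : ¬ (0 < imMul ρ₁ u ∧ 0 < imMul ρ₂ u) := fun h3 => hreg ⟨hu, h2, h3.1, h3.2⟩
        unfold divWeight
        by_cases h4 : 0 < imMul ρ₁ u
        · rw [if_neg (fun h5 => h3 ⟨h4, h5⟩)]; simp
        · rw [if_neg h4]; simp
      · rfl
  have hone : ∀ f₁ f₂, ‖∑ u ∈ box R, F f₁ f₂ u‖ ≤ 64 * M *
      ∑ v ∈ (box V).filter (· ∈ divLattice ρ₁ ρ₂ f₁ f₂), weylBound M ε (γ * (h * nrm v : ℤ)) := by
    intro f₁ f₂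
    refine norm_sum_lattice_le (divLattice ρ₁ ρ₂ f₁ f₂) hV hM hMV hR (F f₁ f₂) ?_ _ ?_
    · intro u hu
      have h1 : u ∈ divLattice ρ₁ ρ₂ f₁ f₂ ∧ region x R ρ₁ ρ₂ u := by
        by_contra hc
        exact hu (by simp only [hF]; rw [if_neg hc])
      exact ⟨mem_box.mpr h1.2.1, h1.1⟩
    · intro v _ hv u hu
      have hmem : ∀ a : ℤ, u + a • v ∈ divLattice ρ₁ ρ₂ f₁ f₂ := fun a =>
        AddSubgroup.add_mem _ hu (AddSubgroup.zsmul_mem _ hv a)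
      -- Along a line the phase is a quadratic polynomial with leading coefficient `γ h N(v)`.
      have h1 : ∀ a : ℤ, F f₁ f₂ (u + a • v) = if region x R ρ₁ ρ₂ (u + a • v) then
          e (γ * (h * nrm v : ℤ) * a ^ 2 + γ * (h * (2 * (u.1 * v.1 + u.2 * v.2)) : ℤ) * a
            + γ * (h * nrm u : ℤ)) else 0 := by
        intro a
        simp only [hF, hmem a, true_and]
        congr 2
        have : nrm (u + a • v) = nrm v * a ^ 2 + 2 * (u.1 * v.1 + u.2 * v.2) * a + nrm u := by
          simp only [nrm, Prod.fst_add, Prod.snd_add, Prod.smul_fst, Prod.smul_snd, smul_eq_mul]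
          ring
        rw [this]
        push_cast
        ring
      rw [Finset.sum_congr rfl fun a _ => h1 a, ← Finset.sum_filter]
      set s := (Finset.Icc (1 : ℤ) M).filter (fun a => region x R ρ₁ ρ₂ (u + a • v)) with hs
      -- By convexity the admissible `a` form an interval.
      obtain ⟨y, w, hyw⟩ := exists_eq_Icc_of_ordConnected s (by
        intro a ha c hc b hab hbc
        obtain ⟨ha1, ha2⟩ := Finset.mem_filter.mp ha
        obtain ⟨hc1, hc2⟩ := Finset.mem_filter.mp hc
        rw [Finset.mem_Icc] at ha1 hc1
        refine Finset.mem_filter.mpr ⟨?_, region_convex hab hbc ha2 hc2⟩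
        rw [Finset.mem_Icc]
        constructor <;> linarith)
      rcases s.eq_empty_or_nonempty with he | ⟨a₀, ha₀⟩
      · rw [he, Finset.sum_empty, norm_zero]
        exact weylBound_nonneg _ _ _
      · have hyw' : y ≤ w := by
          rw [hyw, Finset.mem_Icc] at ha₀
          linarith
        have hy : y ∈ s := by rw [hyw, Finset.mem_Icc]; exact ⟨le_rfl, hyw'⟩
        have hw : w ∈ s := by rw [hyw, Finset.mem_Icc]; exact ⟨hyw', le_rfl⟩
        have hy1 := (Finset.mem_Icc.mp (Finset.mem_filter.mp hy).1).1
        have hw1 := (Finset.mem_Icc.mp (Finset.mem_filter.mp hw).1).2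
        rw [hyw]
        exact norm_quadratic_sum_le hε hM _ _ _ hy1 hw1
  rw [Finset.sum_congr rfl hexp, Finset.sum_comm]
  have hLam : 0 ≤ Lam := (abs_nonneg _).trans (hlam 0)
  calc ‖∑ f₁ ∈ Finset.Icc 1 G, ∑ u ∈ box R, ∑ f₂ ∈ Finset.Icc 1 G,
          (lam f₁ * lam f₂ : ℂ) * F f₁ f₂ u‖
      = ‖∑ f₁ ∈ Finset.Icc 1 G, ∑ f₂ ∈ Finset.Icc 1 G,
          (lam f₁ * lam f₂ : ℂ) * ∑ u ∈ box R, F f₁ f₂ u‖ := by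
        congr 1
        refine Finset.sum_congr rfl fun f₁ _ => ?_
        rw [Finset.sum_comm]
        refine Finset.sum_congr rfl fun f₂ _ => ?_
        rw [Finset.mul_sum]
    _ ≤ ∑ f₁ ∈ Finset.Icc 1 G, ∑ f₂ ∈ Finset.Icc 1 G, Lam ^ 2 * (64 * M *
        ∑ v ∈ box V, if v ∈ divLattice ρ₁ ρ₂ f₁ f₂ then
          weylBound M ε (γ * (h * nrm v : ℤ)) else 0) := by
        refine (norm_sum_le _ _).trans (Finset.sum_le_sum fun f₁ _ => ?_)
        refine (norm_sum_le _ _).trans (Finset.sum_le_sum fun f₂ _ => ?_)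
        have h9 := hone f₁ f₂
        rw [Finset.sum_filter] at h9
        rw [norm_mul]
        refine mul_le_mul ?_ h9 (norm_nonneg _) (by positivity)
        rw [norm_mul, Complex.norm_real, Complex.norm_real, sq]
        exact mul_le_mul (hlam f₁) (hlam f₂) (norm_nonneg _) hLam
    _ = Lam ^ 2 * (64 * M * ∑ v ∈ box V, ∑ f₁ ∈ Finset.Icc 1 G, ∑ f₂ ∈ Finset.Icc 1 G,
        if v ∈ divLattice ρ₁ ρ₂ f₁ f₂ then weylBound M ε (γ * (h * nrm v : ℤ)) else 0) := by
        simp only [← Finset.mul_sum]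
        congr 2
        symm
        rw [Finset.sum_comm]
        refine Finset.sum_congr rfl fun f₁ _ => ?_
        rw [Finset.sum_comm]
    _ = _ := by
        congr 2
        refine Finset.sum_congr rfl fun v _ => ?_
        unfold divCount
        rw [Finset.sum_mul_sum, Finset.sum_mul]
        refine Finset.sum_congr rfl fun f₁ _ => ?_
        rw [Finset.sum_mul]
        refine Finset.sum_congr rfl fun f₂ _ => ?_
        rw [mem_divLattice]
        by_cases h5 : (f₁ : ℤ) ∣ imMul ρ₁ v <;> by_cases h6 : (f₂ : ℤ) ∣ imMul ρ₂ v <;>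
          simp [h5, h6]

/-! ### Summation over pairs of Gaussian integers of different norms -/

/-- The pairs of elements of `𝒬` with different norms. -/
noncomputable def normPairs (𝒬 : Finset (ℤ × ℤ)) : Finset ((ℤ × ℤ) × (ℤ × ℤ)) :=
  (𝒬 ×ˢ 𝒬).filter (fun p => nrm p.1 ≠ nrm p.2)

/-- The term of a pair and a short vector in the bound for the correlations. -/
noncomputable def pairTerm (G M : ℕ) (ε γ : ℝ) (p : (ℤ × ℤ) × (ℤ × ℤ)) (v : ℤ × ℤ) : ℝ :=
  divCount G (imMul p.1 v) * divCount G (imMul p.2 v) *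
    weylBound M ε (γ * ((nrm p.1 - nrm p.2) * nrm v : ℤ))

lemma tau_le_tau_pow {n k : ℕ} (hn : n ≠ 0) (hk : k ≠ 0) : tau n ≤ tau n ^ k :=
  le_self_pow₀ (one_le_tau hn) hk

lemma sum_tau_le {K : ℝ} {X : ℕ} (hK : TauBound K X) {N : ℕ} (hN : N ≤ X) :
    ∑ n ∈ Finset.Icc 1 N, tau n ≤ K * N :=
  (Finset.sum_le_sum fun n hn => tau_le_tau_pow
    (by have := (Finset.mem_Icc.mp hn).1; omega) (by norm_num)).trans (hK N hN)

lemma imMul_comm_vec {ρ v : ℤ × ℤ} (hρ : IsCoprime ρ.1 ρ.2) (h : imMul ρ v = 0) :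
    ∃ t : ℤ, v = (t * ρ.1, -(t * ρ.2)) := by
  obtain ⟨a, b, hab⟩ := hρ
  unfold imMul at h
  refine ⟨a * v.1 - b * v.2, Prod.ext ?_ ?_⟩
  · linear_combination -v.1 * hab + b * h
  · linear_combination -v.2 * hab + a * h

/-- The contribution of the vectors `v` on the line `Im (ρ v) = 0`. These are the multiples
`t (ρ.1, -ρ.2)`, at which `Im (ρ' v)` factors into `t` and a linear form in `ρ'`. -/
lemma sum_line_le {K : ℝ} {X : ℕ} (hK : TauBound K X) (hK0 : 0 ≤ K) {𝒬 : Finset (ℤ × ℤ)} {P₀ : ℕ}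
    (hP : 𝒬 ⊆ box P₀) (hcop : ∀ ρ ∈ 𝒬, IsCoprime ρ.1 ρ.2) (hX₀ : 2 * P₀ ^ 2 ≤ X) {V : ℕ}
    (hV : V ≤ X) {ρ : ℤ × ℤ} (hρ : ρ ∈ 𝒬) :
    ∑ ρ' ∈ 𝒬, ∑ v ∈ (box V).filter (fun v => imMul ρ v = 0 ∧ imMul ρ' v ≠ 0),
      tau (imMul ρ' v).natAbs ≤ 24 * P₀ ^ 2 * V * K ^ 2 := by
  have hρc := hcop ρ hρ
  -- `Im (ρ' v) = t Im (σ ρ')` for `v = t σ`.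
  set σ : ℤ × ℤ := (ρ.1, -ρ.2) with hσ
  have hσc : IsCoprime σ.1 σ.2 := by
    simp only [hσ]
    exact hρc.neg_right
  have hσP : σ ∈ box P₀ := by
    have := hP hρ
    rw [mem_box] at this ⊢
    simp only [hσ, abs_neg]
    exact this
  have hone : ∀ ρ' ∈ 𝒬, ∑ v ∈ (box V).filter (fun v => imMul ρ v = 0 ∧ imMul ρ' v ≠ 0),
      tau (imMul ρ' v).natAbs ≤
        if imMul σ ρ' ≠ 0 then 2 * K * V * tau (imMul σ ρ').natAbs else 0 := by
    intro ρ' _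
    have hsub : (box V).filter (fun v => imMul ρ v = 0 ∧ imMul ρ' v ≠ 0) ⊆
        ((Finset.Icc 1 V).image (fun t : ℕ => (((t : ℤ) * ρ.1, -((t : ℤ) * ρ.2)) : ℤ × ℤ)) ∪
        (Finset.Icc 1 V).image (fun t : ℕ => ((-(t : ℤ) * ρ.1, -(-(t : ℤ) * ρ.2)) : ℤ × ℤ))).filter
          (fun v => imMul ρ' v ≠ 0) := by
      intro v hv
      obtain ⟨hv1, hv2, hv3⟩ := Finset.mem_filter.mp hv
      obtain ⟨t, rfl⟩ := imMul_comm_vec hρc hv2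
      rw [mem_box] at hv1
      refine Finset.mem_filter.mpr ⟨?_, hv3⟩
      have ht0 : t ≠ 0 := by
        rintro rfl
        exact hv3 (by simp [imMul])
      have htV : |t| ≤ V := by
        simp only [abs_neg, abs_mul] at hv1
        rcases eq_or_ne ρ.1 0 with h0 | h0
        · have h1 : ρ.2 ≠ 0 := by
            intro h1
            rw [h0, h1] at hρc
            exact not_isCoprime_zero_zero hρc
          have h2 : 1 ≤ |ρ.2| := Int.one_le_abs h1
          nlinarith [abs_nonneg t, hv1.2]
        · have h2 : 1 ≤ |ρ.1| := Int.one_le_abs h0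
          nlinarith [abs_nonneg t, hv1.1]
      have hmem : t.natAbs ∈ Finset.Icc 1 V := by
        rw [Finset.mem_Icc]
        refine ⟨Int.natAbs_pos.mpr ht0, ?_⟩
        zify
        exact htV
      rw [Finset.mem_union, Finset.mem_image, Finset.mem_image]
      rcases Int.natAbs_eq t with h3 | h3
      · left; exact ⟨_, hmem, by rw [← h3]⟩
      · right; exact ⟨_, hmem, by rw [← h3]⟩
    refine (Finset.sum_le_sum_of_subset_of_nonneg hsub fun v _ _ => tau_nonneg _).trans ?_
    have him : ∀ t : ℤ, imMul ρ' (t * ρ.1, -(t * ρ.2)) = -(t * -imMul σ ρ') := by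
      intro t; simp only [imMul, hσ]; ring
    split_ifs with h0
    · rw [Finset.sum_filter]
      have hle : ∀ t : ℤ, (if imMul ρ' (t * ρ.1, -(t * ρ.2)) ≠ 0 then
          tau (imMul ρ' (t * ρ.1, -(t * ρ.2))).natAbs else 0)
          ≤ tau t.natAbs * tau (imMul σ ρ').natAbs := by
        intro t
        split_ifs
        · rw [him, Int.natAbs_neg, Int.natAbs_mul, Int.natAbs_neg]
          exact tau_mul_le _ _
        · exact mul_nonneg (tau_nonneg _) (tau_nonneg _)
      have hnn : ∀ v : ℤ × ℤ, 0 ≤ (if imMul ρ' v ≠ 0 then tau (imMul ρ' v).natAbs else 0) := by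
        intro v; split_ifs; exacts [tau_nonneg _, le_rfl]
      have h2 : ∀ A B : Finset (ℤ × ℤ), ∀ f : ℤ × ℤ → ℝ, (∀ v, 0 ≤ f v) →
          ∑ v ∈ A ∪ B, f v ≤ ∑ v ∈ A, f v + ∑ v ∈ B, f v := by
        intro A B f hf
        rw [← Finset.sum_union_inter]
        have := Finset.sum_nonneg (s := A ∩ B) fun v _ => hf v
        linarith
      have h3 : ∀ (g : ℕ → ℤ × ℤ) (f : ℤ × ℤ → ℝ), (∀ v, 0 ≤ f v) →
          ∑ v ∈ (Finset.Icc 1 V).image g, f v ≤ ∑ t ∈ Finset.Icc 1 V, f (g t) := by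
        intro g f hf
        exact Finset.sum_image_le_of_nonneg fun v _ => hf v
      refine (h2 _ _ _ hnn).trans ((add_le_add (h3 _ _ hnn) (h3 _ _ hnn)).trans ?_)
      have h4 : ∑ t ∈ Finset.Icc 1 V, tau t * tau (imMul σ ρ').natAbs
          ≤ K * V * tau (imMul σ ρ').natAbs := by
        rw [← Finset.sum_mul]
        exact mul_le_mul_of_nonneg_right (sum_tau_le hK hV) (tau_nonneg _)
      have h5 := (Finset.sum_le_sum fun (t : ℕ) (_ : t ∈ Finset.Icc 1 V) => hle t).trans
        (le_of_eq (Finset.sum_congr rfl fun t _ => by rw [Int.natAbs_natCast])) |>.trans h4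
      have h6 := (Finset.sum_le_sum fun (t : ℕ) (_ : t ∈ Finset.Icc 1 V) => hle (-(t : ℤ))).trans
        (le_of_eq (Finset.sum_congr rfl fun t _ => by
          rw [Int.natAbs_neg, Int.natAbs_natCast])) |>.trans h4
      linarith
    · push Not at h0
      refine le_of_eq (Finset.sum_eq_zero fun v hv => ?_)
      obtain ⟨hv1, hv2⟩ := Finset.mem_filter.mp hv
      exfalso
      rw [Finset.mem_union, Finset.mem_image, Finset.mem_image] at hv1
      rcases hv1 with ⟨t, _, rfl⟩ | ⟨t, _, rfl⟩
      · exact hv2 (by rw [him, h0]; simp)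
      · exact hv2 (by rw [him, h0]; simp)
  refine (Finset.sum_le_sum hone).trans ?_
  rw [← Finset.sum_filter, ← Finset.mul_sum]
  have h1 : ∑ ρ' ∈ 𝒬.filter (fun ρ' => imMul σ ρ' ≠ 0), tau (imMul σ ρ').natAbs
      ≤ 12 * P₀ ^ 2 * K := by
    refine le_trans ?_ (sum_tau_imMul hK hK0 hσc hσP hX₀)
    refine (Finset.sum_le_sum fun u hu => tau_le_tau_pow (k := 4) ?_ (by norm_num)).trans
      (Finset.sum_le_sum_of_subset_of_nonneg (Finset.filter_subset_filter _ hP) fun u _ _ =>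
        pow_nonneg (tau_nonneg _) 4)
    simpa using (Finset.mem_filter.mp hu).2
  calc 2 * K * V * ∑ ρ' ∈ 𝒬.filter (fun ρ' => imMul σ ρ' ≠ 0), tau (imMul σ ρ').natAbs
      ≤ 2 * K * V * (12 * P₀ ^ 2 * K) := by gcongr
    _ = _ := by ring

lemma card_normPairs_le {𝒬 : Finset (ℤ × ℤ)} {P₀ : ℕ} (hP : 𝒬 ⊆ box P₀) (hP₀ : 1 ≤ P₀) :
    ((normPairs 𝒬).card : ℝ) ≤ 81 * P₀ ^ 4 := by
  have h1 : ((normPairs 𝒬).card : ℝ) ≤ (𝒬.card : ℝ) * 𝒬.card := by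
    rw [← Nat.cast_mul, ← Finset.card_product]
    exact Nat.cast_le.mpr (Finset.card_filter_le _ _)
  have h2 : (𝒬.card : ℝ) ≤ 9 * P₀ ^ 2 :=
    (Nat.cast_le.mpr (Finset.card_le_card hP)).trans (card_box_le hP₀)
  calc ((normPairs 𝒬).card : ℝ) ≤ (𝒬.card : ℝ) * 𝒬.card := h1
    _ ≤ (9 * P₀ ^ 2) * (9 * P₀ ^ 2) := by gcongr
    _ = _ := by ring

/-- The mean square of the Weyl bounds over pairs and short vectors, in terms of the number of
multiples of `γ` close to integers. -/
lemma sum_weylBound_sq_le {K : ℝ} {X : ℕ} (hK : TauBound K X) (hK1 : 1 ≤ K)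
    {𝒬 : Finset (ℤ × ℤ)} {P₀ : ℕ} (hP : 𝒬 ⊆ box P₀) (hP₀ : 1 ≤ P₀) (hX₀ : 4 * P₀ ^ 2 ≤ X)
    {V M : ℕ} (hV : 1 ≤ V) {ε : ℝ} (hε : 0 < ε) (γ : ℝ) {Y : ℝ}
    (hY : ∑ v ∈ (box V).filter (· ≠ 0), ∑ h ∈ Finset.Icc 1 (2 * P₀ ^ 2),
      (hitCount γ (1 / (M * ε)) M h (nrm v).natAbs : ℝ) ≤ Y) :
    ∑ p ∈ normPairs 𝒬, ∑ v ∈ (box V).filter (· ≠ 0),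
      weylBound M ε (γ * ((nrm p.1 - nrm p.2) * nrm v : ℤ)) ^ 2
    ≤ 729 * P₀ ^ 4 * V ^ 2 * (2 * M ^ 2 * ε + M) + 528 * M * P₀ ^ 2 * K * Y := by
  set η : ℝ := 1 / (M * ε) with hη
  set F : ℕ → ℝ := fun h => ∑ v ∈ (box V).filter (· ≠ 0),
    (hitCount γ η M h (nrm v).natAbs : ℝ) with hF
  have hF0 : ∀ h, 0 ≤ F h := fun h => Finset.sum_nonneg fun v _ => Nat.cast_nonneg _
  have h1 : ∀ p ∈ normPairs 𝒬, ∑ v ∈ (box V).filter (· ≠ 0),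
      weylBound M ε (γ * ((nrm p.1 - nrm p.2) * nrm v : ℤ)) ^ 2
      ≤ 9 * V ^ 2 * (2 * M ^ 2 * ε + M) + 2 * M * F (nrm p.1 - nrm p.2).natAbs := by
    intro p _
    calc ∑ v ∈ (box V).filter (· ≠ 0), weylBound M ε (γ * ((nrm p.1 - nrm p.2) * nrm v : ℤ)) ^ 2
        ≤ ∑ v ∈ (box V).filter (· ≠ 0), ((2 * M ^ 2 * ε + M) +
          2 * M * (hitCount γ η M (nrm p.1 - nrm p.2).natAbs (nrm v).natAbs : ℝ)) := by
          refine Finset.sum_le_sum fun v _ => (weylBound_sq_le M hε.le _).trans ?_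
          have h2 : (badCount M ε (γ * ((nrm p.1 - nrm p.2) * nrm v : ℤ)) : ℝ)
              ≤ 1 + 2 * (hitCount γ η M (nrm p.1 - nrm p.2).natAbs (nrm v).natAbs : ℝ) := by
            exact_mod_cast badCount_le M ε γ (nrm p.1 - nrm p.2) (nrm v)
          have h3 := mul_le_mul_of_nonneg_left h2 (Nat.cast_nonneg (α := ℝ) M)
          linarith
      _ = (((box V).filter (· ≠ 0)).card : ℝ) * (2 * M ^ 2 * ε + M)
          + 2 * M * F (nrm p.1 - nrm p.2).natAbs := by
          rw [Finset.sum_add_distrib, Finset.sum_const, nsmul_eq_mul, ← Finset.mul_sum]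
      _ ≤ _ := by
          have h4 : (((box V).filter (· ≠ 0)).card : ℝ) ≤ 9 * V ^ 2 :=
            (Nat.cast_le.mpr (Finset.card_filter_le _ _)).trans (card_box_le hV)
          gcongr
  -- A difference `h` of norms arises from few pairs.
  have hE : (energy 𝒬 nrm : ℝ) ≤ 132 * P₀ ^ 2 * K :=
    (Nat.cast_le.mpr (energy_mono hP nrm)).trans (energy_nrm_le hK hP₀ hX₀ hK1)
  have h2 : ∑ p ∈ normPairs 𝒬, F (nrm p.1 - nrm p.2).natAbs ≤ 264 * P₀ ^ 2 * K * Y := by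
    calc ∑ p ∈ normPairs 𝒬, F (nrm p.1 - nrm p.2).natAbs
        ≤ ∑ h ∈ Finset.Icc 1 (2 * P₀ ^ 2), (264 * P₀ ^ 2 * K) * F h := by
          refine sum_comp_le (normPairs 𝒬) _ (fun p => (nrm p.1 - nrm p.2).natAbs) ?_ F
            (fun h _ => hF0 h) _ ?_
          · intro p hp
            obtain ⟨hp1, hp2⟩ := Finset.mem_filter.mp hp
            obtain ⟨hp3, hp4⟩ := Finset.mem_product.mp hp1
            have hb : ∀ ρ ∈ 𝒬, 0 ≤ nrm ρ ∧ nrm ρ ≤ 2 * (P₀ : ℤ) ^ 2 := by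
              intro ρ hρ
              have h3 := hP hρ
              rw [mem_box] at h3
              have e1 : ρ.1 ^ 2 ≤ (P₀ : ℤ) ^ 2 := sq_le_sq.mpr (by simpa using h3.1)
              have e2 : ρ.2 ^ 2 ≤ (P₀ : ℤ) ^ 2 := sq_le_sq.mpr (by simpa using h3.2)
              unfold nrm
              constructor
              · positivity
              · linarith
            have b1 := hb _ hp3
            have b2 := hb _ hp4
            rw [Finset.mem_Icc]
            constructor
            · have : nrm p.1 - nrm p.2 ≠ 0 := sub_ne_zero.mpr hp2
              exact Int.natAbs_pos.mpr this
            · zify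
              rw [abs_le]
              constructor <;> linarith
          · intro j _
            have hsub : (normPairs 𝒬).filter (fun p => (nrm p.1 - nrm p.2).natAbs = j) ⊆
                (𝒬 ×ˢ 𝒬).filter (fun p => nrm p.1 - nrm p.2 = (j : ℤ)) ∪
                (𝒬 ×ˢ 𝒬).filter (fun p => nrm p.1 - nrm p.2 = -(j : ℤ)) := by
              intro p hp
              obtain ⟨hp1, hp2⟩ := Finset.mem_filter.mp hp
              have hp3 := (Finset.mem_filter.mp hp1).1
              have := Int.natAbs_eq (nrm p.1 - nrm p.2)
              rw [hp2] at this
              rw [Finset.mem_union, Finset.mem_filter, Finset.mem_filter]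
              tauto
            have h3 := (Finset.card_le_card hsub).trans (Finset.card_union_le _ _)
            have h4 := card_sub_eq_le_energy 𝒬 nrm j
            have h5 := card_sub_eq_le_energy 𝒬 nrm (-j)
            have h6 : (((normPairs 𝒬).filter (fun p => (nrm p.1 - nrm p.2).natAbs = j)).card : ℝ)
                ≤ ((𝒬 ×ˢ 𝒬).filter (fun p => nrm p.1 - nrm p.2 = (j : ℤ))).card +
                ((𝒬 ×ˢ 𝒬).filter (fun p => nrm p.1 - nrm p.2 = -(j : ℤ))).card := by
              exact_mod_cast h3
            linarith
      _ = 264 * P₀ ^ 2 * K * ∑ h ∈ Finset.Icc 1 (2 * P₀ ^ 2), F h := by rw [Finset.mul_sum]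
      _ ≤ 264 * P₀ ^ 2 * K * Y := by
          rw [Finset.sum_comm] at hY
          exact mul_le_mul_of_nonneg_left hY (by positivity)
  refine (Finset.sum_le_sum h1).trans ?_
  rw [Finset.sum_add_distrib, Finset.sum_const, nsmul_eq_mul, ← Finset.mul_sum]
  have h3 := card_normPairs_le hP hP₀
  have h4 : ((normPairs 𝒬).card : ℝ) * (9 * V ^ 2 * (2 * M ^ 2 * ε + M))
      ≤ 81 * P₀ ^ 4 * (9 * V ^ 2 * (2 * M ^ 2 * ε + M)) := by gcongr
  have h5 : 2 * (M : ℝ) * ∑ p ∈ normPairs 𝒬, F (nrm p.1 - nrm p.2).natAbs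
      ≤ 2 * M * (264 * P₀ ^ 2 * K * Y) := by gcongr
  linarith

/-- The total of all `pairTerm`s. The vectors on the lines `Im (ρ₁ v) = 0` and `Im (ρ₂ v) = 0` are
estimated trivially, on the others Cauchy's inequality separates divisor functions and Weyl
bounds. -/
lemma sum_pairTerm_le {K : ℝ} {X : ℕ} (hK : TauBound K X) (hK1 : 1 ≤ K)
    {𝒬 : Finset (ℤ × ℤ)} {P₀ : ℕ} (hP : 𝒬 ⊆ box P₀) (hcop : ∀ ρ ∈ 𝒬, IsCoprime ρ.1 ρ.2)
    (hP₀ : 1 ≤ P₀) (hX₀ : 4 * P₀ ^ 2 ≤ X) (G : ℕ)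
    {V M : ℕ} (hPV : P₀ ≤ V) (hXV : 2 * V ^ 2 ≤ X) {ε : ℝ} (γ : ℝ) {Y : ℝ}
    (hY : ∑ p ∈ normPairs 𝒬, ∑ v ∈ (box V).filter (· ≠ 0),
      weylBound M ε (γ * ((nrm p.1 - nrm p.2) * nrm v : ℤ)) ^ 2 ≤ Y) :
    ∑ p ∈ normPairs 𝒬, ∑ v ∈ box V, pairTerm G M ε γ p v
      ≤ 81 * P₀ ^ 4 * G ^ 2 * M + 432 * G * M * P₀ ^ 4 * K ^ 2 * V
        + Real.sqrt (972 * P₀ ^ 4 * V ^ 2 * K * Y) := by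
  have hK0 : 0 ≤ K := by linarith
  have hV : 1 ≤ V := hP₀.trans hPV
  have hVX : V ≤ X := by nlinarith
  set W : (ℤ × ℤ) × (ℤ × ℤ) → ℤ × ℤ → ℝ := fun p v =>
    weylBound M ε (γ * ((nrm p.1 - nrm p.2) * nrm v : ℤ)) with hW
  have hW0 : ∀ p v, 0 ≤ W p v := fun p v => weylBound_nonneg _ _ _
  have hWM : ∀ p v, W p v ≤ M := fun p v => weylBound_le _ _ _
  -- `T₀`, `T₁`, `T₂`, `T₃` majorize the terms according to which of `Im (ρ₁ v)` and
  -- `Im (ρ₂ v)` vanish.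
  set T₀ : (ℤ × ℤ) × (ℤ × ℤ) → ℤ × ℤ → ℝ := fun _ v => if v = 0 then (G : ℝ) ^ 2 * M else 0 with hT₀
  set T₁ : (ℤ × ℤ) × (ℤ × ℤ) → ℤ × ℤ → ℝ := fun p v =>
    if imMul p.1 v = 0 ∧ imMul p.2 v ≠ 0 then G * M * tau (imMul p.2 v).natAbs else 0 with hT₁
  set T₂ : (ℤ × ℤ) × (ℤ × ℤ) → ℤ × ℤ → ℝ := fun p v =>
    if imMul p.2 v = 0 ∧ imMul p.1 v ≠ 0 then G * M * tau (imMul p.1 v).natAbs else 0 with hT₂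
  set T₃ : (ℤ × ℤ) × (ℤ × ℤ) → ℤ × ℤ → ℝ := fun p v =>
    if imMul p.1 v ≠ 0 ∧ imMul p.2 v ≠ 0 then
      tau (imMul p.1 v).natAbs * tau (imMul p.2 v).natAbs * W p v else 0 with hT₃
  have hnn₀ : ∀ p v, 0 ≤ T₀ p v := fun p v => by simp only [hT₀]; split_ifs <;> positivity
  have hnn₁ : ∀ p v, 0 ≤ T₁ p v := fun p v => by
    simp only [hT₁]; split_ifs
    · exact mul_nonneg (by positivity) (tau_nonneg _)
    · exact le_rfl
  have hnn₂ : ∀ p v, 0 ≤ T₂ p v := fun p v => by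
    simp only [hT₂]; split_ifs
    · exact mul_nonneg (by positivity) (tau_nonneg _)
    · exact le_rfl
  have hnn₃ : ∀ p v, 0 ≤ T₃ p v := fun p v => by
    simp only [hT₃]; split_ifs
    · exact mul_nonneg (mul_nonneg (tau_nonneg _) (tau_nonneg _)) (hW0 _ _)
    · exact le_rfl
  have hpt : ∀ p ∈ normPairs 𝒬, ∀ v ∈ box V,
      pairTerm G M ε γ p v ≤ T₀ p v + T₁ p v + T₂ p v + T₃ p v := by
    intro p hp v _
    obtain ⟨hp1, hp2⟩ := Finset.mem_filter.mp hp
    obtain ⟨hp3, hp4⟩ := Finset.mem_product.mp hp1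
    have n0 := hnn₀ p v
    have n1 := hnn₁ p v
    have n2 := hnn₂ p v
    have n3 := hnn₃ p v
    change divCount G (imMul p.1 v) * divCount G (imMul p.2 v) * W p v ≤ _
    have d1 := divCount_le G (imMul p.1 v)
    have d2 := divCount_le G (imMul p.2 v)
    have d1' := divCount_nonneg G (imMul p.1 v)
    have d2' := divCount_nonneg G (imMul p.2 v)
    by_cases h1 : imMul p.1 v = 0 <;> by_cases h2 : imMul p.2 v = 0
    -- Two primitive vectors of different norms are not proportional, so only `v = 0` is left.
    · have hv0 : v = 0 := by
        by_contra hv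
        obtain ⟨t, ht⟩ := imMul_comm_vec (hcop _ hp3) h1
        obtain ⟨s, hs⟩ := imMul_comm_vec (hcop _ hp4) h2
        have ht0 : t ≠ 0 := by rintro rfl; exact hv (by rw [ht]; simp)
        rw [ht] at hs
        simp only [Prod.mk.injEq, neg_inj] at hs
        obtain ⟨a, b, hab⟩ := hcop _ hp3
        obtain ⟨a', b', hab'⟩ := hcop _ hp4
        have h3 : t ∣ s := ⟨a' * p.1.1 + b' * p.1.2, by
          linear_combination -s * hab' - a' * hs.1 - b' * hs.2⟩
        have h4 : s ∣ t := ⟨a * p.2.1 + b * p.2.2, by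
          linear_combination -t * hab + a * hs.1 + b * hs.2⟩
        have h5 : t ^ 2 = s ^ 2 := Int.natAbs_eq_iff_sq_eq.mp
          (Nat.dvd_antisymm (Int.natAbs_dvd_natAbs.mpr h3) (Int.natAbs_dvd_natAbs.mpr h4))
        apply hp2
        have h6 : t ^ 2 * nrm p.1 = t ^ 2 * nrm p.2 := by
          unfold nrm
          conv_rhs => rw [h5]
          linear_combination (t * p.1.1 + s * p.2.1) * hs.1 + (t * p.1.2 + s * p.2.2) * hs.2
        exact mul_left_cancel₀ (pow_ne_zero 2 ht0) h6
      have e0 : T₀ p v = (G : ℝ) ^ 2 * M := by simp only [hT₀]; rw [if_pos hv0]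
      have : divCount G (imMul p.1 v) * divCount G (imMul p.2 v) * W p v ≤ G * G * M := by
        gcongr
        · exact hW0 _ _
        · exact hWM _ _
      nlinarith
    · have e1 : T₁ p v = G * M * tau (imMul p.2 v).natAbs := by
        simp only [hT₁]; rw [if_pos ⟨h1, h2⟩]
      have : divCount G (imMul p.1 v) * divCount G (imMul p.2 v) * W p v
          ≤ G * tau (imMul p.2 v).natAbs * M := by
        have := divCount_le_tau G h2
        gcongr
        · exact hW0 _ _
        · exact mul_nonneg (by positivity) (tau_nonneg _)
        · exact hWM _ _
      linarith
    · have e1 : T₂ p v = G * M * tau (imMul p.1 v).natAbs := by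
        simp only [hT₂]; rw [if_pos ⟨h2, h1⟩]
      have : divCount G (imMul p.1 v) * divCount G (imMul p.2 v) * W p v
          ≤ tau (imMul p.1 v).natAbs * G * M := by
        have := divCount_le_tau G h1
        gcongr
        · exact hW0 _ _
        · exact mul_nonneg (tau_nonneg _) (by positivity)
        · exact tau_nonneg _
        · exact hWM _ _
      linarith
    · have e1 : T₃ p v = tau (imMul p.1 v).natAbs * tau (imMul p.2 v).natAbs * W p v := by
        simp only [hT₃]; rw [if_pos ⟨h1, h2⟩]
      have : divCount G (imMul p.1 v) * divCount G (imMul p.2 v) * W p v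
          ≤ tau (imMul p.1 v).natAbs * tau (imMul p.2 v).natAbs * W p v := by
        have a1 := divCount_le_tau G h1
        have a2 := divCount_le_tau G h2
        gcongr
        · exact hW0 _ _
        · exact tau_nonneg _
      linarith
  have hS₀ : ∑ p ∈ normPairs 𝒬, ∑ v ∈ box V, T₀ p v ≤ 81 * P₀ ^ 4 * G ^ 2 * M := by
    have h1 : ∀ p ∈ normPairs 𝒬, ∑ v ∈ box V, T₀ p v ≤ G ^ 2 * M := by
      intro p _
      simp only [hT₀]
      rw [Finset.sum_ite_eq']
      split_ifs
      · exact le_rfl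
      · positivity
    refine (Finset.sum_le_sum h1).trans ?_
    rw [Finset.sum_const, nsmul_eq_mul]
    have := card_normPairs_le hP hP₀
    calc ((normPairs 𝒬).card : ℝ) * (G ^ 2 * M) ≤ (81 * P₀ ^ 4) * (G ^ 2 * M) := by gcongr
      _ = _ := by ring
  have hcardP : (𝒬.card : ℝ) ≤ 9 * P₀ ^ 2 :=
    (Nat.cast_le.mpr (Finset.card_le_card hP)).trans (card_box_le hP₀)
  have hline : ∑ ρ ∈ 𝒬, ∑ ρ' ∈ 𝒬, ∑ v ∈ box V, T₁ (ρ, ρ') v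
      ≤ 216 * G * M * P₀ ^ 4 * K ^ 2 * V := by
    have h1 : ∀ ρ ∈ 𝒬, ∑ ρ' ∈ 𝒬, ∑ v ∈ box V, T₁ (ρ, ρ') v
        ≤ G * M * (24 * P₀ ^ 2 * V * K ^ 2) := by
      intro ρ hρ
      have h2 := sum_line_le hK hK0 hP hcop (by omega) hVX hρ
      calc ∑ ρ' ∈ 𝒬, ∑ v ∈ box V, T₁ (ρ, ρ') v
          = G * M * ∑ ρ' ∈ 𝒬, ∑ v ∈ (box V).filter (fun v => imMul ρ v = 0 ∧ imMul ρ' v ≠ 0),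
            tau (imMul ρ' v).natAbs := by
            rw [Finset.mul_sum]
            refine Finset.sum_congr rfl fun ρ' _ => ?_
            rw [Finset.mul_sum, Finset.sum_filter]
        _ ≤ _ := mul_le_mul_of_nonneg_left h2 (by positivity)
    refine (Finset.sum_le_sum h1).trans ?_
    rw [Finset.sum_const, nsmul_eq_mul]
    calc (𝒬.card : ℝ) * (G * M * (24 * P₀ ^ 2 * V * K ^ 2))
        ≤ (9 * P₀ ^ 2) * (G * M * (24 * P₀ ^ 2 * V * K ^ 2)) := by gcongr
      _ = _ := by ring
  have hS₁ : ∑ p ∈ normPairs 𝒬, ∑ v ∈ box V, T₁ p v ≤ 216 * G * M * P₀ ^ 4 * K ^ 2 * V := by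
    refine le_trans ?_ hline
    rw [← Finset.sum_product (s := 𝒬) (t := 𝒬) (f := fun p => ∑ v ∈ box V, T₁ p v)]
    exact Finset.sum_le_sum_of_subset_of_nonneg (Finset.filter_subset _ _) fun p _ _ =>
      Finset.sum_nonneg fun v _ => hnn₁ p v
  have hS₂ : ∑ p ∈ normPairs 𝒬, ∑ v ∈ box V, T₂ p v ≤ 216 * G * M * P₀ ^ 4 * K ^ 2 * V := by
    refine le_trans ?_ hline
    change _ ≤ ∑ ρ ∈ 𝒬, ∑ ρ' ∈ 𝒬, ∑ v ∈ box V, T₂ (ρ', ρ) v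
    rw [← Finset.sum_product_right (s := 𝒬) (t := 𝒬) (f := fun p => ∑ v ∈ box V, T₂ p v)]
    exact Finset.sum_le_sum_of_subset_of_nonneg (Finset.filter_subset _ _) fun p _ _ =>
      Finset.sum_nonneg fun v _ => hnn₂ p v
  have hS₃ : ∑ p ∈ normPairs 𝒬, ∑ v ∈ box V, T₃ p v
      ≤ Real.sqrt (972 * P₀ ^ 4 * V ^ 2 * K * Y) := by
    apply Real.le_sqrt_of_sq_le
    set S := (normPairs 𝒬 ×ˢ box V).filter (fun q => imMul q.1.1 q.2 ≠ 0 ∧ imMul q.1.2 q.2 ≠ 0)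
      with hS
    have e1 : ∑ p ∈ normPairs 𝒬, ∑ v ∈ box V, T₃ p v = ∑ q ∈ S,
        (tau (imMul q.1.1 q.2).natAbs * tau (imMul q.1.2 q.2).natAbs) * W q.1 q.2 := by
      rw [hS, Finset.sum_filter, Finset.sum_product]
    rw [e1]
    refine (Finset.sum_mul_sq_le_sq_mul_sq _ _ _).trans ?_
    have h1 : ∑ q ∈ S, W q.1 q.2 ^ 2 ≤ Y := by
      refine le_trans ?_ hY
      rw [← Finset.sum_product']
      refine Finset.sum_le_sum_of_subset_of_nonneg ?_ fun q _ _ => sq_nonneg _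
      intro q hq
      obtain ⟨hq1, hq2, _⟩ := Finset.mem_filter.mp hq
      rw [Finset.mem_product] at hq1 ⊢
      refine ⟨hq1.1, Finset.mem_filter.mpr ⟨hq1.2, ?_⟩⟩
      intro h0
      apply hq2
      rw [h0]
      simp [imMul]
    -- The two factors of Cauchy's inequality: the second is `Y`, the first a fourth moment.
    have hmom : ∀ ρ ∈ 𝒬, ∑ u ∈ (box V).filter (fun u => imMul ρ u ≠ 0),
        tau (imMul ρ u).natAbs ^ 4 ≤ 12 * V ^ 2 * K := by
      intro ρ hρ
      refine sum_tau_imMul hK hK0 (hcop ρ hρ) ?_ hXV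
      have := hP hρ
      rw [mem_box] at this ⊢
      have h3 : (P₀ : ℤ) ≤ V := by exact_mod_cast hPV
      exact ⟨this.1.trans h3, this.2.trans h3⟩
    have h2 : ∑ q ∈ S, (tau (imMul q.1.1 q.2).natAbs * tau (imMul q.1.2 q.2).natAbs) ^ 2
        ≤ 972 * P₀ ^ 4 * V ^ 2 * K := by
      set A : (ℤ × ℤ) → ℤ × ℤ → ℝ := fun ρ v =>
        if imMul ρ v ≠ 0 then tau (imMul ρ v).natAbs ^ 4 else 0 with hA
      have hA0 : ∀ ρ v, 0 ≤ A ρ v := fun ρ v => by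
        simp only [hA]; split_ifs
        · exact pow_nonneg (tau_nonneg _) 4
        · exact le_rfl
      have hAs : ∀ ρ ∈ 𝒬, ∑ v ∈ box V, A ρ v ≤ 12 * V ^ 2 * K := by
        intro ρ hρ
        have := hmom ρ hρ
        rwa [Finset.sum_filter] at this
      calc ∑ q ∈ S, (tau (imMul q.1.1 q.2).natAbs * tau (imMul q.1.2 q.2).natAbs) ^ 2
          ≤ ∑ q ∈ S, (A q.1.1 q.2 + A q.1.2 q.2) / 2 := by
            refine Finset.sum_le_sum fun q hq => ?_
            obtain ⟨_, hq2, hq3⟩ := Finset.mem_filter.mp hq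
            simp only [hA]
            rw [if_pos hq2, if_pos hq3]
            nlinarith [sq_nonneg (tau (imMul q.1.1 q.2).natAbs ^ 2
              - tau (imMul q.1.2 q.2).natAbs ^ 2)]
        _ ≤ ∑ q ∈ (𝒬 ×ˢ 𝒬) ×ˢ box V, (A q.1.1 q.2 + A q.1.2 q.2) / 2 := by
            refine Finset.sum_le_sum_of_subset_of_nonneg ?_ fun q _ _ => by
              have := hA0 q.1.1 q.2
              have := hA0 q.1.2 q.2
              positivity
            refine (Finset.filter_subset _ _).trans ?_
            exact Finset.product_subset_product (Finset.filter_subset _ _) subset_rfl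
        _ = ∑ p ∈ 𝒬 ×ˢ 𝒬, (∑ v ∈ box V, A p.1 v + ∑ v ∈ box V, A p.2 v) / 2 := by
            rw [Finset.sum_product]
            refine Finset.sum_congr rfl fun p _ => ?_
            rw [← Finset.sum_add_distrib, Finset.sum_div]
        _ ≤ ∑ p ∈ 𝒬 ×ˢ 𝒬, 12 * V ^ 2 * K := by
            refine Finset.sum_le_sum fun p hp => ?_
            obtain ⟨hp1, hp2⟩ := Finset.mem_product.mp hp
            linarith [hAs _ hp1, hAs _ hp2]
        _ = (𝒬.card : ℝ) * 𝒬.card * (12 * V ^ 2 * K) := by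
            rw [Finset.sum_const, nsmul_eq_mul, Finset.card_product]
            push_cast; ring
        _ ≤ (9 * P₀ ^ 2) * (9 * P₀ ^ 2) * (12 * V ^ 2 * K) := by gcongr
        _ = _ := by ring
    have h3 : 0 ≤ ∑ q ∈ S, W q.1 q.2 ^ 2 := Finset.sum_nonneg fun q _ => sq_nonneg _
    exact mul_le_mul h2 h1 h3 (by positivity)
  calc ∑ p ∈ normPairs 𝒬, ∑ v ∈ box V, pairTerm G M ε γ p v
      ≤ ∑ p ∈ normPairs 𝒬, ∑ v ∈ box V, (T₀ p v + T₁ p v + T₂ p v + T₃ p v) :=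
        Finset.sum_le_sum fun p hp => Finset.sum_le_sum fun v hv => hpt p hp v hv
    _ = ∑ p ∈ normPairs 𝒬, ∑ v ∈ box V, T₀ p v + ∑ p ∈ normPairs 𝒬, ∑ v ∈ box V, T₁ p v
        + ∑ p ∈ normPairs 𝒬, ∑ v ∈ box V, T₂ p v + ∑ p ∈ normPairs 𝒬, ∑ v ∈ box V, T₃ p v := by
        simp only [Finset.sum_add_distrib]
    _ ≤ _ := by linarith

/-! ### Factorization in the Gaussian integers -/

/-- The pair `u` as a Gaussian integer. -/
def toGauss (u : ℤ × ℤ) : GaussianInt := ⟨u.1, u.2⟩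

/-- The product of the Gaussian integers `ρ` and `u`, as a pair. -/
def mulPair (ρ u : ℤ × ℤ) : ℤ × ℤ := (ρ.1 * u.1 - ρ.2 * u.2, imMul ρ u)

lemma toGauss_mulPair (ρ u : ℤ × ℤ) : toGauss (mulPair ρ u) = toGauss ρ * toGauss u := by
  apply Zsqrtd.ext
  · simp [toGauss, mulPair, Zsqrtd.re_mul]; ring
  · simp [toGauss, mulPair, imMul, Zsqrtd.im_mul]

lemma toGauss_injective : Function.Injective toGauss := by
  intro u v h
  have h1 := congrArg Zsqrtd.re h
  have h2 := congrArg Zsqrtd.im h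
  exact Prod.ext h1 h2

lemma norm_toGauss (u : ℤ × ℤ) : Zsqrtd.norm (toGauss u) = nrm u := by
  simp [toGauss, Zsqrtd.norm, nrm]; ring

lemma nrm_mulPair (ρ u : ℤ × ℤ) : nrm (mulPair ρ u) = nrm ρ * nrm u := by
  simp only [nrm, mulPair, imMul]; ring

lemma exists_toGauss (w : GaussianInt) : ∃ u, toGauss u = w := ⟨(w.re, w.im), rfl⟩

lemma prime_toGauss {ρ : ℤ × ℤ} {d : ℕ} (hd : d.Prime) (hρ : nrm ρ = d) : Prime (toGauss ρ) := by
  rw [← irreducible_iff_prime]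
  have hnat : (Zsqrtd.norm (toGauss ρ)).natAbs = d := by rw [norm_toGauss, hρ]; simp
  refine ⟨fun h => ?_, fun a b hab => ?_⟩
  · rw [← Zsqrtd.norm_eq_one_iff, hnat] at h
    exact hd.one_lt.ne' h
  · have h1 : (Zsqrtd.norm a).natAbs * (Zsqrtd.norm b).natAbs = d := by
      rw [← Int.natAbs_mul, ← Zsqrtd.norm_mul, ← hab, hnat]
    rcases (Nat.dvd_prime hd).mp (Dvd.intro _ h1) with h2 | h2
    · left; exact Zsqrtd.norm_eq_one_iff.mp h2
    · right
      rw [h2] at h1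
      exact Zsqrtd.norm_eq_one_iff.mp (Nat.eq_of_mul_eq_mul_left hd.pos (by rw [h1, mul_one]))

lemma isCoprime_of_nrm_prime {ρ : ℤ × ℤ} {d : ℕ} (hd : d.Prime) (hρ : nrm ρ = d) :
    IsCoprime ρ.1 ρ.2 := by
  rw [Int.isCoprime_iff_gcd_eq_one]
  by_contra h
  obtain ⟨p, hp, hpg⟩ := Nat.exists_prime_and_dvd h
  have h1 : (p : ℤ) ∣ ρ.1 := (Int.natCast_dvd_natCast.mpr hpg).trans (Int.gcd_dvd_left _ _)
  have h2 : (p : ℤ) ∣ ρ.2 := (Int.natCast_dvd_natCast.mpr hpg).trans (Int.gcd_dvd_right _ _)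
  have h3 : ((p * p : ℕ) : ℤ) ∣ (d : ℕ) := by
    rw [← hρ, nrm, sq, sq]
    push_cast
    exact dvd_add (mul_dvd_mul h1 h1) (mul_dvd_mul h2 h2)
  have h4 : p * p ∣ d := Int.natCast_dvd_natCast.mp h3
  have h5 := (Nat.dvd_prime hd).mp ((Dvd.intro _ rfl).trans h4)
  rcases h5 with h5 | h5
  · exact hp.one_lt.ne' h5
  · rw [h5] at h4
    have := Nat.le_of_dvd hd.pos h4
    nlinarith [hd.one_lt]

/-- If the prime `d` divides a norm `d n` exactly, a divisor of norm `d` exists. -/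
lemma exists_factor {d n : ℕ} (hd : d.Prime) (hdn : Nat.Coprime d n) {z : ℤ × ℤ}
    (hz : nrm z = (d * n : ℕ)) : ∃ ρ u, nrm ρ = d ∧ nrm u = n ∧ mulPair ρ u = z := by
  have hd0 : (d : ℤ) ≠ 0 := by exact_mod_cast hd.ne_zero
  have hndvd : ¬ d ∣ n := hd.coprime_iff_not_dvd.mp hdn
  have hsuff : ∀ ρ, nrm ρ = d → toGauss ρ ∣ toGauss z →
      ∃ ρ u, nrm ρ = d ∧ nrm u = n ∧ mulPair ρ u = z := by
    rintro ρ hρ ⟨w, hw⟩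
    obtain ⟨u, rfl⟩ := exists_toGauss w
    have h1 : mulPair ρ u = z := toGauss_injective (by rw [toGauss_mulPair, hw])
    refine ⟨ρ, u, hρ, ?_, h1⟩
    have h2 := nrm_mulPair ρ u
    rw [h1, hz, hρ] at h2
    push_cast at h2
    exact (mul_left_cancel₀ hd0 h2).symm
  have hconj : toGauss z * toGauss (z.1, -z.2) = ((d : ℕ) : GaussianInt) * (n : GaussianInt) := by
    apply Zsqrtd.ext
    · simp only [toGauss, Zsqrtd.re_mul, Zsqrtd.re_natCast, Zsqrtd.im_natCast]
      unfold nrm at hz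
      push_cast at hz
      linear_combination hz
    · simp only [toGauss, Zsqrtd.im_mul, Zsqrtd.re_natCast, Zsqrtd.im_natCast]
      ring
  -- An inert `d` would divide `z`, and `d ^ 2` its norm.
  have hnp : ¬ Prime ((d : ℕ) : GaussianInt) := by
    intro hp
    have h1 : ((d : ℕ) : GaussianInt) ∣ toGauss z * toGauss (z.1, -z.2) := ⟨_, hconj⟩
    have h2 : (d : ℤ) ∣ z.1 ∧ (d : ℤ) ∣ z.2 := by
      rcases hp.dvd_or_dvd h1 with h | h
      · obtain ⟨w, hw⟩ := h
        have e1 := congrArg Zsqrtd.re hw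
        have e2 := congrArg Zsqrtd.im hw
        simp only [toGauss, Zsqrtd.re_mul, Zsqrtd.im_mul, Zsqrtd.re_natCast,
          Zsqrtd.im_natCast] at e1 e2
        exact ⟨⟨w.re, by linarith⟩, ⟨w.im, by linarith⟩⟩
      · obtain ⟨w, hw⟩ := h
        have e1 := congrArg Zsqrtd.re hw
        have e2 := congrArg Zsqrtd.im hw
        simp only [toGauss, Zsqrtd.re_mul, Zsqrtd.im_mul, Zsqrtd.re_natCast,
          Zsqrtd.im_natCast] at e1 e2
        exact ⟨⟨w.re, by linarith⟩, ⟨-w.im, by linarith⟩⟩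
    obtain ⟨⟨r, hr⟩, s, hs⟩ := h2
    apply hndvd
    have h3 : (d : ℤ) * (d * (r ^ 2 + s ^ 2)) = d * n := by
      unfold nrm at hz
      push_cast at hz
      rw [hr, hs] at hz
      linear_combination hz
    have h4 := mul_left_cancel₀ hd0 h3
    exact Int.natCast_dvd_natCast.mp ⟨_, h4.symm⟩
  have := Fact.mk hd
  rw [← irreducible_iff_prime] at hnp
  obtain ⟨a, b, hab⟩ := GaussianInt.sq_add_sq_of_nat_prime_of_not_irreducible d hnp
  have hπ : nrm ((a : ℤ), (b : ℤ)) = d := by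
    change (a : ℤ) ^ 2 + (b : ℤ) ^ 2 = d
    exact_mod_cast hab
  have hπ' : nrm ((a : ℤ), -(b : ℤ)) = d := by
    unfold nrm at hπ ⊢
    linarith [neg_sq (b : ℤ)]
  have hπd : toGauss ((a : ℤ), (b : ℤ)) ∣ toGauss z * toGauss (z.1, -z.2) := by
    rw [hconj]
    refine Dvd.dvd.mul_right ⟨toGauss ((a : ℤ), -(b : ℤ)), ?_⟩ _
    apply Zsqrtd.ext
    · simp only [toGauss, Zsqrtd.re_mul, Zsqrtd.re_natCast]
      unfold nrm at hπ
      linear_combination -hπ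
    · simp only [toGauss, Zsqrtd.im_mul, Zsqrtd.im_natCast]
      ring
  -- A prime of norm `d` divides `z` or its conjugate; in the latter case its conjugate divides `z`.
  rcases (prime_toGauss hd hπ).dvd_or_dvd hπd with h | h
  · exact hsuff _ hπ h
  · refine hsuff _ hπ' ?_
    obtain ⟨w, hw⟩ := h
    refine ⟨⟨w.re, -w.im⟩, ?_⟩
    have e1 := congrArg Zsqrtd.re hw
    have e2 := congrArg Zsqrtd.im hw
    simp only [toGauss, Zsqrtd.re_mul, Zsqrtd.im_mul] at e1 e2
    apply Zsqrtd.ext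
    · simp only [toGauss, Zsqrtd.re_mul]; linarith
    · simp only [toGauss, Zsqrtd.im_mul]; linarith

/-- The four units of the Gaussian integers. -/
def gaussUnits : Finset (ℤ × ℤ) := {(1, 0), (-1, 0), (0, 1), (0, -1)}

lemma mem_gaussUnits {u : ℤ × ℤ} : u ∈ gaussUnits ↔ nrm u = 1 := by
  constructor
  · intro h
    simp only [gaussUnits, Finset.mem_insert, Finset.mem_singleton] at h
    rcases h with rfl | rfl | rfl | rfl <;> rfl
  · intro h
    obtain ⟨a, b⟩ := u
    simp only [nrm] at h
    have ha : -1 ≤ a ∧ a ≤ 1 := by constructor <;> nlinarith [sq_nonneg b]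
    have hb : -1 ≤ b ∧ b ≤ 1 := by constructor <;> nlinarith [sq_nonneg a]
    obtain ⟨ha1, ha2⟩ := ha
    obtain ⟨hb1, hb2⟩ := hb
    simp only [gaussUnits, Finset.mem_insert, Finset.mem_singleton, Prod.mk.injEq]
    interval_cases a <;> interval_cases b <;> simp_all

/-- The points of norm `m`. -/
noncomputable def normSphere (m : ℕ) : Finset (ℤ × ℤ) := (box m).filter (fun u => nrm u = m)

lemma mem_normSphere {m : ℕ} {u : ℤ × ℤ} : u ∈ normSphere m ↔ nrm u = m := by
  unfold normSphere
  rw [Finset.mem_filter, mem_box]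
  refine ⟨fun h => h.2, fun h => ⟨?_, h⟩⟩
  unfold nrm at h
  have hself : ∀ r : ℤ, |r| ≤ r ^ 2 := by
    intro r
    rw [← sq_abs]
    rcases eq_or_ne r 0 with rfl | h0
    · simp
    · nlinarith [Int.one_le_abs h0]
  constructor
  · linarith [hself u.1, sq_nonneg u.2]
  · linarith [hself u.2, sq_nonneg u.1]

lemma mulPair_assoc (a b c : ℤ × ℤ) : mulPair (mulPair a b) c = mulPair a (mulPair b c) := by
  simp only [mulPair, imMul, Prod.mk.injEq]; constructor <;> ring

/-- If the prime `d` divides a norm `d n` exactly, there are exactly four factorizations into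
elements of norms `d` and `n`: one up to units. -/
lemma card_factorizations {d n : ℕ} (hd : d.Prime) (hdn : Nat.Coprime d n) {z : ℤ × ℤ}
    (hz : nrm z = (d * n : ℕ)) :
    ((normSphere d ×ˢ normSphere n).filter (fun p => mulPair p.1 p.2 = z)).card = 4 := by
  have hd0 : (d : ℤ) ≠ 0 := by exact_mod_cast hd.ne_zero
  obtain ⟨π, ν, hπ, hν, hπν⟩ := exists_factor hd hdn hz
  have hndvd : ¬ d ∣ n := hd.coprime_iff_not_dvd.mp hdn
  have hcancel : ∀ a b : ℤ × ℤ, mulPair π a = mulPair π b → a = b := by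
    intro a b h
    apply toGauss_injective
    have h1 := congrArg toGauss h
    rw [toGauss_mulPair, toGauss_mulPair] at h1
    exact mul_left_cancel₀ (prime_toGauss hd hπ).ne_zero h1
  have hcard : gaussUnits.card = 4 := by decide
  rw [← hcard]
  symm
  -- From one factorization `(π, ν)` the others are `(π ε, ε⁻¹ ν)`, where `ε⁻¹` is the
  -- conjugate of `ε`.
  refine Finset.card_bij (fun ε _ => (mulPair π ε, mulPair (ε.1, -ε.2) ν)) ?_ ?_ ?_
  · intro ε hε
    rw [mem_gaussUnits] at hε
    have hε' : nrm (ε.1, -ε.2) = 1 := by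
      rw [← hε]; simp [nrm]
    rw [Finset.mem_filter, Finset.mem_product, mem_normSphere, mem_normSphere, nrm_mulPair,
      nrm_mulPair, hε, hε', hπ, hν]
    refine ⟨⟨by simp, by simp⟩, ?_⟩
    change mulPair (mulPair π ε) (mulPair (ε.1, -ε.2) ν) = z
    rw [mulPair_assoc, ← mulPair_assoc ε]
    have : mulPair ε (ε.1, -ε.2) = (1, 0) := by
      unfold nrm at hε
      simp only [mulPair, imMul, Prod.mk.injEq]
      constructor <;> linarith
    rw [this, ← hπν]
    congr 1
    simp [mulPair, imMul]
  · intro ε _ ε' _ h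
    rw [Prod.mk.injEq] at h
    exact hcancel _ _ h.1
  · rintro ⟨ρ, u⟩ hp
    rw [Finset.mem_filter, Finset.mem_product, mem_normSphere, mem_normSphere] at hp
    obtain ⟨⟨hρ, hu⟩, hz'⟩ := hp
    simp only at hρ hu hz'
    -- The prime `π` divides `ρ`, or else `d` would divide the norm `n` of `u`.
    have hdvd : toGauss π ∣ toGauss ρ * toGauss u := by
      rw [← toGauss_mulPair, hz', ← hπν, toGauss_mulPair]
      exact Dvd.intro _ rfl
    rcases (prime_toGauss hd hπ).dvd_or_dvd hdvd with ⟨w, hw⟩ | ⟨w, hw⟩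
    · obtain ⟨ε, rfl⟩ := exists_toGauss w
      have h1 : mulPair π ε = ρ := toGauss_injective (by rw [toGauss_mulPair, hw])
      have h2 : nrm ε = 1 := by
        have := nrm_mulPair π ε
        rw [h1, hρ, hπ] at this
        exact mul_left_cancel₀ hd0 (by rw [← this, mul_one])
      refine ⟨ε, mem_gaussUnits.mpr h2, Prod.ext h1 ?_⟩
      change mulPair (ε.1, -ε.2) ν = u
      have h3 : mulPair ε u = ν := by
        apply hcancel
        rw [← mulPair_assoc, h1, hz', hπν]
      rw [← h3, ← mulPair_assoc]
      have : mulPair (ε.1, -ε.2) ε = (1, 0) := by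
        unfold nrm at h2
        simp only [mulPair, imMul, Prod.mk.injEq]
        constructor <;> linarith
      rw [this]
      simp [mulPair, imMul]
    · exfalso
      obtain ⟨t, rfl⟩ := exists_toGauss w
      have h1 : mulPair π t = u := toGauss_injective (by rw [toGauss_mulPair, hw])
      have h2 := nrm_mulPair π t
      rw [h1, hu, hπ] at h2
      exact hndvd (Int.natCast_dvd_natCast.mp ⟨_, h2⟩)

lemma sumTwoSquares_eq (ω : ℕ → ℝ) (w : ℤ → ℝ) (hw : ∀ l : ℕ, 1 ≤ l → w l = ω l)
    (hw0 : ∀ l : ℤ, l ≤ 0 → w l = 0) (m : ℕ) :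
    sumTwoSquares ω m = ∑ z ∈ normSphere m, w z.2 := by
  have h1 : ∑ z ∈ normSphere m, w z.2 = ∑ l ∈ Finset.Icc (1 : ℤ) m, ∑ k ∈ Finset.Icc (-(m : ℤ)) m,
      if k ^ 2 + l ^ 2 = m then w l else 0 := by
    unfold normSphere box
    rw [Finset.sum_filter, Finset.sum_product_right]
    symm
    refine Finset.sum_subset (fun l hl => ?_) (fun l hl hl' => ?_)
    · rw [Finset.mem_Icc] at hl ⊢
      constructor <;> linarith [hl.1, hl.2]
    · refine Finset.sum_eq_zero fun k _ => ?_
      have : l ≤ 0 := by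
        rw [Finset.mem_Icc] at hl hl'
        by_contra hc
        exact hl' ⟨by omega, hl.2⟩
      rw [hw0 l this, ite_self]
  rw [h1]
  unfold sumTwoSquares
  refine Finset.sum_bij (fun l _ => (l : ℤ)) ?_ ?_ ?_ ?_
  · intro l hl
    rw [Finset.mem_Icc] at hl ⊢
    exact ⟨by exact_mod_cast hl.1, by exact_mod_cast hl.2⟩
  · intro a _ b _ h
    exact_mod_cast h
  · intro l hl
    rw [Finset.mem_Icc] at hl
    refine ⟨l.toNat, ?_, by simp; omega⟩
    rw [Finset.mem_Icc]
    omega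
  · intro l hl
    rw [Finset.sum_filter]
    refine Finset.sum_congr rfl fun k _ => ?_
    rw [hw l (Finset.mem_Icc.mp hl).1]

/-- Representations of `d n` as a sum of two squares come from pairs of Gaussian integers of norms
`d` and `n`, each one from four of them. -/
lemma four_mul_sumTwoSquares (ω : ℕ → ℝ) (w : ℤ → ℝ) (hw : ∀ l : ℕ, 1 ≤ l → w l = ω l)
    (hw0 : ∀ l : ℤ, l ≤ 0 → w l = 0) {d n : ℕ} (hd : d.Prime) (hdn : Nat.Coprime d n) :
    4 * sumTwoSquares ω (d * n)
      = ∑ ρ ∈ normSphere d, ∑ u ∈ normSphere n, w (imMul ρ u) := by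
  rw [sumTwoSquares_eq ω w hw hw0, ← Finset.sum_product']
  have h := sum_comp_eq (normSphere d ×ˢ normSphere n) (normSphere (d * n))
    (fun p => mulPair p.1 p.2) (fun p hp => by
      rw [Finset.mem_product, mem_normSphere, mem_normSphere] at hp
      rw [mem_normSphere, nrm_mulPair, hp.1, hp.2]
      push_cast; rfl) (fun z => w z.2)
  have h' : ∑ p ∈ normSphere d ×ˢ normSphere n, w (imMul p.1 p.2)
      = ∑ p ∈ normSphere d ×ˢ normSphere n, w (mulPair p.1 p.2).2 := rfl
  rw [h', h, Finset.mul_sum]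
  refine Finset.sum_congr rfl fun z hz => ?_
  rw [mem_normSphere] at hz
  rw [card_factorizations hd hdn hz]
  norm_num

/-! ### Cauchy's inequality over the smooth variable -/

lemma nrm_nonneg (u : ℤ × ℤ) : 0 ≤ nrm u := by unfold nrm; positivity

lemma natAbs_nrm (u : ℤ × ℤ) : ((nrm u).natAbs : ℤ) = nrm u := Int.natAbs_of_nonneg (nrm_nonneg u)

/-- The Gaussian integers whose norm is a prime in `[D, 2 D)`. -/
noncomputable def gaussPrimes (D : ℕ) : Finset (ℤ × ℤ) :=
  (box (Nat.sqrt (2 * D))).filter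
    (fun ρ => (nrm ρ).natAbs ∈ Finset.Ico D (2 * D) ∧ (nrm ρ).natAbs.Prime)

/-- The bilinear sum over primes `D ≤ d < 2 D`, without a congruence condition. -/
noncomputable def bilinearSum (ω : ℕ → ℝ) (x : ℕ) (γ : ℝ) (α β : ℕ → ℂ) (D : ℕ) : ℂ :=
  ∑ d ∈ Finset.Ico D (2 * D), β d *
    ∑ n ∈ (Finset.Icc 1 x).filter (fun n => Nat.Coprime d n),
      α n * (if d * n ≤ x then e (γ * (d * n : ℕ)) * (sumTwoSquares ω (d * n) : ℂ) else 0)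

/-- The coefficient attached to `ρ` of norm `d` and `u` of norm `n`: `β_d e(γ d n) w(Im (ρ u))` if
`d n ≤ x`, and `0` otherwise. -/
noncomputable def pairCoeff (w : ℤ → ℝ) (x : ℕ) (γ : ℝ) (β : ℕ → ℂ) (ρ u : ℤ × ℤ) : ℂ :=
  if nrm ρ * nrm u ≤ x then β (nrm ρ).natAbs * (e (γ * (nrm ρ * nrm u : ℤ)) * (w (imMul ρ u) : ℂ))
  else 0

lemma mem_box_sqrt {m n : ℕ} {u : ℤ × ℤ} (h : nrm u ≤ n) (hm : n ≤ m) : u ∈ box (Nat.sqrt m) := by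
  have h1 : ∀ r : ℤ, r ^ 2 ≤ n → |r| ≤ Nat.sqrt m := by
    intro r hr
    have : r.natAbs ≤ Nat.sqrt m := by
      rw [Nat.le_sqrt']
      zify
      rw [sq_abs]
      have : (n : ℤ) ≤ m := by exact_mod_cast hm
      linarith
    zify at this
    exact this
  unfold nrm at h
  rw [mem_box]
  exact ⟨h1 _ (by linarith [sq_nonneg u.2]), h1 _ (by linarith [sq_nonneg u.1])⟩

lemma isCoprime_of_mem_gaussPrimes {D : ℕ} {ρ : ℤ × ℤ} (h : ρ ∈ gaussPrimes D) :
    IsCoprime ρ.1 ρ.2 :=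
  isCoprime_of_nrm_prime (Finset.mem_filter.mp h).2.2 (natAbs_nrm ρ).symm

/-- The bilinear sum over integers as a bilinear sum over pairs of Gaussian integers. -/
lemma four_mul_bilinearSum (ω : ℕ → ℝ) (w : ℤ → ℝ) (hw : ∀ l : ℕ, 1 ≤ l → w l = ω l)
    (hw0 : ∀ l : ℤ, l ≤ 0 → w l = 0) (x : ℕ) (γ : ℝ) (α β : ℕ → ℂ)
    (hβ : ∀ d, ¬ d.Prime → β d = 0) {D : ℕ} (hD : 2 ≤ D) :
    4 * bilinearSum ω x γ α β D = ∑ u ∈ box (Nat.sqrt (x / D)), α (nrm u).natAbs *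
      ∑ ρ ∈ (gaussPrimes D).filter (fun ρ => Nat.Coprime (nrm ρ).natAbs (nrm u).natAbs),
        pairCoeff w x γ β ρ u := by
  set R := Nat.sqrt (x / D) with hR
  set T : ℤ × ℤ → ℤ × ℤ → ℂ := fun ρ u =>
    if Nat.Coprime (nrm ρ).natAbs (nrm u).natAbs then α (nrm u).natAbs * pairCoeff w x γ β ρ u
    else 0 with hT
  have hT0 : ∀ ρ, T ρ 0 = 0 := by
    intro ρ
    simp only [hT, pairCoeff]
    have : imMul ρ 0 = 0 := by simp [imMul]
    rw [this, hw0 0 le_rfl]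
    simp
  have hrhs : ∑ u ∈ box R, α (nrm u).natAbs *
      ∑ ρ ∈ (gaussPrimes D).filter (fun ρ => Nat.Coprime (nrm ρ).natAbs (nrm u).natAbs),
        pairCoeff w x γ β ρ u = ∑ ρ ∈ gaussPrimes D, ∑ u ∈ (box R).filter (· ≠ 0), T ρ u := by
    rw [Finset.sum_comm]
    rw [Finset.sum_filter_of_ne (fun u _ h => by
      rintro rfl
      exact h (Finset.sum_eq_zero fun ρ _ => hT0 ρ))]
    refine Finset.sum_congr rfl fun u _ => ?_
    rw [Finset.mul_sum, Finset.sum_filter]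
  rw [hrhs]
  rw [← Finset.sum_fiberwise_of_maps_to (s := gaussPrimes D) (t := Finset.Ico D (2 * D))
    (g := fun ρ => (nrm ρ).natAbs) (fun ρ hρ => (Finset.mem_filter.mp hρ).2.1)]
  unfold bilinearSum
  rw [Finset.mul_sum]
  refine Finset.sum_congr rfl fun d hd => ?_
  by_cases hdp : d.Prime
  swap
  · rw [hβ d hdp, zero_mul, mul_zero]
    symm
    refine Finset.sum_eq_zero fun ρ hρ => ?_
    exfalso
    obtain ⟨hρ1, hρ2⟩ := Finset.mem_filter.mp hρ
    exact hdp (hρ2 ▸ (Finset.mem_filter.mp hρ1).2.2)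
  have hd' := Finset.mem_Ico.mp hd
  have hsph : (gaussPrimes D).filter (fun ρ => (nrm ρ).natAbs = d) = normSphere d := by
    ext ρ
    rw [mem_normSphere, Finset.mem_filter]
    unfold gaussPrimes
    rw [Finset.mem_filter]
    constructor
    · rintro ⟨_, h2⟩
      rw [← h2, natAbs_nrm]
    · intro h
      have h2 : (nrm ρ).natAbs = d := by rw [h]; simp
      refine ⟨⟨mem_box_sqrt h.le (by omega), ?_, ?_⟩, h2⟩
      · rw [h2]; exact hd
      · rw [h2]; exact hdp
  rw [hsph]
  have hcount : ∀ ρ ∈ normSphere d, ∑ u ∈ (box R).filter (· ≠ 0), T ρ u =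
      ∑ n ∈ Finset.Icc 1 x, if Nat.Coprime d n then
        (if d * n ≤ x then ∑ u ∈ normSphere n,
          α n * (β d * (e (γ * (d * n : ℕ)) * (w (imMul ρ u) : ℂ))) else 0) else 0 := by
    intro ρ hρ
    rw [mem_normSphere] at hρ
    have hρn : (nrm ρ).natAbs = d := by rw [hρ]; simp
    rw [← Finset.sum_fiberwise_of_maps_to (s := (box R).filter (· ≠ 0)) (t := Finset.Icc 1 x)
      (g := fun u => (nrm u).natAbs)]
    · refine Finset.sum_congr rfl fun n hn => ?_
      split_ifs with h1 h2
      · have hset : ((box R).filter (· ≠ 0)).filter (fun u => (nrm u).natAbs = n)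
            = normSphere n := by
          ext u
          rw [mem_normSphere, Finset.mem_filter, Finset.mem_filter]
          constructor
          · rintro ⟨_, h⟩
            rw [← h, natAbs_nrm]
          · intro h
            refine ⟨⟨mem_box_sqrt h.le ?_, ?_⟩, by rw [h]; simp⟩
            · rw [Nat.le_div_iff_mul_le (by omega)]
              nlinarith [hd'.1]
            · rintro rfl
              have : nrm 0 = 0 := rfl
              rw [this] at h
              have := (Finset.mem_Icc.mp hn).1
              omega
        rw [hset]
        refine Finset.sum_congr rfl fun u hu => ?_
        rw [mem_normSphere] at hu
        have hun : (nrm u).natAbs = n := by rw [hu]; simp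
        simp only [hT, pairCoeff]
        rw [hρn, hun, if_pos h1, hρ, hu, if_pos (by exact_mod_cast h2)]
        push_cast
        rfl
      · refine Finset.sum_eq_zero fun u hu => ?_
        have hun := (Finset.mem_filter.mp hu).2
        simp only [hT, pairCoeff]
        rw [if_neg (c := nrm ρ * nrm u ≤ x), mul_zero, ite_self]
        rw [hρ, ← natAbs_nrm, hun]
        exact_mod_cast h2
      · refine Finset.sum_eq_zero fun u hu => ?_
        have hun := (Finset.mem_filter.mp hu).2
        simp only [hT]
        rw [hρn, hun, if_neg h1]
    · intro u hu
      obtain ⟨hu1, hu2⟩ := Finset.mem_filter.mp hu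
      rw [mem_box] at hu1
      have e1 : u.1 ^ 2 ≤ (R : ℤ) ^ 2 := sq_le_sq.mpr (by simpa using hu1.1)
      have e2 : u.2 ^ 2 ≤ (R : ℤ) ^ 2 := sq_le_sq.mpr (by simpa using hu1.2)
      have e3 : R ^ 2 ≤ x / D := Nat.sqrt_le' _
      have e4 : x / D * 2 ≤ x := by
        calc x / D * 2 ≤ x / D * D := Nat.mul_le_mul_left _ hD
          _ ≤ x := Nat.div_mul_le_self _ _
      have e5 : 0 < nrm u := by
        unfold nrm
        by_contra h
        have h4 : u.1 = 0 := by nlinarith [sq_nonneg u.1, sq_nonneg u.2]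
        have h5 : u.2 = 0 := by nlinarith [sq_nonneg u.1, sq_nonneg u.2]
        exact hu2 (Prod.ext h4 h5)
      have e6 : nrm u ≤ x := by
        have : ((R ^ 2 * 2 : ℕ) : ℤ) ≤ x := by exact_mod_cast (by omega : R ^ 2 * 2 ≤ x)
        push_cast at this
        unfold nrm
        linarith
      rw [Finset.mem_Icc]
      constructor
      · omega
      · zify
        rw [abs_of_pos e5]
        exact e6
  rw [Finset.sum_congr rfl hcount, Finset.sum_comm, mul_left_comm, Finset.mul_sum,
    Finset.sum_filter, Finset.mul_sum]
  refine Finset.sum_congr rfl fun n hn => ?_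
  split_ifs with h1 h2
  · have h3 := four_mul_sumTwoSquares ω w hw hw0 hdp h1
    have h4 : (4 : ℂ) * (sumTwoSquares ω (d * n) : ℂ)
        = ∑ ρ ∈ normSphere d, ∑ u ∈ normSphere n, (w (imMul ρ u) : ℂ) := by
      have := congrArg (fun t : ℝ => (t : ℂ)) h3
      push_cast at this
      exact this
    calc β d * (4 * (α n * (e (γ * (d * n : ℕ)) * (sumTwoSquares ω (d * n) : ℂ))))
        = α n * (β d * e (γ * (d * n : ℕ))) * (4 * (sumTwoSquares ω (d * n) : ℂ)) := by ring
      _ = _ := by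
        rw [h4, Finset.mul_sum]
        refine Finset.sum_congr rfl fun ρ _ => ?_
        rw [Finset.mul_sum]
        refine Finset.sum_congr rfl fun u _ => by ring
  · simp
  · simp

lemma norm_pairCoeff_le {w : ℤ → ℝ} {x : ℕ} {γ : ℝ} {β : ℕ → ℂ} (hβ : ∀ d, ‖β d‖ ≤ 1)
    (ρ u : ℤ × ℤ) : ‖pairCoeff w x γ β ρ u‖ ≤ |w (imMul ρ u)| := by
  unfold pairCoeff
  split_ifs
  · rw [norm_mul, norm_mul, norm_e, one_mul, Complex.norm_real, Real.norm_eq_abs]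
    exact mul_le_of_le_one_left (abs_nonneg _) (hβ _)
  · rw [norm_zero]; exact abs_nonneg _

lemma pairCoeff_mul_conj (w : ℤ → ℝ) (x : ℕ) (γ : ℝ) (β : ℕ → ℂ) (ρ₁ ρ₂ u : ℤ × ℤ) :
    pairCoeff w x γ β ρ₁ u * (starRingEnd ℂ) (pairCoeff w x γ β ρ₂ u)
    = (β (nrm ρ₁).natAbs * (starRingEnd ℂ) (β (nrm ρ₂).natAbs)) *
      if nrm ρ₁ * nrm u ≤ x ∧ nrm ρ₂ * nrm u ≤ x then
        (w (imMul ρ₁ u) * w (imMul ρ₂ u) : ℂ) * e (γ * ((nrm ρ₁ - nrm ρ₂) * nrm u : ℤ)) else 0 := by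
  unfold pairCoeff
  by_cases h1 : nrm ρ₁ * nrm u ≤ x <;> by_cases h2 : nrm ρ₂ * nrm u ≤ x
  · rw [if_pos h1, if_pos h2, if_pos ⟨h1, h2⟩, map_mul, map_mul, star_e, Complex.conj_ofReal]
    have : e (γ * ((nrm ρ₁ - nrm ρ₂) * nrm u : ℤ))
        = e (γ * (nrm ρ₁ * nrm u : ℤ)) * e (-(γ * (nrm ρ₂ * nrm u : ℤ))) := by
      rw [← e_add]; congr 1; push_cast; ring
    rw [this]
    ring
  · rw [if_neg h2, if_neg (fun h : _ ∧ _ => h2 h.2), map_zero, mul_zero, mul_zero]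
  · rw [if_neg h1, if_neg (fun h : _ ∧ _ => h1 h.1), zero_mul, mul_zero]
  · rw [if_neg h1, if_neg (fun h : _ ∧ _ => h1 h.1), zero_mul, mul_zero]

/-- The pairs of elements of `𝒬` with the same norm. -/
noncomputable def diagPairs (𝒬 : Finset (ℤ × ℤ)) : Finset ((ℤ × ℤ) × (ℤ × ℤ)) :=
  (𝒬 ×ˢ 𝒬).filter (fun p => nrm p.1 = nrm p.2)

/-- The diagonal contribution, which has few pairs, by the divisor moment. -/
lemma sum_diagPairs_le {K : ℝ} {X : ℕ} (hK : TauBound K X) (hK1 : 1 ≤ K) {lam : ℕ → ℝ} {Lam : ℝ}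
    (hlam : ∀ f, |lam f| ≤ Lam) (G : ℕ)
    {𝒬 : Finset (ℤ × ℤ)} {P₀ : ℕ} (hP : 𝒬 ⊆ box P₀) (hcop : ∀ ρ ∈ 𝒬, IsCoprime ρ.1 ρ.2)
    (hP₀ : 1 ≤ P₀) (hX₀ : 4 * P₀ ^ 2 ≤ X) {R : ℕ} (hPR : P₀ ≤ R) (hXR : 2 * R ^ 2 ≤ X) :
    ∑ p ∈ diagPairs 𝒬, ∑ u ∈ box R, |divWeight lam G (imMul p.1 u)| *
      |divWeight lam G (imMul p.2 u)| ≤ 1584 * P₀ ^ 2 * R ^ 2 * K ^ 2 * Lam ^ 2 := by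
  have hLam : 0 ≤ Lam := (abs_nonneg _).trans (hlam 0)
  have hK0 : 0 ≤ K := by linarith
  have hmom : ∀ ρ ∈ 𝒬, ∑ u ∈ box R, |divWeight lam G (imMul ρ u)| ^ 2
      ≤ Lam ^ 2 * (12 * R ^ 2 * K) := by
    intro ρ hρ
    have hbox : ρ ∈ box R := by
      have := hP hρ
      rw [mem_box] at this ⊢
      have h3 : (P₀ : ℤ) ≤ R := by exact_mod_cast hPR
      exact ⟨this.1.trans h3, this.2.trans h3⟩
    refine le_trans ?_ (mul_le_mul_of_nonneg_left
      (sum_tau_imMul hK hK0 (hcop ρ hρ) hbox hXR) (sq_nonneg Lam))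
    rw [Finset.mul_sum, Finset.sum_filter]
    refine Finset.sum_le_sum fun u _ => ?_
    split_ifs with h
    · have h1 := abs_divWeight_le hLam hlam G (imMul ρ u)
      have h2 : 1 ≤ tau (imMul ρ u).natAbs := one_le_tau (by simpa using h)
      calc |divWeight lam G (imMul ρ u)| ^ 2 ≤ (Lam * tau (imMul ρ u).natAbs) ^ 2 :=
            pow_le_pow_left₀ (abs_nonneg _) h1 2
        _ = Lam ^ 2 * tau (imMul ρ u).natAbs ^ 2 := by ring
        _ ≤ Lam ^ 2 * tau (imMul ρ u).natAbs ^ 4 := by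
            exact mul_le_mul_of_nonneg_left (pow_le_pow_right₀ h2 (by norm_num)) (sq_nonneg Lam)
    · push Not at h
      rw [h]
      simp [divWeight]
  have hcard : ((diagPairs 𝒬).card : ℝ) ≤ 132 * P₀ ^ 2 * K :=
    (Nat.cast_le.mpr (energy_mono hP nrm)).trans (energy_nrm_le hK hP₀ hX₀ hK1)
  calc ∑ p ∈ diagPairs 𝒬, ∑ u ∈ box R, |divWeight lam G (imMul p.1 u)| *
      |divWeight lam G (imMul p.2 u)|
      ≤ ∑ p ∈ diagPairs 𝒬, Lam ^ 2 * (12 * R ^ 2 * K) := by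
        refine Finset.sum_le_sum fun p hp => ?_
        obtain ⟨hp1, hp2⟩ := Finset.mem_product.mp (Finset.mem_filter.mp hp).1
        have h1 := hmom _ hp1
        have h2 := hmom _ hp2
        calc ∑ u ∈ box R, |divWeight lam G (imMul p.1 u)| * |divWeight lam G (imMul p.2 u)|
            ≤ ∑ u ∈ box R, (|divWeight lam G (imMul p.1 u)| ^ 2
              + |divWeight lam G (imMul p.2 u)| ^ 2) / 2 :=
              Finset.sum_le_sum fun u _ => by
                nlinarith [sq_nonneg (|divWeight lam G (imMul p.1 u)|
                  - |divWeight lam G (imMul p.2 u)|)]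
          _ = (∑ u ∈ box R, |divWeight lam G (imMul p.1 u)| ^ 2
              + ∑ u ∈ box R, |divWeight lam G (imMul p.2 u)| ^ 2) / 2 := by
              rw [← Finset.sum_div, Finset.sum_add_distrib]
          _ ≤ _ := by linarith
    _ = ((diagPairs 𝒬).card : ℝ) * (Lam ^ 2 * (12 * R ^ 2 * K)) := by
        rw [Finset.sum_const, nsmul_eq_mul]
    _ ≤ (132 * P₀ ^ 2 * K) * (Lam ^ 2 * (12 * R ^ 2 * K)) := by gcongr
    _ = _ := by ring

/-- The terms with `d ∣ n`: as `n` has few prime divisors, Cauchy's inequality over the norms `d`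
bounds them by the diagonal. -/
lemma sum_sq_notCoprime_le (w : ℤ → ℝ) {x : ℕ} {γ : ℝ} {β : ℕ → ℂ} (hβ : ∀ d, ‖β d‖ ≤ 1)
    {A : ℝ} (hA : ∀ n ≤ x, (n.primeFactors.card : ℝ) ≤ A) (D : ℕ) {R : ℕ}
    (hR : 2 * R ^ 2 ≤ x) (hw0 : w 0 = 0) :
    ∑ u ∈ box R, ‖∑ ρ ∈ (gaussPrimes D).filter
      (fun ρ => ¬ Nat.Coprime (nrm ρ).natAbs (nrm u).natAbs), pairCoeff w x γ β ρ u‖ ^ 2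
    ≤ A * ∑ p ∈ diagPairs (gaussPrimes D), ∑ u ∈ box R, |w (imMul p.1 u)| * |w (imMul p.2 u)| := by
  rw [Finset.sum_comm, Finset.mul_sum]
  refine Finset.sum_le_sum fun u hu => ?_
  have hA0 : 0 ≤ A := (Nat.cast_nonneg _).trans (hA 0 (Nat.zero_le _))
  set n := (nrm u).natAbs with hn
  by_cases hn0 : n = 0
  · have hu0 : u = 0 := by
      have : nrm u = 0 := by simpa [hn] using hn0
      unfold nrm at this
      exact Prod.ext (by simp only [Prod.fst_zero]; nlinarith [sq_nonneg u.1, sq_nonneg u.2])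
        (by simp only [Prod.snd_zero]; nlinarith [sq_nonneg u.1, sq_nonneg u.2])
    have h1 : ∀ ρ, pairCoeff w x γ β ρ u = 0 := by
      intro ρ
      have : imMul ρ u = 0 := by rw [hu0]; simp [imMul]
      unfold pairCoeff
      rw [this, hw0]; simp
    rw [Finset.sum_eq_zero fun ρ _ => h1 ρ, norm_zero]
    have : 0 ≤ A * ∑ p ∈ diagPairs (gaussPrimes D), |w (imMul p.1 u)| * |w (imMul p.2 u)| := by
      positivity
    simpa using this
  have hnx : n ≤ x := by
    rw [mem_box] at hu
    have e1 : u.1 ^ 2 ≤ (R : ℤ) ^ 2 := sq_le_sq.mpr (by simpa using hu.1)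
    have e2 : u.2 ^ 2 ≤ (R : ℤ) ^ 2 := sq_le_sq.mpr (by simpa using hu.2)
    have e3 : 2 * (R : ℤ) ^ 2 ≤ x := by exact_mod_cast hR
    zify
    rw [hn, natAbs_nrm]
    unfold nrm
    linarith
  set S := (gaussPrimes D).filter (fun ρ => ¬ Nat.Coprime (nrm ρ).natAbs n) with hS
  have hmaps : ∀ ρ ∈ S, (nrm ρ).natAbs ∈ n.primeFactors := by
    intro ρ hρ
    obtain ⟨h1, h2⟩ := Finset.mem_filter.mp hρ
    have hp := (Finset.mem_filter.mp h1).2.2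
    rw [Nat.mem_primeFactors]
    exact ⟨hp, by_contra fun h => h2 (hp.coprime_iff_not_dvd.mpr h), hn0⟩
  have h1 : ‖∑ ρ ∈ S, pairCoeff w x γ β ρ u‖
      ≤ ∑ d ∈ n.primeFactors, ∑ ρ ∈ S.filter (fun ρ => (nrm ρ).natAbs = d), |w (imMul ρ u)| := by
    rw [← Finset.sum_fiberwise_of_maps_to hmaps (fun ρ => pairCoeff w x γ β ρ u)]
    refine (norm_sum_le _ _).trans (Finset.sum_le_sum fun d _ => ?_)
    exact (norm_sum_le _ _).trans (Finset.sum_le_sum fun ρ _ => norm_pairCoeff_le hβ ρ u)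
  calc ‖∑ ρ ∈ S, pairCoeff w x γ β ρ u‖ ^ 2
      ≤ (∑ d ∈ n.primeFactors, ∑ ρ ∈ S.filter (fun ρ => (nrm ρ).natAbs = d),
          |w (imMul ρ u)|) ^ 2 := pow_le_pow_left₀ (norm_nonneg _) h1 2
    _ ≤ n.primeFactors.card * ∑ d ∈ n.primeFactors,
          (∑ ρ ∈ S.filter (fun ρ => (nrm ρ).natAbs = d), |w (imMul ρ u)|) ^ 2 :=
        sq_sum_le_card_mul_sum_sq
    _ ≤ A * ∑ p ∈ diagPairs (gaussPrimes D), |w (imMul p.1 u)| * |w (imMul p.2 u)| := by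
        refine mul_le_mul (hA n hnx) ?_ (Finset.sum_nonneg fun d _ => sq_nonneg _) hA0
        have h2 : ∀ d ∈ n.primeFactors,
            (∑ ρ ∈ S.filter (fun ρ => (nrm ρ).natAbs = d), |w (imMul ρ u)|) ^ 2
            = ∑ p ∈ (diagPairs S).filter (fun p => (nrm p.1).natAbs = d),
              |w (imMul p.1 u)| * |w (imMul p.2 u)| := by
          intro d _
          rw [sq, Finset.sum_mul_sum, ← Finset.sum_product']
          refine Finset.sum_congr ?_ fun _ _ => rfl
          ext p
          unfold diagPairs
          simp only [Finset.mem_product, Finset.mem_filter]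
          have e1 := natAbs_nrm p.1
          have e2 := natAbs_nrm p.2
          constructor
          · rintro ⟨⟨a1, a2⟩, b1, b2⟩
            exact ⟨⟨⟨a1, b1⟩, by omega⟩, a2⟩
          · rintro ⟨⟨⟨a1, b1⟩, c⟩, a2⟩
            exact ⟨⟨a1, a2⟩, b1, by omega⟩
        have h3 : ∀ p ∈ diagPairs S, (nrm p.1).natAbs ∈ n.primeFactors := fun p hp =>
          hmaps p.1 (Finset.mem_product.mp (Finset.mem_filter.mp hp).1).1
        rw [Finset.sum_congr rfl h2, Finset.sum_fiberwise_of_maps_to h3]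
        refine Finset.sum_le_sum_of_subset_of_nonneg ?_ fun p _ _ => by positivity
        refine Finset.filter_subset_filter _ (Finset.product_subset_product ?_ ?_) <;>
          exact Finset.filter_subset _ _

lemma sum_norm_sq_eq {ι κ : Type*} (s : Finset ι) (t : Finset κ) (c : κ → ι → ℂ) :
    ((∑ u ∈ s, ‖∑ ρ ∈ t, c ρ u‖ ^ 2 : ℝ) : ℂ)
      = ∑ p ∈ t ×ˢ t, ∑ u ∈ s, c p.1 u * (starRingEnd ℂ) (c p.2 u) := by
  rw [Finset.sum_comm]
  push_cast
  refine Finset.sum_congr rfl fun u _ => ?_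
  rw [← Complex.mul_conj', map_sum, Finset.sum_mul_sum, ← Finset.sum_product']

/-- The bilinear sum after Cauchy's inequality: a diagonal part and the `pairTerm`s. -/
lemma sq_bilinearSum_le {K : ℝ} {X : ℕ} (hK : TauBound K X) (hK1 : 1 ≤ K) {lam : ℕ → ℝ} {Lam : ℝ}
    (hlam : ∀ f, |lam f| ≤ Lam) (G : ℕ) {ω : ℕ → ℝ}
    (hω : ∀ l : ℕ, 1 ≤ l → ω l = divWeight lam G l) {x D : ℕ} (hD : 2 ≤ D)
    (hDx : 2 * D ≤ x / D) (hXD : 8 * D ≤ X) (hXx : x ≤ X) (γ : ℝ) {α β : ℕ → ℂ}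
    {A : ℝ} (hA1 : 1 ≤ A) (hA : ∀ n ≤ x, (n.primeFactors.card : ℝ) ≤ A)
    (hα : ∀ n, ‖α n‖ ≤ (n.primeFactors.card : ℝ)) (hβ : ∀ d, ‖β d‖ ≤ 1)
    (hβp : ∀ d, ¬ d.Prime → β d = 0) {M V : ℕ} (hV : 1 ≤ V) (hM : 1 ≤ M)
    (hMV : M * V ≤ Nat.sqrt (x / D)) (hR : Nat.sqrt (x / D) < 2 * M * V) {ε : ℝ} (hε : 0 < ε)
    {T : ℝ} (hT : ∑ p ∈ normPairs (gaussPrimes D), ∑ v ∈ box V, pairTerm G M ε γ p v ≤ T) :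
    ‖bilinearSum ω x γ α β D‖ ^ 2 ≤ (Nat.sqrt (x / D)) ^ 2 * A ^ 2 *
      (12672 * A * D * (Nat.sqrt (x / D)) ^ 2 * K ^ 2 * Lam ^ 2 + 128 * Lam ^ 2 * M * T) := by
  set R := Nat.sqrt (x / D) with hRdef
  set w := divWeight lam G with hw
  set 𝒬 := gaussPrimes D with hQ
  set P₀ := Nat.sqrt (2 * D) with hP₀def
  have hw0 : ∀ l : ℤ, l ≤ 0 → w l = 0 := fun l hl => by
    simp only [hw, divWeight]; rw [if_neg (not_lt.mpr hl)]
  have hP₀ : 1 ≤ P₀ := by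
    rw [hP₀def, Nat.le_sqrt']; omega
  have hPR : P₀ ≤ R := Nat.sqrt_le_sqrt hDx
  have hP₀sq : P₀ ^ 2 ≤ 2 * D := Nat.sqrt_le' _
  have hRx : 2 * R ^ 2 ≤ x := by
    have e3 : R ^ 2 ≤ x / D := Nat.sqrt_le' _
    have e4 : x / D * 2 ≤ x := by
      calc x / D * 2 ≤ x / D * D := Nat.mul_le_mul_left _ hD
        _ ≤ x := Nat.div_mul_le_self _ _
    omega
  have hLam : 0 ≤ Lam := (abs_nonneg _).trans (hlam 0)
  have hQP : 𝒬 ⊆ box P₀ := Finset.filter_subset _ _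
  -- `I` drops the coprimality condition, `J` collects the terms violating it.
  set I : ℤ × ℤ → ℂ := fun u => ∑ ρ ∈ 𝒬, pairCoeff w x γ β ρ u with hI
  set J : ℤ × ℤ → ℂ := fun u => ∑ ρ ∈ 𝒬.filter
    (fun ρ => ¬ Nat.Coprime (nrm ρ).natAbs (nrm u).natAbs), pairCoeff w x γ β ρ u with hJ
  have hsplit : ∀ u, ∑ ρ ∈ 𝒬.filter (fun ρ => Nat.Coprime (nrm ρ).natAbs (nrm u).natAbs),
      pairCoeff w x γ β ρ u = I u - J u := by
    intro u
    simp only [hI, hJ]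
    rw [eq_sub_iff_add_eq, Finset.sum_filter_add_sum_filter_not]
  have h4 := four_mul_bilinearSum ω w (fun l hl => (hω l hl).symm) hw0 x γ α β hβp hD
  rw [Finset.sum_congr rfl fun u _ => by rw [hsplit u]] at h4
  set Dg := ∑ p ∈ diagPairs 𝒬, ∑ u ∈ box R, |w (imMul p.1 u)| * |w (imMul p.2 u)| with hDg
  have hDg0 : 0 ≤ Dg := Finset.sum_nonneg fun p _ => Finset.sum_nonneg fun u _ => by positivity
  have hDgle : Dg ≤ 3168 * D * R ^ 2 * K ^ 2 * Lam ^ 2 := by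
    have h5 := sum_diagPairs_le hK hK1 hlam G hQP (fun ρ hρ => isCoprime_of_mem_gaussPrimes hρ)
      hP₀ (by omega) hPR (by omega)
    refine h5.trans ?_
    have h6 : (P₀ : ℝ) ^ 2 ≤ 2 * D := by exact_mod_cast hP₀sq
    calc 1584 * (P₀ : ℝ) ^ 2 * R ^ 2 * K ^ 2 * Lam ^ 2
        ≤ 1584 * (2 * D) * R ^ 2 * K ^ 2 * Lam ^ 2 := by gcongr
      _ = _ := by ring
  have hJsum : ∑ u ∈ box R, ‖J u‖ ^ 2 ≤ A * Dg :=
    sum_sq_notCoprime_le w hβ hA D hRx (hw0 0 le_rfl)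
  -- Expand the square: pairs of equal norms form the diagonal.
  have hIsum : ∑ u ∈ box R, ‖I u‖ ^ 2 ≤ Dg + 64 * Lam ^ 2 * M * T := by
    have h5 := sum_norm_sq_eq (box R) 𝒬 (fun ρ u => pairCoeff w x γ β ρ u)
    have h6 : ∑ u ∈ box R, ‖I u‖ ^ 2 = ‖((∑ u ∈ box R, ‖I u‖ ^ 2 : ℝ) : ℂ)‖ := by
      rw [Complex.norm_real, Real.norm_eq_abs, abs_of_nonneg]
      exact Finset.sum_nonneg fun u _ => sq_nonneg _
    rw [h6, h5, ← Finset.sum_filter_add_sum_filter_not (𝒬 ×ˢ 𝒬) (fun p => nrm p.1 = nrm p.2)]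
    refine (norm_add_le _ _).trans (add_le_add ?_ ?_)
    · refine (norm_sum_le _ _).trans (Finset.sum_le_sum fun p _ => ?_)
      refine (norm_sum_le _ _).trans (Finset.sum_le_sum fun u _ => ?_)
      rw [norm_mul, RCLike.norm_conj]
      exact mul_le_mul (norm_pairCoeff_le hβ _ _) (norm_pairCoeff_le hβ _ _) (norm_nonneg _)
        (abs_nonneg _)
    · calc ‖∑ p ∈ (𝒬 ×ˢ 𝒬).filter (fun p => ¬ nrm p.1 = nrm p.2), ∑ u ∈ box R,
            pairCoeff w x γ β p.1 u * (starRingEnd ℂ) (pairCoeff w x γ β p.2 u)‖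
          ≤ ∑ p ∈ normPairs 𝒬, Lam ^ 2 * (64 * M * ∑ v ∈ box V, pairTerm G M ε γ p v) := by
            refine (norm_sum_le _ _).trans (Finset.sum_le_sum fun p _ => ?_)
            simp only [pairCoeff_mul_conj]
            rw [← Finset.mul_sum, norm_mul]
            refine (mul_le_of_le_one_left (norm_nonneg _) ?_).trans
              (norm_correlation_le hlam G x hV hM hMV hR hε γ p.1 p.2)
            rw [norm_mul, RCLike.norm_conj]
            exact mul_le_one₀ (hβ _) (norm_nonneg _) (hβ _)
        _ = 64 * Lam ^ 2 * M * ∑ p ∈ normPairs 𝒬, ∑ v ∈ box V, pairTerm G M ε γ p v := by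
            rw [Finset.mul_sum]
            exact Finset.sum_congr rfl fun p _ => by ring
        _ ≤ _ := mul_le_mul_of_nonneg_left hT (by positivity)
  have hdiff : ∑ u ∈ box R, ‖I u - J u‖ ^ 2 ≤ 4 * A * Dg + 128 * Lam ^ 2 * M * T := by
    calc ∑ u ∈ box R, ‖I u - J u‖ ^ 2 ≤ ∑ u ∈ box R, (2 * ‖I u‖ ^ 2 + 2 * ‖J u‖ ^ 2) := by
          refine Finset.sum_le_sum fun u _ => ?_
          have h5 := norm_sub_le (I u) (J u)
          have h6 := norm_nonneg (I u - J u)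
          nlinarith [sq_nonneg (‖I u‖ - ‖J u‖)]
      _ = 2 * ∑ u ∈ box R, ‖I u‖ ^ 2 + 2 * ∑ u ∈ box R, ‖J u‖ ^ 2 := by
          rw [Finset.sum_add_distrib, Finset.mul_sum, Finset.mul_sum]
      _ ≤ _ := by nlinarith
  have hαsum : ∑ u ∈ box R, ‖α (nrm u).natAbs‖ ^ 2 ≤ 9 * R ^ 2 * A ^ 2 := by
    calc ∑ u ∈ box R, ‖α (nrm u).natAbs‖ ^ 2 ≤ ∑ u ∈ box R, A ^ 2 := by
          refine Finset.sum_le_sum fun u hu => ?_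
          refine pow_le_pow_left₀ (norm_nonneg _) ((hα _).trans (hA _ ?_)) 2
          rw [mem_box] at hu
          have e1 : u.1 ^ 2 ≤ (R : ℤ) ^ 2 := sq_le_sq.mpr (by simpa using hu.1)
          have e2 : u.2 ^ 2 ≤ (R : ℤ) ^ 2 := sq_le_sq.mpr (by simpa using hu.2)
          have e3 : 2 * (R : ℤ) ^ 2 ≤ x := by exact_mod_cast hRx
          zify
          rw [abs_of_nonneg (nrm_nonneg u)]
          unfold nrm
          linarith
      _ = ((box R).card : ℝ) * A ^ 2 := by rw [Finset.sum_const, nsmul_eq_mul]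
      _ ≤ _ := mul_le_mul_of_nonneg_right (card_box_le (hP₀.trans hPR)) (sq_nonneg A)
  -- Cauchy's inequality over `u`, which removes the coefficients `α`.
  have hcs : (4 * ‖bilinearSum ω x γ α β D‖) ^ 2
      ≤ (9 * R ^ 2 * A ^ 2) * (4 * A * Dg + 128 * Lam ^ 2 * M * T) := by
    have h5 : 4 * ‖bilinearSum ω x γ α β D‖
        ≤ ∑ u ∈ box R, ‖α (nrm u).natAbs‖ * ‖I u - J u‖ := by
      have : 4 * ‖bilinearSum ω x γ α β D‖ = ‖4 * bilinearSum ω x γ α β D‖ := by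
        rw [norm_mul]; norm_num
      rw [this, h4]
      refine (norm_sum_le _ _).trans (le_of_eq (Finset.sum_congr rfl fun u _ => norm_mul _ _))
    refine (pow_le_pow_left₀ (by positivity) h5 2).trans ?_
    refine (Finset.sum_mul_sq_le_sq_mul_sq _ _ _).trans ?_
    exact mul_le_mul hαsum hdiff (Finset.sum_nonneg fun u _ => sq_nonneg _) (by positivity)
  have hpos : 0 ≤ 4 * A * Dg + 128 * Lam ^ 2 * M * T :=
    (Finset.sum_nonneg fun u _ => sq_nonneg _).trans hdiff
  have hB : 4 * A * Dg ≤ 12672 * A * D * R ^ 2 * K ^ 2 * Lam ^ 2 := by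
    have := mul_le_mul_of_nonneg_left hDgle (show 0 ≤ 4 * A by linarith)
    linarith
  have hR2 : 0 ≤ (R : ℝ) ^ 2 * A ^ 2 := by positivity
  have hfin := mul_le_mul_of_nonneg_left
    (show 4 * A * Dg + 128 * Lam ^ 2 * M * T
      ≤ 12672 * A * D * R ^ 2 * K ^ 2 * Lam ^ 2 + 128 * Lam ^ 2 * M * T by linarith) hR2
  have hh := mul_nonneg hR2 hpos
  nlinarith

/-! ### The sieve weights as divisor sums of bounded level -/

lemma le_of_dvd_primeProd {z z₀ : ℝ} {p : ℕ} (hp : p.Prime) (h : p ∣ primeProd z z₀) :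
    (p : ℝ) ≤ z ∧ z₀ < p := by
  unfold primeProd at h
  rw [hp.prime.dvd_finsetProd_iff] at h
  obtain ⟨q, hq, hpq⟩ := h
  obtain ⟨hq1, hq2, hq3⟩ := Finset.mem_filter.mp hq
  have hpq' : p = q := (Nat.prime_dvd_prime_iff_eq hp hq2).mp hpq
  rw [Finset.mem_Icc] at hq1
  rw [hpq']
  exact ⟨(Nat.le_floor_iff' hq2.ne_zero).mp hq1.2, hq3⟩

lemma primeProd_ne_zero (z z₀ : ℝ) : primeProd z z₀ ≠ 0 := by
  unfold primeProd
  rw [Finset.prod_ne_zero_iff]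
  intro p hp
  exact (Finset.mem_filter.mp hp).2.1.ne_zero

lemma coprime_of_dvd_primeProd {z y z₀ : ℝ} {a b : ℕ} (ha : a ∣ primeProd y z₀)
    (hb : b ∣ primeProd z y) : Nat.Coprime a b := by
  refine Nat.coprime_of_dvd fun p hp hpa hpb => ?_
  have h1 := le_of_dvd_primeProd hp (hpa.trans ha)
  have h2 := le_of_dvd_primeProd hp (hpb.trans hb)
  linarith [h1.1, h2.2]

/-- Elements of the support of a beta-sieve are at most its level. If the parity condition fails
at the last prime, it holds at the one before it, which exceeds the last prime. -/
lemma le_of_betaSupport {Q : ℕ → Prop} (hQ : ∀ n, ¬ Q (n + 1) → Q n) {D : ℝ} (hD : 1 ≤ D)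
    {β d : ℕ} (hβ : 1 ≤ β) (h : BetaSupport Q D β d) (hp : ∀ p ∈ d.primeFactors, (p : ℝ) ≤ D) :
    (d : ℝ) ≤ D := by
  obtain ⟨hsq, hcond⟩ := h
  have hprod : (∏ q ∈ d.primeFactors, (q : ℝ)) = d := by
    rw [← Nat.cast_prod, Nat.prod_primeFactors_of_squarefree hsq]
  set s := d.primeFactors with hs
  have hs1 : ∀ q ∈ s, (1 : ℝ) ≤ q := fun q hq => by
    exact_mod_cast (Nat.prime_of_mem_primeFactors hq).one_lt.le
  rcases s.eq_empty_or_nonempty with he | hne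
  · rw [he, Finset.prod_empty] at hprod
    rw [← hprod]; exact hD
  set p := s.min' hne with hpdef
  have hpmem : p ∈ s := s.min'_mem hne
  by_cases hQc : Q s.card
  · have hfil : s.filter (fun q => p ≤ q) = s :=
      Finset.filter_true_of_mem fun q hq => s.min'_le q hq
    have h1 := hcond p hpmem (by rw [hfil]; exact hQc)
    rw [hfil, hprod] at h1
    have h2 : (1 : ℝ) ≤ (p : ℝ) ^ β := one_le_pow₀ (hs1 p hpmem)
    nlinarith [Nat.cast_nonneg (α := ℝ) d]
  · have hcard : (s.erase p).card + 1 = s.card := Finset.card_erase_add_one hpmem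
    rw [← hcard] at hQc
    have hQ' := hQ _ hQc
    rcases (s.erase p).eq_empty_or_nonempty with he | hne'
    · have h3 : (∏ q ∈ s, (q : ℝ)) = p := by
        rw [← Finset.mul_prod_erase s _ hpmem, he, Finset.prod_empty, mul_one]
      rw [← hprod, h3]
      exact hp p hpmem
    · set p' := (s.erase p).min' hne' with hp'def
      have hp'mem : p' ∈ s.erase p := (s.erase p).min'_mem hne'
      have hp's : p' ∈ s := Finset.mem_of_mem_erase hp'mem
      have hlt : p < p' := lt_of_le_of_ne (s.min'_le p' hp's) (Finset.ne_of_mem_erase hp'mem).symm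
      have hfil : s.filter (fun q => p' ≤ q) = s.erase p := by
        ext q
        rw [Finset.mem_filter]
        constructor
        · rintro ⟨h1, h2⟩
          exact Finset.mem_erase.mpr ⟨by omega, h1⟩
        · intro h1
          exact ⟨Finset.mem_of_mem_erase h1, (s.erase p).min'_le q h1⟩
      have h1 := hcond p' hp's (by rw [hfil]; exact hQ')
      rw [hfil] at h1
      have h3 : (p : ℝ) ≤ (p' : ℝ) ^ β := by
        have h4 : (p : ℝ) ≤ p' := by exact_mod_cast hlt.le
        exact h4.trans (le_self_pow₀ (hs1 p' hp's) (by omega))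
      rw [← hprod, ← Finset.mul_prod_erase s _ hpmem]
      have h5 : 0 ≤ ∏ q ∈ s.erase p, (q : ℝ) := Finset.prod_nonneg fun q _ => Nat.cast_nonneg q
      nlinarith

lemma abs_betaWeight_le (Q : ℕ → Prop) (D : ℝ) (β d : ℕ) : |betaWeight Q D β d| ≤ 1 := by
  unfold betaWeight
  split_ifs
  · rw [← Int.cast_abs]
    exact_mod_cast ArithmeticFunction.abs_moebius_le_one
  · simp

/-- The factorizations of `f` into a part from the primes `p ≤ z₀` and a part from the primes
`z₀ < p ≤ z`; there is at most one. -/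
noncomputable def sievePairs (z z₀ : ℝ) (f : ℕ) : Finset (ℕ × ℕ) :=
  f.divisorsAntidiagonal.filter (fun p => p.1 ∣ primeProd z₀ 0 ∧ p.2 ∣ primeProd z z₀)

/-- The coefficient of `f` when the composed sieve is multiplied out to a single divisor sum. -/
noncomputable def thetaCoeff (Q : ℕ → Prop) (D D₀ z z₀ : ℝ) (f : ℕ) : ℝ :=
  ∑ p ∈ sievePairs z z₀ f, betaWeight Q D₀ 10 p.1 * betaWeight Q D 2 p.2

lemma card_sievePairs_le (z z₀ : ℝ) (f : ℕ) : (sievePairs z z₀ f).card ≤ 1 := by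
  rw [Finset.card_le_one]
  intro p hp q hq
  obtain ⟨hp1, hp2, hp3⟩ := Finset.mem_filter.mp hp
  obtain ⟨hq1, hq2, hq3⟩ := Finset.mem_filter.mp hq
  rw [Nat.mem_divisorsAntidiagonal] at hp1 hq1
  have h : p.1 * p.2 = q.1 * q.2 := hp1.1.trans hq1.1.symm
  have h1 : p.1 ∣ q.1 := (coprime_of_dvd_primeProd hp2 hq3).dvd_of_dvd_mul_right
    ⟨p.2, h.symm⟩
  have h2 : q.1 ∣ p.1 := (coprime_of_dvd_primeProd hq2 hp3).dvd_of_dvd_mul_right ⟨q.2, h⟩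
  have h3 : p.1 = q.1 := Nat.dvd_antisymm h1 h2
  have h0 : 0 < p.1 := Nat.pos_of_ne_zero fun h0 => hp1.2 (by rw [← hp1.1, h0, zero_mul])
  refine Prod.ext h3 ?_
  rw [← h3] at h
  exact Nat.eq_of_mul_eq_mul_left h0 h

lemma abs_thetaCoeff_le (Q : ℕ → Prop) (D D₀ z z₀ : ℝ) (f : ℕ) :
    |thetaCoeff Q D D₀ z z₀ f| ≤ 1 := by
  unfold thetaCoeff
  calc _ ≤ ∑ p ∈ sievePairs z z₀ f, |betaWeight Q D₀ 10 p.1 * betaWeight Q D 2 p.2| :=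
        Finset.abs_sum_le_sum_abs _ _
    _ ≤ ∑ p ∈ sievePairs z z₀ f, (1 : ℝ) := Finset.sum_le_sum fun p _ => by
        rw [abs_mul]
        exact mul_le_one₀ (abs_betaWeight_le _ _ _ _) (abs_nonneg _) (abs_betaWeight_le _ _ _ _)
    _ = ((sievePairs z z₀ f).card : ℝ) := by simp
    _ ≤ 1 := by exact_mod_cast card_sievePairs_le z z₀ f

/-- The composed sieve has level `D D₀`. -/
lemma thetaCoeff_eq_zero {Q : ℕ → Prop} (hQ : ∀ n, ¬ Q (n + 1) → Q n) {D D₀ z z₀ : ℝ}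
    (hD : 1 ≤ D) (hD₀ : 1 ≤ D₀) (hz : z ≤ D) (hz₀ : z₀ ≤ D₀) {f : ℕ} (hf : D * D₀ < f) :
    thetaCoeff Q D D₀ z z₀ f = 0 := by
  unfold thetaCoeff
  refine Finset.sum_eq_zero fun p hp => ?_
  obtain ⟨hp1, hp2, hp3⟩ := Finset.mem_filter.mp hp
  rw [Nat.mem_divisorsAntidiagonal] at hp1
  by_contra h
  have h1 : BetaSupport Q D₀ 10 p.1 := by
    by_contra h1
    exact h (by unfold betaWeight; rw [if_neg h1, zero_mul])
  have h2 : BetaSupport Q D 2 p.2 := by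
    by_contra h2
    exact h (by unfold betaWeight; rw [if_neg h2, mul_zero])
  have h3 : (p.1 : ℝ) ≤ D₀ := le_of_betaSupport hQ hD₀ (by norm_num) h1 fun q hq =>
    (le_of_dvd_primeProd (Nat.prime_of_mem_primeFactors hq)
      ((Nat.dvd_of_mem_primeFactors hq).trans hp2)).1.trans hz₀
  have h4 : (p.2 : ℝ) ≤ D := le_of_betaSupport hQ hD (by norm_num) h2 fun q hq =>
    (le_of_dvd_primeProd (Nat.prime_of_mem_primeFactors hq)
      ((Nat.dvd_of_mem_primeFactors hq).trans hp3)).1.trans hz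
  rw [← hp1.1] at hf
  push_cast at hf
  have : (p.1 : ℝ) * p.2 ≤ D₀ * D := by gcongr
  linarith

/-- The composed sieve as a single divisor sum: products of divisors from the two disjoint sifting
ranges are again divisors. -/
lemma theta_eq_sum (Q : ℕ → Prop) (D D₀ z z₀ : ℝ) {n : ℕ} (hn : n ≠ 0) :
    theta Q n D D₀ z z₀ = ∑ f ∈ n.divisors, thetaCoeff Q D D₀ z z₀ f := by
  unfold theta betaSieve
  rw [Finset.sum_mul_sum, ← Finset.sum_product']
  set S := n.divisors.filter (fun d => d ∣ primeProd z₀ 0) ×ˢ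
    n.divisors.filter (fun d => d ∣ primeProd z z₀) with hS
  have hmaps : ∀ p ∈ S, p.1 * p.2 ∈ n.divisors := by
    intro p hp
    simp only [hS, Finset.mem_product, Finset.mem_filter, Nat.mem_divisors] at hp
    obtain ⟨⟨⟨a1, _⟩, a2⟩, ⟨b1, _⟩, b2⟩ := hp
    rw [Nat.mem_divisors]
    exact ⟨(coprime_of_dvd_primeProd a2 b2).mul_dvd_of_dvd_of_dvd a1 b1, hn⟩
  rw [← Finset.sum_fiberwise_of_maps_to hmaps]
  refine Finset.sum_congr rfl fun f hf => ?_
  rw [Nat.mem_divisors] at hf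
  unfold thetaCoeff
  refine Finset.sum_congr ?_ fun _ _ => rfl
  ext p
  simp only [hS, sievePairs, Finset.mem_filter, Finset.mem_product, Nat.mem_divisors,
    Nat.mem_divisorsAntidiagonal]
  constructor
  · rintro ⟨⟨⟨_, a2⟩, _, b2⟩, h⟩
    exact ⟨⟨h, ne_zero_of_dvd_ne_zero hn hf.1⟩, a2, b2⟩
  · rintro ⟨⟨h, _⟩, a2, b2⟩
    exact ⟨⟨⟨⟨(Dvd.intro _ h).trans hf.1, hn⟩, a2⟩, ⟨(Dvd.intro_left _ h).trans hf.1, hn⟩, b2⟩, h⟩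

lemma card_primeFactors_le_log {n : ℕ} (hn : n ≠ 0) :
    (n.primeFactors.card : ℝ) ≤ 2 * Real.log n := by
  have h1 : 2 ^ n.primeFactors.card ≤ n := by
    calc 2 ^ n.primeFactors.card = ∏ _p ∈ n.primeFactors, 2 := by simp
      _ ≤ ∏ p ∈ n.primeFactors, p :=
        Finset.prod_le_prod' fun p hp => (Nat.prime_of_mem_primeFactors hp).two_le
      _ ≤ n := Nat.le_of_dvd (Nat.pos_of_ne_zero hn) (Nat.prod_primeFactors_dvd n)
  have h2 : (2 : ℝ) ^ n.primeFactors.card ≤ n := by exact_mod_cast h1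
  have h3 := Real.log_le_log (by positivity) h2
  rw [Real.log_pow] at h3
  have h4 := Real.log_two_gt_d9
  nlinarith [Nat.cast_nonneg (α := ℝ) n.primeFactors.card]

lemma sum_divisors_eq_divWeight {lam : ℕ → ℝ} {G : ℕ} (h : ∀ f, G < f → lam f = 0) {l : ℕ}
    (hl : 1 ≤ l) : ∑ f ∈ l.divisors, lam f = divWeight lam G l := by
  unfold divWeight
  rw [if_pos (by exact_mod_cast hl)]
  simp only [Int.natCast_dvd_natCast]
  rw [← Finset.sum_filter, ← Finset.sum_filter_of_ne (s := l.divisors) (p := fun f => f ≤ G)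
    (fun f _ hf => by by_contra hc; exact hf (h f (by omega)))]
  refine Finset.sum_congr ?_ fun _ _ => rfl
  ext f
  simp only [Finset.mem_filter, Nat.mem_divisors, Finset.mem_Icc]
  constructor
  · rintro ⟨⟨h1, h2⟩, h3⟩
    exact ⟨⟨Nat.pos_of_dvd_of_pos h1 hl, h3⟩, h1⟩
  · rintro ⟨⟨_, h3⟩, h1⟩
    exact ⟨⟨h1, by omega⟩, h3⟩

lemma odd_parity (n : ℕ) (h : ¬ Odd (n + 1)) : Odd n := by
  rw [Nat.not_odd_iff_even] at h
  by_contra hc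
  rw [Nat.not_odd_iff_even] at hc
  exact absurd hc.add_one (Nat.not_odd_iff_even.mpr h)

lemma even_parity (n : ℕ) (h : ¬ Even (n + 1)) : Even n := by
  by_contra hc
  exact h (Nat.not_even_iff_odd.mp hc).add_one

lemma one_le_paramD0 (x : ℕ) : 1 ≤ paramD0 x := by
  unfold paramD0
  rw [Real.one_le_exp_iff]
  exact Real.rpow_nonneg (Real.log_natCast_nonneg x) _

lemma paramZ0_le {x : ℕ} (hL : 1 ≤ Real.log x) : paramZ0 x ≤ paramD0 x := by
  unfold paramZ0 paramD0
  exact Real.exp_le_exp.mpr (Real.rpow_le_rpow_of_exponent_le hL (by norm_num))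

lemma log_sqrt_eq (x : ℕ) : Real.log (Real.sqrt x) = Real.log x / 2 :=
  Real.log_sqrt (Nat.cast_nonneg x)

/-- `ω₁` is a divisor sum of level `D₁ D₀`. -/
lemma omega1_eq_divWeight {x : ℕ} (hx : 1 ≤ x) (hL : 1 ≤ Real.log x) :
    ∃ lam : ℕ → ℝ, (∀ f, |lam f| ≤ 2 * Real.log x ^ 2) ∧
      ∀ l : ℕ, 1 ≤ l → omega1 x l = divWeight lam ⌊paramD1 x * paramD0 x⌋₊ l := by
  have hx1 : (1 : ℝ) ≤ x := by exact_mod_cast hx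
  have hD1 : 1 ≤ paramD1 x := Real.one_le_rpow hx1 (by norm_num)
  have hz1 : paramZ1 x ≤ paramD1 x := Real.rpow_le_rpow_of_exponent_le hx1 (by norm_num)
  refine ⟨fun f => thetaCoeff Odd (paramD1 x) (paramD0 x) (paramZ1 x) (paramZ0 x) f *
    Real.log (Real.sqrt x), ?_, ?_⟩
  · intro f
    rw [abs_mul, log_sqrt_eq, abs_of_nonneg (show 0 ≤ Real.log x / 2 by linarith)]
    have h1 := abs_thetaCoeff_le Odd (paramD1 x) (paramD0 x) (paramZ1 x) (paramZ0 x) f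
    nlinarith [abs_nonneg (thetaCoeff Odd (paramD1 x) (paramD0 x) (paramZ1 x) (paramZ0 x) f)]
  · intro l hl
    rw [← sum_divisors_eq_divWeight ?_ hl]
    · unfold omega1 thetaPlus
      rw [theta_eq_sum _ _ _ _ _ (by omega), Finset.sum_mul]
    · intro f hf
      rw [thetaCoeff_eq_zero odd_parity hD1 (one_le_paramD0 x) hz1 (paramZ0_le hL)
        (Nat.lt_of_floor_lt hf), zero_mul]

/-- `ω₂` is a divisor sum of level `D₁ D₀`: the prime `p` is absorbed into the sieve variable, of
level `D₁ D₀ / p`. A given `F = p f` arises from at most `2 log x` primes. -/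
lemma omega2_eq_divWeight {x : ℕ} (hx : 1 ≤ x) (hL : 1 ≤ Real.log x)
    (hG : paramD1 x * paramD0 x ≤ x) :
    ∃ lam : ℕ → ℝ, (∀ f, |lam f| ≤ 2 * Real.log x ^ 2) ∧
      ∀ l : ℕ, 1 ≤ l → omega2 x l = divWeight lam ⌊paramD1 x * paramD0 x⌋₊ l := by
  have hx1 : (1 : ℝ) ≤ x := by exact_mod_cast hx
  have hx0 : (0 : ℝ) < x := by linarith
  set I : ℕ → Prop := fun p => paramZ1 x ≤ (p : ℝ) ∧ (p : ℝ) < paramZ x with hI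
  set tc : ℕ → ℕ → ℝ := fun p f =>
    thetaCoeff Even (paramD1 x / p) (paramD0 x) (paramZ1 x) (paramZ0 x) f with htc
  classical
  set lam : ℕ → ℝ := fun F => -(1 / 2) * (∑ p ∈ F.primeFactors.filter I, tc p (F / p)) *
    Real.log (Real.sqrt x) with hlam
  have hzero : ∀ F, ⌊paramD1 x * paramD0 x⌋₊ < F → lam F = 0 := by
    intro F hF
    have hF' := Nat.lt_of_floor_lt hF
    have : ∑ p ∈ F.primeFactors.filter I, tc p (F / p) = 0 := by
      refine Finset.sum_eq_zero fun p hp => ?_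
      obtain ⟨hp1, hp2, hp3⟩ := Finset.mem_filter.mp hp
      have hpp := Nat.prime_of_mem_primeFactors hp1
      have hp0 : (0 : ℝ) < p := by exact_mod_cast hpp.pos
      -- `z₁ p ≤ z₁ z ≤ D₁`, so that the level `D₁ / p` exceeds the sifting limit `z₁`.
      have hz1 : paramZ1 x ≤ paramD1 x / p := by
        rw [le_div_iff₀ hp0]
        calc paramZ1 x * p ≤ paramZ1 x * paramZ x := by
              gcongr
              exact Real.rpow_nonneg hx0.le _
          _ = (x : ℝ) ^ ((0.183 : ℝ) / 2 + 0.265 / 2) := (Real.rpow_add hx0 _ _).symm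
          _ ≤ paramD1 x := Real.rpow_le_rpow_of_exponent_le hx1 (by norm_num)
      have hD : 1 ≤ paramD1 x / p :=
        le_trans (Real.one_le_rpow hx1 (by norm_num)) hz1
      refine thetaCoeff_eq_zero even_parity hD (one_le_paramD0 x) hz1 (paramZ0_le hL) ?_
      rw [Nat.cast_div (Nat.dvd_of_mem_primeFactors hp1) hp0.ne']
      rw [div_mul_eq_mul_div, div_lt_div_iff_of_pos_right hp0]
      exact hF'
    simp only [hlam]
    rw [this]; simp
  refine ⟨lam, ?_, ?_⟩
  · intro F
    rcases lt_or_ge ⌊paramD1 x * paramD0 x⌋₊ F with hF | hF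
    · rw [hzero F hF, abs_zero]; positivity
    -- `F = 0` has no prime factors.
    rcases Nat.eq_zero_or_pos F with rfl | hF0
    · simp only [hlam]
      simp
      positivity
    have hFx : (F : ℝ) ≤ x := ((Nat.le_floor_iff' hF0.ne').mp hF).trans hG
    have h1 : |∑ p ∈ F.primeFactors.filter I, tc p (F / p)| ≤ 2 * Real.log x := by
      calc _ ≤ ∑ p ∈ F.primeFactors.filter I, |tc p (F / p)| := Finset.abs_sum_le_sum_abs _ _
        _ ≤ ∑ p ∈ F.primeFactors.filter I, (1 : ℝ) :=
          Finset.sum_le_sum fun p _ => abs_thetaCoeff_le _ _ _ _ _ _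
        _ = ((F.primeFactors.filter I).card : ℝ) := by simp
        _ ≤ F.primeFactors.card := by exact_mod_cast Finset.card_filter_le _ _
        _ ≤ 2 * Real.log F := card_primeFactors_le_log hF0.ne'
        _ ≤ 2 * Real.log x := by
          have := Real.log_le_log (by exact_mod_cast hF0) hFx
          linarith
    simp only [hlam]
    rw [abs_mul, abs_mul, log_sqrt_eq, abs_of_nonneg (show 0 ≤ Real.log x / 2 by linarith)]
    rw [abs_neg, abs_of_pos (by norm_num : (0 : ℝ) < 1 / 2)]
    nlinarith [abs_nonneg (∑ p ∈ F.primeFactors.filter I, tc p (F / p))]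
  · intro l hl
    rw [← sum_divisors_eq_divWeight hzero hl]
    unfold omega2
    simp only [hlam]
    rw [← Finset.sum_mul, ← Finset.mul_sum]
    congr 2
    have h1 : ∀ p ∈ l.primeFactors.filter I,
        thetaMinus (l / p) (paramD1 x / p) (paramD0 x) (paramZ1 x) (paramZ0 x)
        = ∑ F ∈ l.divisors.filter (fun F => p ∣ F), tc p (F / p) := by
      intro p hp
      have hp1 := (Finset.mem_filter.mp hp).1
      have hpp := Nat.prime_of_mem_primeFactors hp1
      have hpl := Nat.dvd_of_mem_primeFactors hp1
      have hlp : l / p ≠ 0 := (Nat.div_pos (Nat.le_of_dvd hl hpl) hpp.pos).ne'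
      unfold thetaMinus
      rw [theta_eq_sum _ _ _ _ _ hlp]
      refine Finset.sum_bij (fun f _ => p * f) ?_ ?_ ?_ ?_
      · intro f hf
        rw [Nat.mem_divisors] at hf
        rw [Finset.mem_filter, Nat.mem_divisors]
        exact ⟨⟨(Nat.dvd_div_iff_mul_dvd hpl).mp hf.1, by omega⟩, Dvd.intro _ rfl⟩
      · intro f _ f' _ h
        exact Nat.eq_of_mul_eq_mul_left hpp.pos h
      · intro F hF
        obtain ⟨hF1, f, rfl⟩ := Finset.mem_filter.mp hF
        rw [Nat.mem_divisors] at hF1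
        exact ⟨f, Nat.mem_divisors.mpr ⟨(Nat.dvd_div_iff_mul_dvd hpl).mpr hF1.1, hlp⟩, rfl⟩
      · intro f _
        simp only [htc]
        rw [Nat.mul_div_cancel_left f hpp.pos]
    calc _ = ∑ p ∈ l.primeFactors.filter I,
          ∑ F ∈ l.divisors.filter (fun F => p ∣ F), tc p (F / p) := Finset.sum_congr
            (by ext; simp [hI]) h1
      _ = _ := by
        refine Finset.sum_comm' fun p F => ?_
        simp only [Finset.mem_filter, Nat.mem_divisors, Nat.mem_primeFactors]
        constructor
        · rintro ⟨⟨⟨a, b, c⟩, d⟩, ⟨f, g⟩, h⟩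
          exact ⟨⟨⟨a, h, ne_zero_of_dvd_ne_zero g f⟩, d⟩, f, g⟩
        · rintro ⟨⟨⟨a, h, _⟩, d⟩, f, g⟩
          exact ⟨⟨⟨a, h.trans f, g⟩, d⟩, ⟨f, g⟩, h⟩

/-! ### Removing the congruence condition and Dirichlet approximation -/

/-- The bilinear sum over `d ∈ s`, without a congruence condition. -/
noncomputable def fullSum (ω : ℕ → ℝ) (x : ℕ) (γ : ℝ) (α β : ℕ → ℂ) (s : Finset ℕ) : ℂ :=
  ∑ d ∈ s, β d * ∑ n ∈ (Finset.Icc 1 x).filter (fun n => Nat.Coprime d n),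
      α n * (if d * n ≤ x then e (γ * (d * n : ℕ)) * (sumTwoSquares ω (d * n) : ℂ) else 0)

lemma e_eq_one_iff {t : ℝ} : e t = 1 ↔ ∃ n : ℤ, t = n := by
  constructor
  · intro h
    unfold e at h
    rw [Complex.exp_eq_one_iff] at h
    obtain ⟨n, hn⟩ := h
    refine ⟨n, ?_⟩
    have h2 : (2 * (Real.pi : ℂ) * Complex.I) ≠ 0 := Complex.two_pi_I_ne_zero
    have h3 : (t : ℂ) = (n : ℂ) := by
      apply mul_left_cancel₀ h2
      rw [hn]; ring
    exact_mod_cast h3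
  · rintro ⟨n, rfl⟩
    exact e_intCast n

lemma e_nat_mul (j : ℕ) (t : ℝ) : e (j * t) = e t ^ j := by
  unfold e
  rw [← Complex.exp_nat_mul]; congr 1; push_cast; ring

/-- Orthogonality of the additive characters modulo `W`. -/
lemma sum_e_eq {W : ℕ} (hW : 1 ≤ W) (m b : ℕ) :
    ∑ j ∈ Finset.range W, e (j * (((m : ℝ) - b) / W)) = if m ≡ b [MOD W] then (W : ℂ) else 0 := by
  have hW0 : (W : ℝ) ≠ 0 := by exact_mod_cast (by omega : W ≠ 0)
  simp only [e_nat_mul]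
  have hiff : e (((m : ℝ) - b) / W) = 1 ↔ m ≡ b [MOD W] := by
    rw [e_eq_one_iff, ← Int.natCast_modEq_iff, Int.modEq_comm, Int.modEq_iff_dvd]
    constructor
    · rintro ⟨k, hk⟩
      rw [div_eq_iff hW0] at hk
      refine ⟨k, ?_⟩
      have : ((m : ℝ) - b) = W * k := by rw [hk]; ring
      exact_mod_cast this
    · rintro ⟨k, hk⟩
      refine ⟨k, ?_⟩
      rw [div_eq_iff hW0]
      have : ((m : ℝ) - b) = W * k := by exact_mod_cast congrArg (Int.cast (R := ℝ)) hk
      rw [this]; ring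
  split_ifs with h
  · rw [hiff.mpr h]; simp
  · have h1 : e (((m : ℝ) - b) / W) ≠ 1 := fun h1 => h (hiff.mp h1)
    have h2 : e (((m : ℝ) - b) / W) ^ W = 1 := by
      rw [← e_nat_mul, mul_div_cancel₀ _ hW0]
      have := e_intCast ((m : ℤ) - b)
      push_cast at this
      exact this
    have h3 := geom_sum_mul (e (((m : ℝ) - b) / W)) W
    rw [h2, sub_self] at h3
    exact (mul_eq_zero.mp h3).resolve_right (sub_ne_zero.mpr h1)

/-- The congruence modulo `W` only costs translates of `γ` by multiples of `1 / W`. -/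
lemma norm_typeII_le {ω : ℕ → ℝ} {x W b : ℕ} (hW : 1 ≤ W) {γ : ℝ} {α β : ℕ → ℂ} {U₁ U₂ : ℝ}
    {B : ℝ} (hB : ∀ j < W,
      ‖fullSum ω x (γ + (j : ℝ) / W) α β (Finset.Ico ⌈U₁⌉₊ ⌈U₂⌉₊)‖ ≤ B) :
    ‖typeII U₁ U₂ x α β (cSeq ω x W b γ)‖ ≤ B := by
  have hW0 : (W : ℝ) ≠ 0 := by exact_mod_cast (by omega : W ≠ 0)
  have hW0' : (W : ℂ) ≠ 0 := by exact_mod_cast hW0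
  have hc : ∀ m : ℕ, (W : ℂ) * cSeq ω x W b γ m = ∑ j ∈ Finset.range W, e (-(j * (b : ℝ) / W)) *
      (if m ≤ x then e ((γ + (j : ℝ) / W) * m) * (sumTwoSquares ω m : ℂ) else 0) := by
    intro m
    unfold cSeq
    by_cases hm : m ≤ x
    · simp only [hm, true_and, if_true]
      have h1 : ∀ j : ℕ, e (-(j * (b : ℝ) / W)) *
          (e ((γ + (j : ℝ) / W) * m) * (sumTwoSquares ω m : ℂ))
          = e (j * (((m : ℝ) - b) / W)) * (e (γ * m) * (sumTwoSquares ω m : ℂ)) := by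
        intro j
        rw [← mul_assoc, ← mul_assoc, ← e_add, ← e_add]
        congr 2
        field_simp
        ring
      rw [Finset.sum_congr rfl fun j _ => h1 j, ← Finset.sum_mul, sum_e_eq hW]
      split_ifs <;> simp
    · simp [hm]
  have hmain : (W : ℂ) * typeII U₁ U₂ x α β (cSeq ω x W b γ)
      = ∑ j ∈ Finset.range W, e (-(j * (b : ℝ) / W)) *
        fullSum ω x (γ + (j : ℝ) / W) α β (Finset.Ico ⌈U₁⌉₊ ⌈U₂⌉₊) := by
    unfold typeII fullSum
    simp only [Finset.mul_sum]
    rw [Finset.sum_comm]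
    refine Finset.sum_congr rfl fun d _ => ?_
    rw [Finset.sum_comm]
    refine Finset.sum_congr rfl fun n _ => ?_
    calc (W : ℂ) * (β d * (α n * cSeq ω x W b γ (d * n)))
        = β d * α n * (W * cSeq ω x W b γ (d * n)) := by ring
      _ = _ := by
        rw [hc, Finset.mul_sum]
        exact Finset.sum_congr rfl fun j _ => by ring
  have h2 : (W : ℝ) * ‖typeII U₁ U₂ x α β (cSeq ω x W b γ)‖ ≤ W * B := by
    have h3 := congrArg norm hmain
    rw [norm_mul, Complex.norm_natCast] at h3
    rw [h3]
    calc _ ≤ ∑ j ∈ Finset.range W, B := by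
          refine (norm_sum_le _ _).trans (Finset.sum_le_sum fun j hj => ?_)
          rw [norm_mul, norm_e, one_mul]
          exact hB j (Finset.mem_range.mp hj)
      _ = W * B := by simp
  exact le_of_mul_le_mul_left h2 (by positivity)

/-- A translate of a minor arc point by a fraction with a small denominator has no good rational
approximation with a small denominator. -/
lemma exists_approx {x W : ℕ} {L : ℝ} (hL : L = Real.log x) (hL1 : 1 ≤ L) (hW : 1 ≤ W)
    (hWL : (W : ℝ) ≤ L) (hx : L ^ 1000 ≤ x) {γ : ℝ} (hγ : γ ∈ minorArcs x) (j : ℕ) :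
    ∃ (a : ℤ) (q : ℕ), 1 ≤ q ∧ IsCoprime a (q : ℤ) ∧ L ^ 1000 ≤ q ∧ (q : ℝ) ≤ x / L ^ 1000 ∧
      |γ + (j : ℝ) / W - a / q| ≤ 1 / (q : ℝ) ^ 2 := by
  have hLpos : (0 : ℝ) < L ^ 1000 := by positivity
  have hx0 : (0 : ℝ) < x := lt_of_lt_of_le hLpos hx
  set n := ⌊(x : ℝ) / L ^ 1000⌋₊ with hn
  have hn1 : 0 < n := by
    rw [hn, Nat.floor_pos, one_le_div hLpos]; exact hx
  have hnle : (n : ℝ) ≤ x / L ^ 1000 := Nat.floor_le (by positivity)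
  have hnlt : (x : ℝ) / L ^ 1000 < n + 1 := Nat.lt_floor_add_one _
  obtain ⟨r, hr1, hr2⟩ := Real.exists_rat_abs_sub_le_and_den_le (γ + (j : ℝ) / W) hn1
  have hden : (1 : ℝ) ≤ r.den := by exact_mod_cast r.den_pos
  have hr2' : (r.den : ℝ) ≤ n := by exact_mod_cast hr2
  have hrcast : (r : ℝ) = (r.num : ℝ) / r.den := Rat.cast_def r
  refine ⟨r.num, r.den, r.den_pos, ?_, ?_, hr2'.trans hnle, ?_⟩
  · rw [Int.isCoprime_iff_gcd_eq_one]
    exact r.reduced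
  -- If `q < L ^ 1000`, subtracting `j / W` puts `γ` on a major arc of denominator at most `q W`.
  · by_contra hlt
    push Not at hlt
    apply hγ.2
    set s : ℚ := r - (j : ℚ) / W with hs
    have hsden : s.den ≤ r.den * W := by
      have h1 : s.den ∣ r.den * ((j : ℚ) / W).den := Rat.sub_den_dvd r _
      have h2 : ((j : ℚ) / W).den ∣ W := by
        have := Rat.den_dvd (j : ℤ) (W : ℤ)
        rw [Rat.divInt_eq_div, Int.cast_natCast, Int.cast_natCast] at this
        exact Int.natCast_dvd_natCast.mp this
      exact Nat.le_of_dvd (Nat.mul_pos r.den_pos hW) (h1.trans (Nat.mul_dvd_mul_left _ h2))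
    have hbig : L ^ 1001 ≤ L ^ (10 ^ 5 : ℕ) := pow_le_pow_right₀ hL1 (by norm_num)
    have hbig2 : L ^ 1000 ≤ L ^ (10 ^ 5 : ℕ) := pow_le_pow_right₀ hL1 (by norm_num)
    refine ⟨s.den, s.num, s.den_pos, ?_, ?_, hγ.1, ?_⟩
    · rw [← hL]
      calc (s.den : ℝ) ≤ r.den * W := by exact_mod_cast hsden
        _ ≤ L ^ 1000 * L := by gcongr
        _ = L ^ 1001 := by ring
        _ ≤ _ := hbig
    · rw [Int.isCoprime_iff_gcd_eq_one]
      exact s.reduced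
    · have h1 : ((s.num : ℝ) / s.den) = r - (j : ℝ) / W := by
        rw [← Rat.cast_def, hs]; push_cast; ring
      rw [h1, ← hL]
      calc |γ - (r - (j : ℝ) / W)| = |γ + (j : ℝ) / W - r| := by congr 1; ring
        _ ≤ 1 / ((n + 1) * r.den) := hr1
        _ ≤ 1 / (x / L ^ 1000) := by
            refine one_div_le_one_div_of_le (by positivity) ?_
            nlinarith
        _ = L ^ 1000 / x := by rw [one_div_div]
        _ ≤ _ := by gcongr
  · rw [← hrcast]
    refine hr1.trans (one_div_le_one_div_of_le (by positivity) ?_)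
    rw [sq]
    gcongr
    linarith

/-- Dyadic decomposition of the sum over `d`. -/
lemma norm_fullSum_le {ω : ℕ → ℝ} {x : ℕ} {γ : ℝ} {α β : ℕ → ℂ} {u v J : ℕ} (hu : 1 ≤ u)
    (hv : v ≤ 2 ^ J) {B : ℝ} (hB0 : 0 ≤ B)
    (hB : ∀ D : ℕ, u < 2 * D → D < v → ∀ β' : ℕ → ℂ, (∀ d, ‖β' d‖ ≤ ‖β d‖) →
      ‖bilinearSum ω x γ α β' D‖ ≤ B) :
    ‖fullSum ω x γ α β (Finset.Ico u v)‖ ≤ J * B := by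
  set β' : ℕ → ℂ := fun d => if d ∈ Finset.Ico u v then β d else 0 with hβ'
  have hβ'le : ∀ d, ‖β' d‖ ≤ ‖β d‖ := by
    intro d
    simp only [hβ']
    split_ifs
    · exact le_rfl
    · rw [norm_zero]; exact norm_nonneg _
  set F : (ℕ → ℂ) → ℕ → ℂ := fun b d => b d *
    ∑ n ∈ (Finset.Icc 1 x).filter (fun n => Nat.Coprime d n),
      α n * (if d * n ≤ x then e (γ * (d * n : ℕ)) * (sumTwoSquares ω (d * n) : ℂ) else 0) with hF
  have hFeq : ∀ d ∈ Finset.Ico u v, F β d = F β' d := by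
    intro d hd
    simp only [hF, hβ', if_pos hd]
  have hmaps : ∀ d ∈ Finset.Ico u v, Nat.log 2 d ∈ Finset.range J := by
    intro d hd
    rw [Finset.mem_Ico] at hd
    rw [Finset.mem_range]
    exact Nat.log_lt_of_lt_pow (by omega) (lt_of_lt_of_le hd.2 hv)
  have h1 : fullSum ω x γ α β (Finset.Ico u v) =
      ∑ k ∈ Finset.range J, bilinearSum ω x γ α β' (2 ^ k) := by
    change ∑ d ∈ Finset.Ico u v, F β d =
      ∑ k ∈ Finset.range J, ∑ d ∈ Finset.Ico (2 ^ k) (2 * 2 ^ k), F β' d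
    rw [Finset.sum_congr rfl hFeq, ← Finset.sum_fiberwise_of_maps_to hmaps]
    refine Finset.sum_congr rfl fun k _ => ?_
    refine Finset.sum_subset (fun d hd => ?_) (fun d hd hd' => ?_)
    · obtain ⟨hd1, hd2⟩ := Finset.mem_filter.mp hd
      rw [Finset.mem_Ico] at hd1 ⊢
      have := (Nat.log_eq_iff (b := 2) (m := k) (n := d) (Or.inr ⟨by norm_num, by omega⟩)).mp hd2
      rw [pow_succ] at this
      omega
    · have : d ∉ Finset.Ico u v := by
        intro hc
        apply hd'
        refine Finset.mem_filter.mpr ⟨hc, ?_⟩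
        rw [Finset.mem_Ico] at hd hc
        refine (Nat.log_eq_iff (Or.inr ⟨by norm_num, by omega⟩)).mpr ⟨hd.1, ?_⟩
        rw [pow_succ]; omega
      simp only [hβ', if_neg this, zero_mul]
  rw [h1]
  calc _ ≤ ∑ k ∈ Finset.range J, B := by
        refine (norm_sum_le _ _).trans (Finset.sum_le_sum fun k _ => ?_)
        by_cases hk : u < 2 * 2 ^ k ∧ 2 ^ k < v
        · exact hB _ hk.1 hk.2 β' hβ'le
        · have : bilinearSum ω x γ α β' (2 ^ k) = 0 := by
            refine Finset.sum_eq_zero fun d hd => ?_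
            rw [Finset.mem_Ico] at hd
            have : d ∉ Finset.Ico u v := by
              rw [Finset.mem_Ico]; omega
            simp only [hβ', if_neg this, zero_mul]
          rw [this, norm_zero]
          exact hB0
    _ = J * B := by simp

/-- Chebyshev's bound for the primorial; the factor `0.1` leaves room for the extra factor `2`. -/
lemma paramW_le {x : ℕ} (hL : 16 ≤ Real.log x) : (paramW x : ℝ) ≤ Real.log x := by
  set L := Real.log x with hLdef
  set y : ℝ := 0.1 * Real.log L with hy
  have hlog : 0 ≤ Real.log L := Real.log_nonneg (by linarith)
  have hy0 : 0 ≤ y := by positivity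
  have h1 : primeProd y 0 ≤ 4 ^ ⌊y⌋₊ := by
    refine le_trans (le_of_eq ?_) (primorial_le_four_pow ⌊y⌋₊)
    unfold primeProd primorial
    refine Finset.prod_congr ?_ fun _ _ => rfl
    ext p
    simp only [Finset.mem_filter, Finset.mem_Icc, Finset.mem_range, Nat.cast_pos]
    constructor
    · rintro ⟨⟨_, h2⟩, h3, _⟩; exact ⟨by omega, h3⟩
    · rintro ⟨h2, h3⟩; exact ⟨⟨h3.one_lt.le, by omega⟩, h3, h3.pos⟩
  have h2 : (4 : ℝ) ^ ⌊y⌋₊ ≤ Real.sqrt L := by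
    calc (4 : ℝ) ^ ⌊y⌋₊ = (4 : ℝ) ^ ((⌊y⌋₊ : ℕ) : ℝ) := (Real.rpow_natCast _ _).symm
      _ ≤ (4 : ℝ) ^ y := Real.rpow_le_rpow_of_exponent_le (by norm_num) (Nat.floor_le hy0)
      _ = Real.exp (Real.log 4 * y) := Real.rpow_def_of_pos (by norm_num) _
      _ ≤ Real.exp (Real.log L / 2) := by
          apply Real.exp_le_exp.mpr
          have h4 : Real.log 4 ≤ 4 - 1 := Real.log_le_sub_one_of_pos (by norm_num)
          rw [hy]
          nlinarith
      _ = Real.sqrt L := by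
          rw [← Real.log_sqrt (by linarith), Real.exp_log (Real.sqrt_pos.mpr (by linarith))]
  have h3 : (paramW x : ℝ) = 2 * (primeProd y 0 : ℝ) := by
    unfold paramW; push_cast; rfl
  have h4 : (primeProd y 0 : ℝ) ≤ 4 ^ ⌊y⌋₊ := by exact_mod_cast h1
  have h5 : 2 * Real.sqrt L ≤ L := by
    have h6 : Real.sqrt L * Real.sqrt L = L := Real.mul_self_sqrt (by linarith)
    have h7 : 2 ≤ Real.sqrt L := Real.le_sqrt_of_sq_le (by linarith)
    nlinarith
  rw [h3]
  linarith

lemma one_le_paramW (x : ℕ) : 1 ≤ paramW x := by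
  unfold paramW
  have := primeProd_ne_zero (0.1 * Real.log (Real.log x)) 0
  omega

/-! ### The bilinear sum over a dyadic block -/

/-- `TauBound` with `K` a power of the logarithm. -/
lemma tauBound_log {x : ℕ} {L : ℝ} (hL : L = Real.log x) (hL0 : 2 ^ 15 ≤ L) :
    TauBound (L ^ 16) x := by
  intro N hN
  refine (sum_tau_pow_le 4 x N hN).trans ?_
  rw [← hL, mul_comm]
  have hL1 : 1 ≤ L := le_trans (by norm_num) hL0
  refine mul_le_mul_of_nonneg_right ?_ (Nat.cast_nonneg _)
  calc (1 + L) ^ (2 ^ 4 - 1) ≤ (2 * L) ^ 15 := by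
        norm_num only
        gcongr
        linarith
    _ = 2 ^ 15 * L ^ 15 := by ring
    _ ≤ L * L ^ 15 := by gcongr
    _ = L ^ 16 := by ring

/-- For `γ` with a rational approximation of denominator between `ℓ⁻¹⁰⁰⁰` and `ℓ¹⁰⁰⁰ x`, the
multiples of `γ` up to `N₁` are close to integers about as rarely as equidistribution predicts. -/
lemma card_nearInt_le_of_minor {γ η ℓ x M N₁ : ℝ} {a : ℤ} {q N : ℕ} (hq : 1 ≤ q)
    (haq : IsCoprime a (q : ℤ)) (hγ : |γ - a / q| ≤ 1 / (q : ℝ) ^ 2) (hℓ : 0 < ℓ)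
    (hℓ1 : ℓ ≤ 1 / 2 ^ 15) (hq1 : 1 / (q : ℝ) ≤ ℓ ^ 1000) (hq2 : (q : ℝ) ≤ x * ℓ ^ 1000)
    (hη : 0 ≤ η) (hηℓ : η ≤ ℓ ^ 750) (hN : (N : ℝ) ≤ N₁) (hxN : x ≤ N₁ * M)
    (hM : M * ℓ ^ 900 ≤ 2) (hN₁ : 1 ≤ N₁ * ℓ ^ 1000) :
    ((nearInt γ η N).card : ℝ) ≤ N₁ * ℓ ^ 740 := by
  have hN₁0 : 0 ≤ N₁ := (Nat.cast_nonneg N).trans hN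
  have hq0 : (0 : ℝ) < q := by exact_mod_cast hq
  have hℓ1' : ℓ ≤ 1 := hℓ1.trans (by norm_num)
  have hmono : ∀ m : ℕ, 750 ≤ m → ℓ ^ m ≤ ℓ ^ 750 := fun m hm =>
    pow_le_pow_of_le_one hℓ.le hℓ1' hm
  have t1 : (N : ℝ) * η ≤ N₁ * ℓ ^ 750 := by gcongr
  have t2 : (N : ℝ) * (1 / q) ≤ N₁ * ℓ ^ 750 := by
    have := hmono 1000 (by norm_num)
    calc (N : ℝ) * (1 / q) ≤ N₁ * ℓ ^ 1000 :=
          mul_le_mul hN hq1 (by positivity) hN₁0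
      _ ≤ _ := by gcongr
  have t3 : η * q ≤ 2 * (N₁ * ℓ ^ 750) := by
    calc η * q ≤ ℓ ^ 750 * (x * ℓ ^ 1000) := by gcongr
      _ ≤ ℓ ^ 750 * (N₁ * M * ℓ ^ 1000) := by gcongr
      _ = N₁ * ℓ ^ 850 * (M * ℓ ^ 900) := by ring
      _ ≤ N₁ * ℓ ^ 850 * 2 :=
        mul_le_mul_of_nonneg_left hM (mul_nonneg hN₁0 (pow_nonneg hℓ.le _))
      _ ≤ N₁ * ℓ ^ 750 * 2 := by
        have := hmono 850 (by norm_num)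
        gcongr
      _ = _ := by ring
  have t4 : (1 : ℝ) ≤ N₁ * ℓ ^ 750 := by
    have := hmono 1000 (by norm_num)
    refine hN₁.trans ?_
    gcongr
  calc ((nearInt γ η N).card : ℝ) ≤ (N / q + 1) * (6 * η * q + 9) :=
        card_nearInt_le hq haq hγ hη N
    _ = 6 * (N * η) + 9 * (N * (1 / q)) + 6 * (η * q) + 9 * 1 := by
        field_simp
        ring
    _ ≤ 36 * (N₁ * ℓ ^ 750) := by linarith
    _ = (36 * ℓ ^ 10) * (N₁ * ℓ ^ 740) := by ring
    _ ≤ 1 * (N₁ * ℓ ^ 740) := by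
        have h10 : ℓ ^ 10 ≤ ℓ ^ 1 := pow_le_pow_of_le_one hℓ.le hℓ1' (by norm_num)
        have : 36 * ℓ ^ 10 ≤ 1 := by
          rw [pow_one] at h10
          linarith
        exact mul_le_mul_of_nonneg_right this (mul_nonneg hN₁0 (pow_nonneg hℓ.le _))
    _ = _ := one_mul _

lemma le_of_sq_le_sq_of_nonneg {a b : ℝ} (hb : 0 ≤ b) (h : a ^ 2 ≤ b ^ 2) : a ≤ b :=
  (le_abs_self a).trans (abs_le_of_sq_le_sq h hb)

/-- The sum of `pairTerm` with all parameters powers of `ℓ = 1 / log x`: the saving over the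
trivial bound is `ℓ⁶⁴`. -/
lemma sum_pairTerm_le_of_minor {x D M V G : ℕ} {ℓ γ : ℝ} {a : ℤ} {q : ℕ} (hq : 1 ≤ q)
    (haq : IsCoprime a (q : ℤ)) (hγ : |γ - a / q| ≤ 1 / (q : ℝ) ^ 2) (hℓ : 0 < ℓ)
    (hℓ1 : ℓ ≤ 1 / 2 ^ 15) (hq1 : 1 / (q : ℝ) ≤ ℓ ^ 1000) (hq2 : (q : ℝ) ≤ x * ℓ ^ 1000)
    (hK : TauBound ((ℓ ^ 16)⁻¹) x) (hD : 2 ≤ D) (hM1 : 1 ≤ M * ℓ ^ 900) (hM2 : M * ℓ ^ 900 ≤ 2)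
    (hV : 1 ≤ V) (hPV : 2 * D ≤ V ^ 2) (hx1 : 16 * (D * V ^ 2 * M) ≤ x)
    (hx2 : (x : ℝ) ≤ 16 * (D * V ^ 2 * M) * M) (hx3 : 2 ≤ x * ℓ ^ 1900)
    (hG : (G : ℝ) ≤ V * ℓ ^ 100) :
    ∑ p ∈ normPairs (gaussPrimes D), ∑ v ∈ box V, pairTerm G M (ℓ ^ 150) γ p v
      ≤ D ^ 2 * V ^ 2 * M * ℓ ^ 64 := by
  set P₀ := Nat.sqrt (2 * D) with hP₀
  have hℓ1' : ℓ ≤ 1 := hℓ1.trans (by norm_num)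
  have hM0' : (0 : ℝ) < M := by
    by_contra h
    have : (M : ℝ) = 0 := le_antisymm (not_lt.mp h) (Nat.cast_nonneg _)
    rw [this, zero_mul] at hM1
    linarith
  have hM0 : 1 ≤ M := by exact_mod_cast hM0'
  have hK1 : 1 ≤ (ℓ ^ 16)⁻¹ := (one_le_inv₀ (by positivity)).mpr (pow_le_one₀ hℓ.le hℓ1')
  have hP1 : 1 ≤ P₀ := by
    rw [hP₀, Nat.le_sqrt]
    omega
  have hPD : P₀ ^ 2 ≤ 2 * D := Nat.sqrt_le' _
  have hPD' : (P₀ : ℝ) ^ 2 ≤ 2 * D := by exact_mod_cast hPD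
  have hPD4 : (P₀ : ℝ) ^ 4 ≤ 4 * D ^ 2 := by
    calc (P₀ : ℝ) ^ 4 = ((P₀ : ℝ) ^ 2) ^ 2 := by ring
      _ ≤ (2 * (D : ℝ)) ^ 2 := by gcongr
      _ = _ := by ring
  have hPV' : P₀ ≤ V := by
    refine (Nat.pow_le_pow_iff_left two_ne_zero).mp (hPD.trans hPV)
  have hDVx : 16 * (D * V ^ 2) ≤ x := by
    refine le_trans ?_ hx1
    exact Nat.mul_le_mul_left _ (Nat.le_mul_of_pos_right _ hM0)
  have hVx : 4 * V ^ 2 ≤ x := by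
    refine le_trans ?_ hDVx
    nlinarith [Nat.zero_le (V ^ 2)]
  have hDx : 8 * D ≤ x := by
    refine le_trans ?_ hDVx
    have : 1 ≤ V ^ 2 := Nat.one_le_pow _ _ hV
    nlinarith
  set η : ℝ := 1 / (M * ℓ ^ 150) with hη
  have hη0 : 0 ≤ η := by positivity
  have hηℓ : η ≤ ℓ ^ 750 := by
    rw [hη, div_le_iff₀ (by positivity)]
    calc (1 : ℝ) ≤ M * ℓ ^ 900 := hM1
      _ = _ := by ring
  -- `N` is the largest product `2 h N(v) t` counted by `hitCount`, and `N₁` an upper bound for it.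
  set N : ℕ := 2 * (2 * P₀ ^ 2) * (2 * V ^ 2) * M with hN
  set N₁ : ℝ := 16 * (D * V ^ 2 * M) with hN₁
  have hN₁0 : 0 ≤ N₁ := by positivity
  have hNN₁ : (N : ℝ) ≤ N₁ := by
    rw [hN, hN₁]
    push_cast
    calc _ = 8 * ((P₀ : ℝ) ^ 2 * V ^ 2 * M) := by ring
      _ ≤ 8 * (2 * (D : ℝ) * V ^ 2 * M) := by gcongr
      _ = _ := by ring
  have hNx : N ≤ x := by
    have : N₁ ≤ x := by rw [hN₁]; exact_mod_cast hx1
    exact_mod_cast hNN₁.trans this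
  have hN₁1 : 1 ≤ N₁ * ℓ ^ 1000 := by
    have h1 : (2 : ℝ) ≤ N₁ * ℓ ^ 1000 * 2 := by
      calc (2 : ℝ) ≤ x * ℓ ^ 1900 := hx3
        _ ≤ (N₁ * M) * ℓ ^ 1900 := by gcongr
        _ = N₁ * ℓ ^ 1000 * (M * ℓ ^ 900) := by ring
        _ ≤ _ := by gcongr
    linarith
  have hcard : ((nearInt γ η N).card : ℝ) ≤ N₁ * ℓ ^ 740 :=
    card_nearInt_le_of_minor hq haq hγ hℓ hℓ1 hq1 hq2 hη0 hηℓ hNN₁ hx2 hM2 hN₁1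
  have hZ : ∑ n ∈ nearInt γ η N, tau n ^ 2 ≤ N₁ * ℓ ^ 362 := by
    refine le_of_sq_le_sq_of_nonneg (by positivity) ?_
    calc _ ≤ (ℓ ^ 16)⁻¹ * N * (nearInt γ η N).card := sq_sum_tau_nearInt_le hK γ η hNx
      _ ≤ (ℓ ^ 16)⁻¹ * N₁ * (N₁ * ℓ ^ 740) := by gcongr
      _ = (N₁ * ℓ ^ 362) ^ 2 := by
        field_simp
  have hY : ∑ v ∈ (box V).filter (· ≠ 0), ∑ h ∈ Finset.Icc 1 (2 * P₀ ^ 2),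
      (hitCount γ (1 / (M * ℓ ^ 150)) M h (nrm v).natAbs : ℝ) ≤ 92 * (D * V ^ 2 * M) * ℓ ^ 173 := by
    refine le_of_sq_le_sq_of_nonneg (by positivity) ?_
    calc _ ≤ 132 * V ^ 2 * (ℓ ^ 16)⁻¹ * ((2 * P₀ ^ 2 : ℕ) * M *
          ∑ n ∈ nearInt γ η N, tau n ^ 2) := sq_sum_hitCount_box_le hK hK1 γ _ hV hVx
      _ ≤ 132 * V ^ 2 * (ℓ ^ 16)⁻¹ * ((2 * (2 * D)) * M * (N₁ * ℓ ^ 362)) := by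
        push_cast
        gcongr
      _ = 8448 * ((D * V ^ 2 * M) ^ 2 * ℓ ^ 346) := by
        rw [hN₁]
        field_simp
        ring
      _ ≤ 8464 * ((D * V ^ 2 * M) ^ 2 * ℓ ^ 346) := by gcongr; norm_num
      _ = _ := by ring
  have hl1 : ℓ ^ 2 ≤ 1 / 2 ^ 30 := by
    calc ℓ ^ 2 ≤ (1 / 2 ^ 15) ^ 2 := by gcongr
      _ = _ := by norm_num
  have hl9 : ℓ ^ 9 ≤ ℓ ^ 2 := pow_le_pow_of_le_one hℓ.le hℓ1' (by norm_num)
  have hY2 := sum_weylBound_sq_le hK hK1 (𝒬 := gaussPrimes D) (P₀ := P₀)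
    (Finset.filter_subset _ _) hP1 (by omega) hV (ε := ℓ ^ 150) (by positivity) γ hY
  have hY3 : 729 * (P₀ : ℝ) ^ 4 * V ^ 2 * (2 * M ^ 2 * ℓ ^ 150 + M) + 528 * M * P₀ ^ 2 *
      (ℓ ^ 16)⁻¹ * (92 * (D * V ^ 2 * M) * ℓ ^ 173) ≤ D ^ 2 * V ^ 2 * M ^ 2 * ℓ ^ 148 := by
    have hMM : (M : ℝ) ≤ M ^ 2 * ℓ ^ 150 := by
      have h9 : ℓ ^ 900 ≤ ℓ ^ 150 := pow_le_pow_of_le_one hℓ.le hℓ1' (by norm_num)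
      calc (M : ℝ) = M * 1 := (mul_one _).symm
        _ ≤ M * (M * ℓ ^ 900) := by gcongr
        _ ≤ M * (M * ℓ ^ 150) := by gcongr
        _ = _ := by ring
    calc _ ≤ 729 * (4 * (D : ℝ) ^ 2) * V ^ 2 * (2 * M ^ 2 * ℓ ^ 150 + M ^ 2 * ℓ ^ 150) +
          528 * M * (2 * D) * (ℓ ^ 16)⁻¹ * (92 * (D * V ^ 2 * M) * ℓ ^ 173) := by gcongr
      _ = (8748 * ℓ ^ 2 + 97152 * ℓ ^ 9) * (D ^ 2 * V ^ 2 * M ^ 2 * ℓ ^ 148) := by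
        field_simp
        ring
      _ ≤ 1 * (D ^ 2 * V ^ 2 * M ^ 2 * ℓ ^ 148) := by
        gcongr
        linarith
      _ = _ := one_mul _
  have hT := sum_pairTerm_le hK hK1 (𝒬 := gaussPrimes D) (P₀ := P₀)
    (Finset.filter_subset _ _) (fun ρ hρ => isCoprime_of_mem_gaussPrimes hρ) hP1 (by omega) G
    hPV' (by omega) γ (hY2.trans hY3)
  refine hT.trans ?_
  have hsqrt : Real.sqrt (972 * P₀ ^ 4 * V ^ 2 * (ℓ ^ 16)⁻¹ * (D ^ 2 * V ^ 2 * M ^ 2 * ℓ ^ 148))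
      ≤ 63 * (D ^ 2 * V ^ 2 * M * ℓ ^ 66) := by
    refine Real.sqrt_le_iff.mpr ⟨by positivity, ?_⟩
    calc _ ≤ 972 * (4 * (D : ℝ) ^ 2) * V ^ 2 * (ℓ ^ 16)⁻¹ *
          (D ^ 2 * V ^ 2 * M ^ 2 * ℓ ^ 148) := by gcongr
      _ = 3888 * (D ^ 2 * V ^ 2 * M * ℓ ^ 66) ^ 2 := by
        field_simp
        ring
      _ ≤ 3969 * (D ^ 2 * V ^ 2 * M * ℓ ^ 66) ^ 2 := by gcongr; norm_num
      _ = _ := by ring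
  calc _ ≤ 81 * (4 * (D : ℝ) ^ 2) * (V * ℓ ^ 100) ^ 2 * M +
        432 * (V * ℓ ^ 100) * M * (4 * D ^ 2) * (ℓ ^ 16)⁻¹ ^ 2 * V +
        63 * (D ^ 2 * V ^ 2 * M * ℓ ^ 66) := by gcongr
    _ = (324 * ℓ ^ 136 + 1728 * ℓ ^ 4 + 63 * ℓ ^ 2) * (D ^ 2 * V ^ 2 * M * ℓ ^ 64) := by
        field_simp
        ring
    _ ≤ 1 * (D ^ 2 * V ^ 2 * M * ℓ ^ 64) := by
        have h1 : ℓ ^ 136 ≤ ℓ ^ 2 := pow_le_pow_of_le_one hℓ.le hℓ1' (by norm_num)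
        have h2 : ℓ ^ 4 ≤ ℓ ^ 2 := pow_le_pow_of_le_one hℓ.le hℓ1' (by norm_num)
        gcongr
        linarith
    _ = _ := one_mul _

/-- The saving of a power of `log x` in the bilinear sum over a dyadic block `D < d ≤ 2 D`, where
`c = x ^ (1/3)`: the weights have level `G` slightly below `c`, and `D ≤ c`. -/
lemma norm_bilinearSum_le_of_minor {x D G : ℕ} {L c γ : ℝ} {a : ℤ} {q : ℕ} {ω lam : ℕ → ℝ}
    {α β : ℕ → ℂ} (hL : L = Real.log x) (hL0 : 2 ^ 15 ≤ L) (hcx : c ^ 3 = x) (hcL : L ^ 2000 ≤ c)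
    (hq : 1 ≤ q) (haq : IsCoprime a (q : ℤ)) (hγ : |γ - a / q| ≤ 1 / (q : ℝ) ^ 2)
    (hq1 : L ^ 1000 ≤ q) (hq2 : (q : ℝ) ≤ x / L ^ 1000) (hDL : L ^ 100 ≤ D) (hDc : (D : ℝ) ≤ c)
    (hG : G * (8 * L ^ 1001) ≤ c) (hlam : ∀ f, |lam f| ≤ 2 * L ^ 2)
    (hω : ∀ l : ℕ, 1 ≤ l → ω l = divWeight lam G l)
    (hα : ∀ n, ‖α n‖ ≤ (n.primeFactors.card : ℝ)) (hβ : ∀ d, ‖β d‖ ≤ 1)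
    (hβp : ∀ d, ¬ d.Prime → β d = 0) :
    ‖bilinearSum ω x γ α β D‖ ≤ x / L ^ 28 := by
  have hL1 : 1 ≤ L := le_trans (by norm_num) hL0
  have hLpos : 0 < L := by linarith
  have hc1 : 1 ≤ c := (one_le_pow₀ hL1).trans hcL
  have hc0 : 0 < c := by linarith
  have hLL : ∀ m : ℕ, L ^ m * 2 ^ 15 ≤ L ^ (m + 1) := fun m => by
    rw [pow_succ]
    exact mul_le_mul_of_nonneg_left hL0 (by positivity)
  have hLmono : ∀ m n : ℕ, m ≤ n → L ^ m ≤ L ^ n := fun m n h => pow_le_pow_right₀ hL1 h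
  have hD2 : 2 ≤ D := by
    have h1 : (2 : ℝ) ≤ D := by
      have h2 : L ^ 1 ≤ L ^ 100 := hLmono 1 100 (by norm_num)
      rw [pow_one] at h2
      linarith
    exact_mod_cast h1
  have hD0 : (0 : ℝ) < D := by exact_mod_cast (by omega : 0 < D)
  have hc32 : 32 * L ^ 1800 ≤ c := by
    have h1 : L ^ 1800 * 2 ^ 15 ≤ L ^ 1801 := hLL 1800
    have h2 : L ^ 1801 ≤ L ^ 2000 := hLmono _ _ (by norm_num)
    have h3 : 0 < L ^ 1800 := by positivity
    linarith
  have hc900 : 32 * L ^ 900 ≤ c := by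
    have h2 : L ^ 900 ≤ L ^ 1800 := hLmono _ _ (by norm_num)
    linarith
  have hc4 : 32 ≤ c := by
    have h2 : 1 ≤ L ^ 1800 := one_le_pow₀ hL1
    linarith
  set R := Nat.sqrt (x / D) with hR
  set M := ⌈L ^ 900⌉₊ with hM
  set V := R / M with hV
  have hM1 : L ^ 900 ≤ M := Nat.le_ceil _
  have hM2 : (M : ℝ) ≤ 2 * L ^ 900 := by
    have h1 : (M : ℝ) < L ^ 900 + 1 := Nat.ceil_lt_add_one (by positivity)
    have h2 : 1 ≤ L ^ 900 := one_le_pow₀ hL1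
    linarith
  have hM0' : (0 : ℝ) < M := lt_of_lt_of_le (by positivity) hM1
  have hM0 : 1 ≤ M := by exact_mod_cast hM0'
  -- `R` is about the square root of `x / D ≥ c ^ 2`, hence `V` about `c / log x ^ 900`.
  have hRD : D * R ^ 2 ≤ x :=
    (Nat.mul_le_mul_left D (Nat.sqrt_le' _)).trans (Nat.mul_div_le x D)
  have hRD' : (D : ℝ) * R ^ 2 ≤ x := by exact_mod_cast hRD
  have hxR : (x : ℝ) < D * (R + 1) ^ 2 := by
    have h1 : x / D < (R + 1) ^ 2 := Nat.lt_succ_sqrt' _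
    have h2 : x < D * (R + 1) ^ 2 := by
      rw [Nat.div_lt_iff_lt_mul (by omega)] at h1
      linarith
    exact_mod_cast h2
  have hcR : c < R + 1 := by
    refine lt_of_pow_lt_pow_left₀ 2 (by positivity) ?_
    have h1 : c * c ^ 2 < c * (R + 1) ^ 2 := by
      calc c * c ^ 2 = x := by rw [← hcx]; ring
        _ < D * (R + 1) ^ 2 := hxR
        _ ≤ _ := by gcongr
    exact lt_of_mul_lt_mul_left h1 hc0.le
  have hMR : M ≤ R := by
    have : (M : ℝ) < R + 1 := by linarith
    exact Nat.lt_succ_iff.mp (by exact_mod_cast this)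
  have hV1 : 1 ≤ V := (Nat.one_le_div_iff hM0).mpr hMR
  have hMV : M * V ≤ R := Nat.mul_div_le R M
  have hRMV : R < 2 * M * V := by
    have h1 : R < M * (V + 1) := Nat.lt_mul_div_succ R hM0
    nlinarith
  have hRMV' : (R : ℝ) + 1 ≤ 2 * M * V := by exact_mod_cast hRMV
  have hcV : c ≤ V * (4 * L ^ 900) := by
    calc c ≤ 2 * M * V := by linarith
      _ ≤ 2 * (2 * L ^ 900) * V := by gcongr
      _ = _ := by ring
  have hPV : 2 * D ≤ V ^ 2 := by
    have h1 : 2 * c * (16 * L ^ 1800) ≤ (V : ℝ) ^ 2 * (16 * L ^ 1800) := by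
      calc 2 * c * (16 * L ^ 1800) = c * (32 * L ^ 1800) := by ring
        _ ≤ c * c := by gcongr
        _ ≤ (V * (4 * L ^ 900)) * (V * (4 * L ^ 900)) := by gcongr
        _ = _ := by ring
    have h2 : 2 * c ≤ (V : ℝ) ^ 2 := le_of_mul_le_mul_right h1 (by positivity)
    have h3 : 2 * (D : ℝ) ≤ (V : ℝ) ^ 2 := by linarith
    exact_mod_cast h3
  have hDx : 2 * D ≤ x / D := by
    rw [Nat.le_div_iff_mul_le (by omega)]
    have h1 : 2 * (D : ℝ) ≤ c * c := by
      calc 2 * (D : ℝ) ≤ 32 * c := by linarith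
        _ ≤ c * c := by gcongr
    have : 2 * (D : ℝ) * D ≤ x := by
      calc 2 * (D : ℝ) * D ≤ c * c * c := by gcongr
        _ = x := by rw [← hcx]; ring
    exact_mod_cast this
  have hXD : 8 * D ≤ x := by
    have : 8 * (D : ℝ) ≤ x := by
      calc 8 * (D : ℝ) ≤ 32 * c := by linarith
        _ ≤ c * c := by gcongr
        _ ≤ c * c * c := by
          exact le_mul_of_one_le_right (by positivity) hc1
        _ = x := by rw [← hcx]; ring
    exact_mod_cast this
  have hA : ∀ n ≤ x, (n.primeFactors.card : ℝ) ≤ 2 * L := by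
    intro n hn
    rcases Nat.eq_zero_or_pos n with rfl | hn0
    · simp only [Nat.primeFactors_zero, Finset.card_empty, Nat.cast_zero]
      positivity
    · refine (card_primeFactors_le_log hn0.ne').trans ?_
      rw [hL]
      gcongr
  -- With `ℓ = 1 / L`, all savings are powers of `ℓ`.
  set ℓ := L⁻¹ with hℓdef
  have hℓ : 0 < ℓ := by positivity
  have hLℓ : L * ℓ = 1 := mul_inv_cancel₀ hLpos.ne'
  have hLℓp : ∀ m : ℕ, L ^ m * ℓ ^ m = 1 := fun m => by rw [← mul_pow, hLℓ, one_pow]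
  have hℓ1 : ℓ ≤ 1 / 2 ^ 15 := by
    rw [hℓdef, one_div]
    exact inv_anti₀ (by positivity) hL0
  have hmul : ∀ (m : ℕ) {s t : ℝ}, s ≤ t → s * ℓ ^ m ≤ t * ℓ ^ m := fun m s t h =>
    mul_le_mul_of_nonneg_right h (pow_nonneg hℓ.le _)
  have hq0 : (0 : ℝ) < q := by exact_mod_cast hq
  have hT := sum_pairTerm_le_of_minor (x := x) (D := D) (M := M) (V := V) (G := G) hq haq hγ hℓ hℓ1
    (by
      rw [div_le_iff₀ hq0, mul_comm, ← hLℓp 1000]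
      exact hmul _ hq1)
    (by
      rw [hℓdef, inv_pow, ← div_eq_mul_inv]
      exact hq2)
    (by
      rw [hℓdef, inv_pow, inv_inv]
      exact tauBound_log hL hL0)
    hD2
    (by
      rw [← hLℓp 900]
      exact hmul _ hM1)
    (by
      have := hmul 900 hM2
      rwa [mul_assoc, hLℓp 900, mul_one] at this)
    hV1 hPV
    (by
      have h16 : 16 ≤ M := by
        have h1 : (16 : ℝ) ≤ M := by
          have h2 : L ^ 1 ≤ L ^ 900 := hLmono 1 900 (by norm_num)
          rw [pow_one] at h2
          linarith
        exact_mod_cast h1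
      calc 16 * (D * V ^ 2 * M) ≤ M * (D * V ^ 2 * M) := Nat.mul_le_mul_right _ h16
        _ = D * (M * V) ^ 2 := by ring
        _ ≤ D * R ^ 2 := by gcongr
        _ ≤ x := hRD)
    (by
      calc (x : ℝ) ≤ D * (R + 1) ^ 2 := hxR.le
        _ ≤ D * (2 * M * V) ^ 2 := by gcongr
        _ = 4 * (D * V ^ 2 * M * M) := by ring
        _ ≤ 16 * (D * V ^ 2 * M * M) := by
          gcongr
          norm_num
        _ = _ := by ring)
    (by
      have h1 : 2 * L ^ 1900 ≤ x := by
        have h2 : L ^ 1900 * 2 ^ 15 ≤ L ^ 1901 := hLL 1900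
        have h3 : L ^ 1901 ≤ L ^ 2000 := hLmono _ _ (by norm_num)
        have h4 : 0 < L ^ 1900 := by positivity
        have h5 : c ≤ x := by
          calc c = c ^ 1 := (pow_one c).symm
            _ ≤ c ^ 3 := pow_le_pow_right₀ hc1 (by norm_num)
            _ = x := hcx
        linarith
      have := hmul 1900 h1
      rwa [mul_assoc, hLℓp 1900, mul_one] at this)
    (by
      have h1 : (G : ℝ) * L ^ 100 * (8 * L ^ 901) ≤ V * (8 * L ^ 901) := by
        calc (G : ℝ) * L ^ 100 * (8 * L ^ 901) = G * (8 * L ^ 1001) := by ring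
          _ ≤ c := hG
          _ ≤ V * (4 * L ^ 900) := hcV
          _ ≤ V * (8 * L ^ 901) := by
            have h2 : L ^ 900 ≤ L ^ 901 := hLmono _ _ (by norm_num)
            have h3 : 0 < L ^ 901 := by positivity
            gcongr
            norm_num
      have h2 := hmul 100 (le_of_mul_le_mul_right h1 (by positivity))
      rwa [mul_assoc, hLℓp 100, mul_one] at h2)
  have hmain := sq_bilinearSum_le (tauBound_log hL hL0) (one_le_pow₀ hL1) hlam G hω hD2 hDx hXD
    le_rfl γ (by linarith : 1 ≤ 2 * L) hA hα hβ hβp hV1 hM0 hMV hRMV (ε := ℓ ^ 150)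
    (by positivity) hT
  refine le_of_sq_le_sq_of_nonneg (by positivity) (hmain.trans ?_)
  have hMV' : (M : ℝ) * V ≤ R := by exact_mod_cast hMV
  have e1 : 12672 * (2 * L) * D * (R : ℝ) ^ 2 * (L ^ 16) ^ 2 * (2 * L ^ 2) ^ 2
      ≤ 101376 * (L ^ 37 * ℓ ^ 100) * (D ^ 2 * R ^ 2) := by
    have h1 : (D : ℝ) ≤ D ^ 2 * ℓ ^ 100 := by
      calc (D : ℝ) = D * (L ^ 100 * ℓ ^ 100) := by rw [hLℓp, mul_one]
        _ ≤ D * (D * ℓ ^ 100) := mul_le_mul_of_nonneg_left (hmul 100 hDL) hD0.le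
        _ = _ := by ring
    calc _ = 101376 * L ^ 37 * R ^ 2 * (D : ℝ) := by ring
      _ ≤ 101376 * L ^ 37 * R ^ 2 * (D ^ 2 * ℓ ^ 100) := by gcongr
      _ = _ := by ring
  have e2 : 128 * (2 * L ^ 2) ^ 2 * M * (D ^ 2 * V ^ 2 * M * ℓ ^ 64)
      ≤ 512 * (L ^ 4 * ℓ ^ 64) * ((D : ℝ) ^ 2 * R ^ 2) := by
    calc _ = 512 * (L ^ 4 * ℓ ^ 64) * ((D : ℝ) ^ 2 * (M * V) ^ 2) := by ring
      _ ≤ _ := by gcongr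
  have f1 : L ^ 37 * ℓ ^ 100 ≤ ℓ ^ 60 := by
    calc L ^ 37 * ℓ ^ 100 = (L ^ 37 * ℓ ^ 37) * ℓ ^ 63 := by ring
      _ = ℓ ^ 63 := by rw [hLℓp, one_mul]
      _ ≤ ℓ ^ 60 := pow_le_pow_of_le_one hℓ.le (hℓ1.trans (by norm_num)) (by norm_num)
  have f2 : L ^ 4 * ℓ ^ 64 = ℓ ^ 60 := by
    calc L ^ 4 * ℓ ^ 64 = (L ^ 4 * ℓ ^ 4) * ℓ ^ 60 := by ring
      _ = ℓ ^ 60 := by rw [hLℓp, one_mul]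
  rw [f2] at e2
  have hℓ4 : 407552 * ℓ ^ 2 ≤ 1 := by
    calc 407552 * ℓ ^ 2 ≤ 407552 * (1 / 2 ^ 15) ^ 2 := by gcongr
      _ ≤ 1 := by norm_num
  calc _ ≤ (R : ℝ) ^ 2 * (2 * L) ^ 2 * (101376 * ℓ ^ 60 * (D ^ 2 * R ^ 2) +
        512 * ℓ ^ 60 * (D ^ 2 * R ^ 2)) := by
        refine mul_le_mul_of_nonneg_left (add_le_add (e1.trans ?_) e2) (by positivity)
        gcongr
    _ = 407552 * (L ^ 2 * ℓ ^ 2) * ℓ ^ 58 * (D * R ^ 2) ^ 2 := by ring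
    _ = 407552 * ℓ ^ 2 * (ℓ ^ 56 * (D * R ^ 2) ^ 2) := by
        rw [hLℓp]
        ring
    _ ≤ 1 * (ℓ ^ 56 * (x : ℝ) ^ 2) :=
        mul_le_mul hℓ4 (mul_le_mul_of_nonneg_left
          (pow_le_pow_left₀ (mul_nonneg hD0.le (sq_nonneg _)) hRD' 2) (pow_nonneg hℓ.le _))
          (mul_nonneg (pow_nonneg hℓ.le _) (sq_nonneg _)) zero_le_one
    _ = (x / L ^ 28) ^ 2 := by
        rw [hℓdef]
        field_simp

/-! ### Sizes of the parameters -/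

open Filter Asymptotics

lemma eventually_pow_le_exp (k : ℕ) {C b : ℝ} (hC : 0 < C) (hb : 0 < b) :
    ∀ᶠ L : ℝ in atTop, C * L ^ k ≤ Real.exp (b * L) := by
  have h := (isLittleO_pow_exp_pos_mul_atTop k hb).bound (c := C⁻¹) (by positivity)
  filter_upwards [h] with L hL
  have h1 : L ^ k ≤ C⁻¹ * Real.exp (b * L) := by
    refine (le_abs_self _).trans (hL.trans (le_of_eq ?_))
    rw [Real.norm_eq_abs, abs_of_pos (Real.exp_pos _)]
  calc C * L ^ k ≤ C * (C⁻¹ * Real.exp (b * L)) := by gcongr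
    _ = _ := by field_simp

lemma eventually_log_pow_le :
    ∀ᶠ L : ℝ in atTop, 101 * Real.log L ^ 5 ≤ L := by
  have h := (Real.isLittleO_pow_log_id_atTop (n := 5)).bound (c := 101⁻¹) (by norm_num)
  filter_upwards [h, eventually_ge_atTop 0] with L hL hL0
  have h1 : Real.log L ^ 5 ≤ 101⁻¹ * L := by
    refine (le_abs_self _).trans (hL.trans (le_of_eq ?_))
    rw [id, Real.norm_eq_abs, abs_of_nonneg hL0]
  linarith

lemma eventually_rpow_two_thirds_le {b : ℝ} (hb : 0 < b) :
    ∀ᶠ L : ℝ in atTop, L ^ ((2 : ℝ) / 3) ≤ b * L := by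
  have h := (tendsto_rpow_neg_atTop (by norm_num : (0 : ℝ) < 1 / 3)).eventually_le_const hb
  filter_upwards [h, eventually_gt_atTop 0] with L hL hL0
  calc L ^ ((2 : ℝ) / 3) = L ^ (-((1 : ℝ) / 3)) * L := by
        rw [← Real.rpow_add_one hL0.ne']
        norm_num
    _ ≤ b * L := by gcongr

/-- Inequalities between the parameters, valid for large `x`. The level `D₁ D₀` stays below
`U₂ = x ^ (1/3)` by any power of `log x` thanks to the exponent `10⁻⁷`, and `U₁` exceeds any power
of `log x` since `(log log x) ^ 5 = o(log x)`. -/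
lemma eventually_params : ∀ᶠ x : ℕ in atTop,
    2 ^ 15 ≤ Real.log x ∧ Real.log x ^ 2000 ≤ paramU2 x ∧ 2 * Real.log x ^ 100 ≤ paramU1 x ∧
      paramD1 x * paramD0 x * (8 * Real.log x ^ 1001) ≤ paramU2 x ∧
      paramU2 x ^ 3 = x := by
  have hlog : Tendsto (fun x : ℕ => Real.log x) atTop atTop :=
    Real.tendsto_log_atTop.comp tendsto_natCast_atTop_atTop
  have e1 := hlog.eventually (eventually_ge_atTop (2 ^ 15))
  have e2 := hlog.eventually (eventually_pow_le_exp 2000 one_pos (by norm_num : (0 : ℝ) < 1 / 3))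
  have e3 := hlog.eventually eventually_log_pow_le
  have e4 := hlog.eventually
    (eventually_rpow_two_thirds_le (by norm_num : (0 : ℝ) < 1 / 2 * (1 / 10 ^ 7)))
  have e5 := hlog.eventually (eventually_pow_le_exp 1001 (by norm_num : (0 : ℝ) < 8)
    (by norm_num : (0 : ℝ) < 1 / 2 * (1 / 10 ^ 7)))
  filter_upwards [e1, e2, e3, e4, e5, eventually_ge_atTop 1] with x h1 h2 h3 h4 h5 hx
  have hx0 : (0 : ℝ) < x := by exact_mod_cast hx
  set L := Real.log x with hL
  have hL0 : 0 < L := lt_of_lt_of_le (by norm_num) h1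
  have hpow : ∀ y : ℝ, (x : ℝ) ^ y = Real.exp (L * y) := fun y => Real.rpow_def_of_pos hx0 y
  refine ⟨h1, ?_, ?_, ?_, ?_⟩
  · rw [paramU2, hpow, mul_comm L]
    linarith
  · have hl0 : 0 < Real.log L := Real.log_pos (lt_of_lt_of_le (by norm_num) h1)
    rw [paramU1, hpow]
    calc 2 * L ^ 100 ≤ L * L ^ 100 := by
          gcongr
          exact le_trans (by norm_num) h1
      _ = L ^ 101 := by ring
      _ = Real.exp (101 * Real.log L) := by
          rw [show (101 : ℝ) * Real.log L = (101 : ℕ) * Real.log L by norm_num, Real.exp_nat_mul,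
            Real.exp_log hL0]
      _ ≤ _ := by
          refine Real.exp_le_exp.mpr ?_
          rw [mul_one_div, le_div_iff₀ (by positivity)]
          calc _ = 101 * Real.log L ^ 5 := by ring
            _ ≤ L := h3
  · rw [paramD1, paramD0, paramU2, hpow, hpow, ← hL]
    calc _ ≤ Real.exp (L * (1 / 3 - 1 / 10 ^ 7)) * Real.exp (1 / 2 * (1 / 10 ^ 7) * L) *
          Real.exp (1 / 2 * (1 / 10 ^ 7) * L) := by gcongr
      _ = Real.exp (L * (1 / 3)) := by
          rw [← Real.exp_add, ← Real.exp_add]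
          congr 1
          ring
  · rw [paramU2, ← Real.rpow_natCast, ← Real.rpow_mul hx0.le]
    norm_num

end FouvryIwaniec

theorem lemma5p2 :
    ∃ C : ℝ, 0 < C ∧ ∃ x₀ : ℕ, ∀ x : ℕ, x₀ ≤ x → x % 4 = 3 →
      ∀ b : ℕ, 1 ≤ b → b ≤ FouvryIwaniec.paramW x → Nat.Coprime b (FouvryIwaniec.paramW x) →
        b % 4 = 1 →
      ∀ γ : ℝ, γ ∈ FouvryIwaniec.minorArcs x →
      ∀ α β : ℕ → ℂ, (∀ n, ‖α n‖ ≤ (n.primeFactors.card : ℝ)) → (∀ d, ‖β d‖ ≤ 1) →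
        (∀ d, ¬ d.Prime → β d = 0) →
      ∀ ω : ℕ → ℝ, ω = FouvryIwaniec.omega1 x ∨ ω = FouvryIwaniec.omega2 x →
        ‖FouvryIwaniec.typeII (FouvryIwaniec.paramU1 x) (FouvryIwaniec.paramU2 x) x α β
            (FouvryIwaniec.cSeq ω x (FouvryIwaniec.paramW x) b γ)‖
          ≤ C * ((x : ℝ) / Real.log x ^ 24) := by
  open FouvryIwaniec in
  obtain ⟨x₀, hx₀⟩ := Filter.eventually_atTop.mp eventually_params
  refine ⟨1, one_pos, x₀, fun x hx _ b _ _ _ _ γ hγ α β hα hβ hβp ω hω => ?_⟩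
  obtain ⟨hL0, hcL, hU1, hDD, hc3⟩ := hx₀ x hx
  set L := Real.log x with hL
  set c := paramU2 x with hc
  have hL1 : 1 ≤ L := le_trans (by norm_num) hL0
  have hLpos : 0 < L := by linarith
  have hc1 : 1 ≤ c := (one_le_pow₀ hL1).trans hcL
  have hcx : c ≤ x := by
    calc c = c ^ 1 := (pow_one c).symm
      _ ≤ c ^ 3 := pow_le_pow_right₀ hc1 (by norm_num)
      _ = x := hc3
  have hx1 : 1 ≤ x := by exact_mod_cast hc1.trans hcx
  have hx0 : (0 : ℝ) < x := by linarith
  have hD0 : 0 ≤ paramD1 x * paramD0 x :=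
    mul_nonneg (Real.rpow_nonneg hx0.le _) (Real.exp_pos _).le
  have hGx : paramD1 x * paramD0 x ≤ x := by
    have h1 : 1 ≤ 8 * L ^ 1001 := by
      have : 1 ≤ L ^ 1001 := one_le_pow₀ hL1
      linarith
    exact ((le_mul_of_one_le_right hD0 h1).trans hDD).trans hcx
  obtain ⟨lam, hlam, hωlam⟩ : ∃ lam : ℕ → ℝ, (∀ f, |lam f| ≤ 2 * L ^ 2) ∧
      ∀ l : ℕ, 1 ≤ l → ω l = divWeight lam ⌊paramD1 x * paramD0 x⌋₊ l := by
    rcases hω with rfl | rfl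
    · exact omega1_eq_divWeight hx1 hL1
    · exact omega2_eq_divWeight hx1 hL1 hGx
  have hG : (⌊paramD1 x * paramD0 x⌋₊ : ℝ) * (8 * L ^ 1001) ≤ c :=
    (mul_le_mul_of_nonneg_right (Nat.floor_le hD0) (by positivity)).trans hDD
  have hLx : L ^ 1000 ≤ x :=
    (pow_le_pow_right₀ hL1 (by norm_num)).trans (hcL.trans hcx)
  have hW : (paramW x : ℝ) ≤ L := paramW_le (le_trans (by norm_num) hL0)
  set J := ⌈2 * L⌉₊ with hJ
  have hJ3 : (J : ℝ) ≤ 3 * L := by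
    have : (J : ℝ) < 2 * L + 1 := Nat.ceil_lt_add_one (by positivity)
    linarith
  have hvJ : ⌈c⌉₊ ≤ 2 ^ J := by
    refine (Nat.ceil_le.mpr hcx).trans ?_
    have h1 : (x : ℝ) ≤ 2 ^ J := by
      calc (x : ℝ) = Real.exp L := (Real.exp_log hx0).symm
        _ ≤ Real.exp (Real.log 2 * J) := by
          refine Real.exp_le_exp.mpr ?_
          have h2 : 2 * L ≤ J := Nat.le_ceil _
          nlinarith [Real.log_two_gt_d9]
        _ = 2 ^ J := by
          rw [mul_comm, Real.exp_nat_mul, Real.exp_log two_pos]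
    exact_mod_cast h1
  have hu : 1 ≤ ⌈paramU1 x⌉₊ := by
    refine Nat.one_le_ceil_iff.mpr (lt_of_lt_of_le ?_ hU1)
    positivity
  refine norm_typeII_le (one_le_paramW x) fun j _ => ?_
  obtain ⟨a, q, hq, haq, hq1, hq2, hγq⟩ := exists_approx hL hL1 (one_le_paramW x) hW hLx hγ j
  have hB : ∀ D : ℕ, ⌈paramU1 x⌉₊ < 2 * D → D < ⌈c⌉₊ → ∀ β' : ℕ → ℂ, (∀ d, ‖β' d‖ ≤ ‖β d‖) →
      ‖bilinearSum ω x (γ + (j : ℝ) / paramW x) α β' D‖ ≤ x / L ^ 28 := by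
    intro D hD1 hD2 β' hβ'
    have h1 : (D : ℝ) ≤ c := (Nat.lt_ceil.mp hD2).le
    have h2 : L ^ 100 ≤ D := by
      have h3 : (⌈paramU1 x⌉₊ : ℝ) < 2 * D := by exact_mod_cast hD1
      have h4 : paramU1 x ≤ ⌈paramU1 x⌉₊ := Nat.le_ceil _
      linarith
    exact norm_bilinearSum_le_of_minor hL hL0 hc3 hcL hq haq hγq hq1 hq2 h2 h1 hG hlam hωlam hα
      (fun d => (hβ' d).trans (hβ d)) fun d hd => by
        have := hβ' d
        rw [hβp d hd, norm_zero] at this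
        exact norm_le_zero_iff.mp this
  refine (norm_fullSum_le hu hvJ (by positivity) hB).trans ?_
  -- There are `O(log x)` dyadic blocks.
  calc (J : ℝ) * (x / L ^ 28) ≤ 3 * L * (x / L ^ 28) := by gcongr
    _ = 3 / L ^ 3 * (x / L ^ 24) := by field_simp
    _ ≤ 1 * (x / L ^ 24) := by
        have h3 : 3 / L ^ 3 ≤ 1 := by
          rw [div_le_one (by positivity)]
          have : L ^ 1 ≤ L ^ 3 := pow_le_pow_right₀ hL1 (by norm_num)
          rw [pow_one] at this
          linarith
        gcongr
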